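/- For $\theta=(\theta_1,\theta_2,\theta_3)=(\mu,\sigma,\alpha)$ with $\sigma>0$, $0<\alpha\le 2$, let $$f(x;\theta)=\frac1{2\pi}\int_{-\infty}^{\infty}e^{-itx}\,e^{i\mu t-|\sigma t|^{\alpha}}\,dt$$ be the symmetric stable density, and write $f(x;\alpha)=f(x;0,1,\alpha)$. Let $\gamma$ denote Euler's constant and $\theta_0=(0,1,1)$ the standard Cauchy parameter. (1) Scores. For every real $x$, $f(x;\theta_0)>0$, and $\theta\mapsto\log f(x;\theta)$ is $C^2$ near $\theta_0$. The score functions at $\alpha=1$, $(\mu,\sigma)=(0,1)$, that is, the functions $$h_\mu(x)=\frac1{2\pi f(x;1)}\int_{-\infty}^{\infty} it\,e^{-itx}e^{-|t|}\,dt,\qquad h_\sigma(x)=-\frac1{2\pi f(x;1)}\int_{-\infty}^{\infty} e^{-itx}e^{-|t|}|t|\,dt,$$ $$h_\alpha(x)=-\frac1{2\pi f(x;1)}\int_{-\infty}^{\infty} e^{-itx}e^{-|t|}|t|\log|t|\,dt$$ (all three integrals converge absolutely), are the partial derivatives of $\log f(x;\theta)$ with respect to $\mu,\sigma,\alpha$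 at $\theta_0$, and $$h_\mu(x)=\frac{2x}{x^2+1},\qquad h_\sigma(x)=\frac{x^2-1}{x^2+1},$$ $$h_\alpha(x)=\frac{1-x^2}{x^2+1}\Big[\tfrac12\log(x^2+1)-1+\gamma\Big]+\frac{2x}{x^2+1}\arctan x .$$ (2) Fisher information. The functions $\partial^2\log f(x;\theta)/\partial\theta_i\partial\theta_j|_{\theta=\theta_0}$ are integrable under $f(\cdot;\theta_0)$, and the matrix $I$ with $I_{ij}=-\mathrm E_{\theta_0}\big[\partial^2\log f(x;\theta)/\partial\theta_i\partial\theta_j|_{\theta=\theta_0}\big]$ is $$I_{11}=I_{22}=\tfrac12,\quad I_{12}=I_{21}=I_{13}=I_{31}=0,\quad I_{23}=I_{32}=\tfrac12(1-\gamma-\log 2),\quad I_{33}=\tfrac12\Big\{\tfrac{\pi^2}{6}+(\gamma+\log2-1)^2\Big\}.$$ (3) Asymptotically linear representation. Let $X_1,X_2,\dots$ be i.i.d. with density $f(\cdot;\theta_0)$, let $0<\varepsilon<1$, and let $\hat\theta_n$ be maximum likelihood estimators over $\{\mu\in\mathbb R,\ \sigma>0,\ \varepsilon\le\alpha\le 2\}$,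 in the sense that the probability that $\hat\theta_n$ is not in this set or does not maximize $\theta\mapsto\prod_{j=1}^n f(X_j;\theta)$ over it tends to $0$. Then, with $l_\theta(x)=I^{-1}h_\theta(x)$, where $h_\theta=(h_\mu,h_\sigma,h_\alpha)$, $$\sqrt n\,(\hat\theta_n-\theta_0)=\frac1{\sqrt n}\sum_{j=1}^n l_\theta(X_j)+r_n,\qquad r_n\to0\ \text{in probability}.$$ -/

import Mathlib

open MeasureTheory ProbabilityTheory Filter Topology

noncomputable section

namespace SymmStable

/-- A parameter `θ = (μ, σ, α)`: location `θ 0`, scale `θ 1`, characteristic exponent `θ 2`. -/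
abbrev Param : Type := Fin 3 → ℝ

/-- The standard Cauchy parameter `(μ, σ, α) = (0, 1, 1)`. -/
def cauchyParam : Param := ![0, 1, 1]

/-- The characteristic function `Φ(t; θ) = exp (i μ t - |σ t| ^ α)`. -/
def charFn (θ : Param) (t : ℝ) : ℂ :=
  Complex.exp (Complex.I * (θ 0 : ℂ) * (t : ℂ) - ((|θ 1 * t| ^ θ 2 : ℝ) : ℂ))

/-- The symmetric stable density `f(x; θ)`, by Fourier inversion of its characteristic function:
`f(x; θ) = (2π)⁻¹ ∫ exp (-i t x) Φ(t; θ) dt` (the integral is real; `re` only changes the type). -/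
def density (θ : Param) (x : ℝ) : ℝ :=
  (1 / (2 * Real.pi)) *
    (∫ t : ℝ, Complex.exp (-(Complex.I * (t : ℂ) * (x : ℂ))) * charFn θ t).re

/-- The symmetric stable law with density `f(·; θ)`. -/
def law (θ : Param) : Measure ℝ :=
  volume.withDensity fun x => ENNReal.ofReal (density θ x)

/-- The partial derivative `∂ g / ∂ θᵢ`. -/
def partialDeriv (i : Fin 3) (g : Param → ℝ) (θ : Param) : ℝ :=
  lineDeriv ℝ g θ (Pi.single i 1)

/-- The log-density `log f(x; θ)` of one observation, as a function of `θ`. -/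
def logDensity (x : ℝ) (θ : Param) : ℝ :=
  Real.log (density θ x)

/-- The integrand of `∂² log f(x; θ) / ∂ θᵢ ∂ θⱼ`. -/
def logDensityHess (θ : Param) (i j : Fin 3) (x : ℝ) : ℝ :=
  partialDeriv i (partialDeriv j (logDensity x)) θ

/-- The Fisher information matrix `I_ij(θ) = - E_θ [∂² log f(x; θ) / ∂ θᵢ ∂ θⱼ]`. -/
def fisherInfo (θ : Param) : Matrix (Fin 3) (Fin 3) ℝ :=
  Matrix.of fun i j => -∫ x, logDensityHess θ i j x ∂(law θ)

/-- The gradient `(Φ_μ, Φ_σ, Φ_α)(t; α)` of the characteristic function with respect to `θ`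
at `(μ, σ) = (0, 1)`. -/
def charFnGrad (α t : ℝ) : Fin 3 → ℂ :=
  ![Complex.I * (t : ℂ) * ((Real.exp (-|t| ^ α) : ℝ) : ℂ),
    ((-(Real.exp (-|t| ^ α) * |t| ^ α * α) : ℝ) : ℂ),
    ((-(Real.exp (-|t| ^ α) * |t| ^ α * Real.log |t|) : ℝ) : ℂ)]

/-- The integrand `exp (-i t x) Φ_{θᵢ}(t; α)` of the score functions. -/
def scoreIntegrand (α x : ℝ) (i : Fin 3) (t : ℝ) : ℂ :=
  Complex.exp (-(Complex.I * (t : ℂ) * (x : ℂ))) * charFnGrad α t i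

/-- The maximum likelihood score functions `h_θ(x) = (h_μ(x), h_σ(x), h_α(x))` at `(μ, σ) = (0, 1)`:
`h_{θᵢ}(x) = (2π f(x; α))⁻¹ ∫ exp (-i t x) Φ_{θᵢ}(t; α) dt`. -/
def score (α x : ℝ) (i : Fin 3) : ℂ :=
  (1 / (2 * (Real.pi : ℂ) * (density ![0, 1, α] x : ℂ))) * ∫ t : ℝ, scoreIntegrand α x i t

/-- The function `l_θ(x) = I⁻¹ h_θ(x)` at `(μ, σ) = (0, 1)`; the scores are real. -/
def linearRep (α x : ℝ) : Fin 3 → ℝ :=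
  Matrix.mulVec (fisherInfo ![0, 1, α])⁻¹ (fun i => (score α x i).re)

/-- The parameter space with the characteristic exponent bounded away from `0`:
`-∞ < μ < ∞`, `σ > 0`, `ε ≤ α ≤ 2`. -/
def paramSpace (ε : ℝ) : Set Param :=
  {θ | 0 < θ 1 ∧ ε ≤ θ 2 ∧ θ 2 ≤ 2}

/-- The likelihood of `θ` given the observations `x 0, …, x (n - 1)`. -/
def likelihood (n : ℕ) (x : ℕ → ℝ) (θ : Param) : ℝ :=
  ∏ j ∈ Finset.range n, density θ (x j)

/-- `θ` is a maximum likelihood estimate in `paramSpace ε` from `x 0, …, x (n - 1)`. -/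
def IsMLE (ε : ℝ) (n : ℕ) (x : ℕ → ℝ) (θ : Param) : Prop :=
  θ ∈ paramSpace ε ∧ IsMaxOn (likelihood n x) (paramSpace ε) θ

/-- The estimators `est n` of `θ₀`, based on `X 0, …, X (n - 1)`, have the asymptotically linear
representation `l`: for each coordinate `i`,
`√n (est n - θ₀)ᵢ = n^{-1/2} ∑_{j < n} lᵢ(X j) + r_n` with `r_n → 0` in probability. -/
def HasALRep {Ω : Type*} [MeasurableSpace Ω] (P : Measure Ω) (X : ℕ → Ω → ℝ)
    (est : ℕ → Ω → Param) (θ₀ : Param) (l : ℝ → Fin 3 → ℝ) : Prop :=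
  ∀ i : Fin 3, TendstoInMeasure P
    (fun (n : ℕ) ω => Real.sqrt n * (est n ω i - θ₀ i) -
      (1 / Real.sqrt n) * ∑ j ∈ Finset.range n, l (X j ω) i)
    atTop (fun _ => 0)

end SymmStable

end

open MeasureTheory ProbabilityTheory Filter Topology

noncomputable section

namespace SymmStable

/-! The analysis rests on the half-line integrals `kernInt`, whose integrand is z^a (log σz)^c
(σz)^(bα) exp(-iyz - (σz)^α) on a ray of argument -η. The density is 1/π times the real part of the
case a = b = c = η = 0 with y = x - μ (`density_eq`), and differentiation in (μ, σ, α) only shifts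
the indices and brings in factors α and 1/σ (`hasFDerivAt_kern`, `TailGen.hasFDerivAt`). For y ≥ 0
the ray can be rotated to argument -1/4 (`kernInt_rotate`); there exp(-iyz) decays exponentially,
and this yields the tails. Near the Cauchy parameter the first three orders of derivatives of the
density are O((1 + |x|)^(-31/16)) (`norm_kernInt_tail_le`), while the density is at least a multiple
of (1 + |x|)^(-65/32) (`density_tail_lower`, `exists_density_lower`). Hence the third derivatives of
the log-density are bounded, locally uniformly in θ, by a multiple of (1 + |x|)^(9/32), which is
integrable under the Cauchy law (`DensityDerivs.logDensityDerivs`).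

At α = 1 the transforms are Gamma integrals with complex rate 1 + ix; the logarithm in the α-score
comes from differentiating a Mellin transform (`integral_mul_log_mul_exp_neg`). Differentiating ∫ f
= 1 twice under the integral gives the information identity, so the Fisher matrix is the second
moment matrix of the scores (`DensityDerivs.integral_logHess`). The Cayley transform w carries the
Cauchy law to the uniform law on the unit circle, where the scores are Im w, -Re w and Re(w(c -
log(1 + w))) with c = log 2 - 1 + γ. Their products are integrated by the mean value property of
analytic functions (`cayley_moment`), up to the second moment of arctan.

Consistency follows Wald's method, with fractional moments in place of logarithms: P(∏ G(X_j) ≥ 1) ≤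
(E G^t)^n (`tendsto_measure_one_le_prod`). Small scales, large scales and far locations are excluded
separately, and the remaining compact set is covered by neighbourhoods on which a Hellinger affinity
stays below one (`exists_excluded_nhds`). This uses nonnegativity of the densities, obtained from
Pareto sums (`density_nonneg`), and identifiability, obtained from Fourier inversion
(`density_injective`). Once the estimator is near θ₀ it is an interior maximum, so the score
equation holds; a Taylor expansion, the law of large numbers for the Hessian and Chebyshev's
inequality for the normalized score give the linear representation
(`LogDensityDerivs.exists_expansion`). -/

/-! ### Elementary estimates and an integrable majorant -/

lemma abs_log_add_one_pow_le {ρ : ℝ} (hρ : 0 < ρ) (c : ℕ) :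
    ∃ M : ℝ, 0 < M ∧ ∀ y : ℝ, 0 < y → y ≤ 1 → (|Real.log y| + 1) ^ c ≤ M * y ^ (-ρ) := by
  have hc : (0 : ℝ) < c + 1 := by positivity
  -- Each factor `|log y| + 1` costs a power `r`. Dividing by `c + 1` rather than `c` also covers `c
  -- = 0`, and `c * r ≤ ρ` still holds.
  set r := ρ / (c + 1) with hr
  have hr0 : 0 < r := by positivity
  refine ⟨(1 / r + 1) ^ c, by positivity, fun y hy hy1 => ?_⟩
  have h1 : |Real.log y| + 1 ≤ (1 / r + 1) * y ^ (-r) := by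
    have h := Real.abs_log_mul_self_rpow_lt y r hy hy1 hr0
    have hyr : 0 < y ^ r := Real.rpow_pos_of_pos hy _
    rw [abs_mul, abs_of_pos hyr] at h
    have hyr1 : y ^ r ≤ 1 := Real.rpow_le_one hy.le hy1 hr0.le
    rw [Real.rpow_neg hy.le, ← div_eq_mul_inv, le_div_iff₀ hyr]
    nlinarith
  calc (|Real.log y| + 1) ^ c ≤ ((1 / r + 1) * y ^ (-r)) ^ c := by gcongr
    _ = (1 / r + 1) ^ c * y ^ (-r * c) := by
        rw [mul_pow, ← Real.rpow_natCast (y ^ (-r)), ← Real.rpow_mul hy.le]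
    _ ≤ (1 / r + 1) ^ c * y ^ (-ρ) := by
        refine mul_le_mul_of_nonneg_left (Real.rpow_le_rpow_of_exponent_ge hy hy1 ?_) (by positivity)
        rw [hr, neg_mul, neg_le_neg_iff, div_mul_eq_mul_div, div_le_iff₀ hc]
        nlinarith

lemma abs_log_add_one_le {y : ℝ} (hy : 1 ≤ y) : |Real.log y| + 1 ≤ y := by
  rw [abs_of_nonneg (Real.log_nonneg hy)]
  linarith [Real.log_le_sub_one_of_pos (show 0 < y by linarith)]

/-- An integrable majorant for the integrands of the stable densities and their derivatives. -/
def majorant (s : ℝ) : ℝ := s ^ (-(1 / 2) : ℝ) * (1 + s ^ 2)⁻¹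

lemma majorant_nonneg {s : ℝ} (hs : 0 < s) : 0 ≤ majorant s := by
  unfold majorant; positivity

lemma integrableOn_majorant : IntegrableOn majorant (Set.Ioi 0) := by
  have h1 : IntegrableOn majorant (Set.Ioc 0 1) := by
    have h0 : IntegrableOn (fun s : ℝ => s ^ (-(1 / 2) : ℝ)) (Set.Ioc 0 1) :=
      (intervalIntegrable_iff_integrableOn_Ioc_of_le zero_le_one).1
        (intervalIntegral.intervalIntegrable_rpow' (by norm_num))
    refine h0.mono' ?_ ?_
    · exact (by unfold majorant; fun_prop : Measurable majorant).aestronglyMeasurable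
    · refine (ae_restrict_iff' measurableSet_Ioc).2 (ae_of_all _ fun s hs => ?_)
      rw [Real.norm_of_nonneg (majorant_nonneg hs.1)]
      have : 0 < s ^ (-(1 / 2) : ℝ) := Real.rpow_pos_of_pos hs.1 _
      have h2 : (1 + s ^ 2)⁻¹ ≤ 1 := inv_le_one_of_one_le₀ (by nlinarith [sq_nonneg s])
      unfold majorant; nlinarith
  have h2 : IntegrableOn majorant (Set.Ioi 1) := by
    have h0 := integrable_inv_one_add_sq.integrableOn (s := Set.Ioi (1 : ℝ))
    refine h0.mono' ?_ ?_
    · exact (by unfold majorant; fun_prop : Measurable majorant).aestronglyMeasurable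
    · refine (ae_restrict_iff' measurableSet_Ioi).2 (ae_of_all _ fun s hs => ?_)
      have hs0 : (0 : ℝ) < s := lt_trans one_pos hs
      rw [Real.norm_of_nonneg (majorant_nonneg hs0)]
      have h3 : s ^ (-(1 / 2) : ℝ) ≤ 1 :=
        Real.rpow_le_one_of_one_le_of_nonpos (le_of_lt hs) (by norm_num)
      have h2 : 0 < (1 + s ^ 2)⁻¹ := by positivity
      unfold majorant; nlinarith
  have := h1.union h2
  rwa [Set.Ioc_union_Ioi_eq_Ioi zero_le_one] at this

/-- For y ≤ 1 the factor y^(-1/2) of `majorant` absorbs the logarithms. For y ≥ 1 the exponent may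
be lowered to α₁, and the exponential then beats every power. This makes the constant uniform in α
and q. -/
lemma rpow_mul_log_mul_exp_le {α₁ : ℝ} (hα₁ : 0 < α₁) (N c : ℕ) :
    ∃ C : ℝ, 0 < C ∧ ∀ y α q : ℝ, 0 < y → α₁ ≤ α → 0 ≤ q → q ≤ N →
      y ^ q * (|Real.log y| + 1) ^ c * Real.exp (-(y ^ α / 2)) ≤ C * majorant y := by
  obtain ⟨M, hM, hMb⟩ := abs_log_add_one_pow_le (ρ := 1 / 2) (by norm_num) c
  -- With α₁ k ≥ N + c + 3, the k-th term of the exponential series dominates y^(N+c+3). The three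
  -- extra powers pay for `1 ≤ 2 * y ^ 3 * majorant y`.
  set k := ⌈((N + c + 3 : ℕ) : ℝ) / α₁⌉₊ with hk
  have hkα : ((N + c + 3 : ℕ) : ℝ) ≤ α₁ * k := by
    have := Nat.le_ceil (((N + c + 3 : ℕ) : ℝ) / α₁)
    rw [div_le_iff₀ hα₁] at this
    linarith
  refine ⟨2 * M + 2 * (2 ^ k * k.factorial), by positivity, fun y α q hy hα hq hqN => ?_⟩
  have hmaj := majorant_nonneg hy
  rcases le_total y 1 with h1 | h1
  · have e1 : y ^ q ≤ 1 := Real.rpow_le_one hy.le h1 hq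
    have e2 : Real.exp (-(y ^ α / 2)) ≤ 1 := by
      rw [Real.exp_le_one_iff]; have := Real.rpow_nonneg hy.le α; linarith
    have e3 : y ^ (-(1 / 2) : ℝ) ≤ 2 * majorant y := by
      have h0 : 0 < y ^ (-(1 / 2) : ℝ) := Real.rpow_pos_of_pos hy _
      have : (1 : ℝ) / 2 ≤ (1 + y ^ 2)⁻¹ := by
        rw [one_div]; exact inv_anti₀ (by positivity) (by nlinarith)
      unfold majorant; nlinarith
    calc y ^ q * (|Real.log y| + 1) ^ c * Real.exp (-(y ^ α / 2))
        ≤ 1 * (|Real.log y| + 1) ^ c * 1 := by gcongr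
      _ ≤ M * y ^ (-(1 / 2) : ℝ) := by simpa using hMb y hy h1
      _ ≤ M * (2 * majorant y) := by gcongr
      _ ≤ _ := by nlinarith [mul_nonneg (show (0 : ℝ) ≤ 2 * (2 ^ k * k.factorial) by positivity) hmaj]
  · have e1 : y ^ q ≤ y ^ N := by
      rw [← Real.rpow_natCast]; exact Real.rpow_le_rpow_of_exponent_le h1 hqN
    have e2 : (|Real.log y| + 1) ^ c ≤ y ^ c := by gcongr; exact abs_log_add_one_le h1
    have e4 : Real.exp (-(y ^ α / 2)) ≤ Real.exp (-(y ^ α₁ / 2)) := by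
      gcongr
    have e5 : y ^ (N + c + 3) * Real.exp (-(y ^ α₁ / 2)) ≤ 2 ^ k * k.factorial := by
      have h2 := Real.pow_div_factorial_le_exp (y ^ α₁ / 2) (by positivity) k
      have h3 : y ^ (N + c + 3) ≤ (y ^ α₁) ^ k := by
        rw [← Real.rpow_natCast, ← Real.rpow_natCast, ← Real.rpow_mul hy.le]
        exact Real.rpow_le_rpow_of_exponent_le h1 hkα
      rw [Real.exp_neg, ← div_eq_mul_inv, div_le_iff₀ (Real.exp_pos _)]
      rw [div_le_iff₀ (by positivity), div_pow, div_le_iff₀ (by positivity)] at h2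
      linarith
    have e3 : 1 ≤ 2 * y ^ 3 * majorant y := by
      have h0 : y⁻¹ ≤ y ^ (-(1 / 2) : ℝ) := by
        rw [← Real.rpow_neg_one]; exact Real.rpow_le_rpow_of_exponent_le h1 (by norm_num)
      have h2 : (2 * y ^ 2)⁻¹ ≤ (1 + y ^ 2)⁻¹ := inv_anti₀ (by positivity) (by nlinarith)
      calc (1 : ℝ) = 2 * y ^ 3 * (y⁻¹ * (2 * y ^ 2)⁻¹) := by field_simp
        _ ≤ _ := by unfold majorant; gcongr
    calc y ^ q * (|Real.log y| + 1) ^ c * Real.exp (-(y ^ α / 2))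
        ≤ y ^ N * y ^ c * Real.exp (-(y ^ α₁ / 2)) * 1 := by rw [mul_one]; gcongr
      _ ≤ y ^ N * y ^ c * Real.exp (-(y ^ α₁ / 2)) * (2 * y ^ 3 * majorant y) := by gcongr
      _ = (y ^ (N + c + 3) * Real.exp (-(y ^ α₁ / 2))) * (2 * majorant y) := by ring
      _ ≤ (2 ^ k * k.factorial) * (2 * majorant y) := by gcongr
      _ ≤ _ := by nlinarith [mul_nonneg hM.le hmaj]

lemma rpow_mul_log_le {δ : ℝ} (hδ : 0 < δ) (r : ℝ) (N c : ℕ) :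
    ∃ C : ℝ, 0 < C ∧ ∀ y q : ℝ, 0 < y → r ≤ q → q ≤ N →
      y ^ q * (|Real.log y| + 1) ^ c ≤ C * (y ^ (r - δ) + y ^ (N + c)) := by
  obtain ⟨M, hM, hMb⟩ := abs_log_add_one_pow_le hδ c
  refine ⟨M + 1, by positivity, fun y q hy hq hqN => ?_⟩
  have p1 : 0 < y ^ (r - δ) := Real.rpow_pos_of_pos hy _
  have p2 : 0 < y ^ (N + c) := by positivity
  rcases le_total y 1 with h1 | h1
  · calc y ^ q * (|Real.log y| + 1) ^ c ≤ y ^ r * (M * y ^ (-δ)) := by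
          gcongr ?_ * ?_
          · exact Real.rpow_le_rpow_of_exponent_ge hy h1 hq
          · exact hMb y hy h1
      _ = M * y ^ (r - δ) := by rw [sub_eq_add_neg, Real.rpow_add hy]; ring
      _ ≤ _ := by nlinarith [mul_pos hM p2]
  · calc y ^ q * (|Real.log y| + 1) ^ c ≤ y ^ N * y ^ c := by
          gcongr ?_ * ?_ ^ c
          · rw [← Real.rpow_natCast]; exact Real.rpow_le_rpow_of_exponent_le h1 hqN
          · exact abs_log_add_one_le h1
      _ = y ^ (N + c) := by rw [pow_add]
      _ ≤ _ := by nlinarith [mul_pos hM p2, mul_pos hM p1]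

/-! ### Stable kernels on rays and rotation of the contour -/

/-- The complex logarithm `log (σ z)` at the point `z = s exp (-i η)` of a rotated ray. -/
def ell (η σ s : ℝ) : ℂ := (Real.log (σ * s) : ℂ) - η * Complex.I

/-- The integrands
`z ^ a (log (σ z)) ^ c (σ z) ^ (b α) exp (-i y z - (σ z) ^ α)` at `z = s exp (-i η)`. -/
def kern (a b c : ℕ) (η y σ α s : ℝ) : ℂ :=
  ((s : ℂ) * Complex.exp (-(η * Complex.I))) ^ a * ell η σ s ^ c *
    Complex.exp (b * α * ell η σ s) *
    Complex.exp (-(Complex.I * y * (s * Complex.exp (-(η * Complex.I)))) -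
      Complex.exp (α * ell η σ s))

/-- The integral of `kern` along the ray of argument `-η`. -/
def kernInt (a b c : ℕ) (η y σ α : ℝ) : ℂ :=
  ∫ s in Set.Ioi (0 : ℝ), Complex.exp (-(η * Complex.I)) * kern a b c η y σ α s

lemma norm_exp_neg_mul_I (η : ℝ) : ‖Complex.exp (-(η * Complex.I))‖ = 1 := by
  rw [Complex.norm_exp]; simp

lemma exp_ell {η σ s : ℝ} (hσ : 0 < σ) (hs : 0 < s) (α : ℝ) :
    Complex.exp (α * ell η σ s) = ((σ * s) ^ α : ℝ) * Complex.exp (-((α * η : ℝ) * Complex.I)) := by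
  rw [Real.rpow_def_of_pos (mul_pos hσ hs), Complex.ofReal_exp, ← Complex.exp_add]
  congr 1
  unfold ell
  push_cast
  ring

lemma norm_kern {η σ s : ℝ} (hσ : 0 < σ) (hs : 0 < s) (a b c : ℕ) (y α : ℝ) :
    ‖kern a b c η y σ α s‖ = s ^ a * ‖ell η σ s‖ ^ c * (σ * s) ^ (b * α) *
      Real.exp (-(y * s * Real.sin η) - (σ * s) ^ α * Real.cos (α * η)) := by
  have h1 : (Complex.exp (-(η * Complex.I))).re = Real.cos η := by
    rw [Complex.exp_re]; simp
  have h2 : (Complex.exp (-(η * Complex.I))).im = -Real.sin η := by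
    rw [Complex.exp_im]; simp
  have h3 : (Complex.exp (-((α * η : ℝ) * Complex.I))).re = Real.cos (α * η) := by
    rw [Complex.exp_re]; simp
  unfold kern
  rw [norm_mul, norm_mul, norm_mul, norm_pow, norm_pow, norm_mul, norm_exp_neg_mul_I, mul_one,
    Complex.norm_of_nonneg hs.le]
  congr 1
  · congr 1
    have := exp_ell (η := η) hσ hs (b * α)
    push_cast at this
    rw [this, norm_mul, Complex.norm_of_nonneg (Real.rpow_nonneg (mul_pos hσ hs).le _)]
    have h4 := norm_exp_neg_mul_I (b * α * η)
    push_cast at h4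
    rw [h4, mul_one]
  · rw [Complex.norm_exp, exp_ell hσ hs]
    congr 1
    rw [Complex.sub_re, Complex.neg_re, Complex.re_ofReal_mul, h3]
    congr 2
    rw [mul_assoc, Complex.I_mul_re, Complex.im_ofReal_mul, Complex.im_ofReal_mul, h2]
    ring

lemma norm_ell_le {η σ s : ℝ} (hη : |η| ≤ 1) :
    ‖ell η σ s‖ ≤ |Real.log (σ * s)| + 1 := by
  unfold ell
  refine (norm_sub_le _ _).trans ?_
  rw [norm_mul, Complex.norm_I, mul_one, Complex.norm_real, Complex.norm_real]
  simpa using hη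

lemma half_le_cos_mul {α η : ℝ} (hα : 0 ≤ α) (hα2 : α ≤ 2) (hη : 0 ≤ η) (hη2 : η ≤ 1 / 4) :
    1 / 2 ≤ Real.cos (α * η) := by
  have h1 := Real.one_sub_sq_div_two_le_cos (x := α * η)
  have h2 : α * η ≤ 1 / 2 := by nlinarith
  have h3 : 0 ≤ α * η := by positivity
  nlinarith

/-- The kernels have an integrable majorant, uniformly for bounded parameters. -/
lemma norm_kern_le {α₁ σ₁ σ₂ : ℝ} (hα₁ : 0 < α₁) (hσ₁ : 0 < σ₁) (a b c : ℕ) :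
    ∃ C : ℝ, 0 < C ∧ ∀ η y σ α s : ℝ, 0 ≤ η → η ≤ 1 / 4 → 0 ≤ y * η → σ₁ ≤ σ → σ ≤ σ₂ →
      α₁ ≤ α → α ≤ 2 → 0 < s → ‖kern a b c η y σ α s‖ ≤ C * majorant s := by
  obtain ⟨C, hC, hCb⟩ := rpow_mul_log_mul_exp_le hα₁ (a + 2 * b) c
  -- The cap at 1 gives `σ₀ ^ 2 ≤ 1`, needed to compare 1 + (σs)² with σ₀²(1 + s²).
  set σ₀ := min σ₁ 1 with hσ₀
  have hσ₀p : 0 < σ₀ := lt_min hσ₁ one_pos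
  refine ⟨(σ₀⁻¹) ^ a * C * (σ₀ ^ (-(1 / 2) : ℝ) * (σ₀ ^ 2)⁻¹), by positivity,
    fun η y σ α s hη hη2 hyη hσ hσ2 hα hα2 hs => ?_⟩
  have hσp : 0 < σ := hσ₁.trans_le hσ
  have hσs : 0 < σ * s := mul_pos hσp hs
  have hσσ : σ₀ ≤ σ := (min_le_left _ _).trans hσ
  have hα0 : 0 < α := hα₁.trans_le hα
  rw [norm_kern hσp hs]
  have h1 := norm_ell_le (η := η) (σ := σ) (s := s) (by rw [abs_of_nonneg hη]; linarith)
  -- The hypothesis `0 ≤ y * η` covers two situations at once: the unrotated ray with y of any sign,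
  -- and a properly rotated ray with y ≥ 0.
  have hsin : 0 ≤ y * s * Real.sin η := by
    rcases eq_or_lt_of_le hη with h | h
    · simp [← h]
    · have hy : 0 ≤ y := by by_contra hy; push Not at hy; nlinarith
      have : 0 ≤ Real.sin η := Real.sin_nonneg_of_nonneg_of_le_pi hη (by linarith [Real.pi_gt_three])
      positivity
  have h2 : Real.exp (-(y * s * Real.sin η) - (σ * s) ^ α * Real.cos (α * η)) ≤
      Real.exp (-((σ * s) ^ α / 2)) := by
    have := half_le_cos_mul hα0.le hα2 hη hη2
    have h3 : 0 < (σ * s) ^ α := Real.rpow_pos_of_pos hσs _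
    gcongr
    nlinarith
  have h3 := hCb (σ * s) α (a + b * α) hσs hα (by positivity) (by push_cast; nlinarith [Nat.cast_nonneg (α := ℝ) b])
  have h4 : s ^ a ≤ (σ₀⁻¹) ^ a * (σ * s) ^ (a : ℝ) := by
    rw [Real.rpow_natCast, ← mul_pow]
    gcongr
    rw [← mul_assoc]
    have : 1 ≤ σ₀⁻¹ * σ := by rw [inv_mul_eq_div, le_div_iff₀ hσ₀p]; linarith
    nlinarith
  have h5 : majorant (σ * s) ≤ (σ₀ ^ (-(1 / 2) : ℝ) * (σ₀ ^ 2)⁻¹) * majorant s := by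
    have e1 : (σ * s) ^ (-(1 / 2) : ℝ) ≤ σ₀ ^ (-(1 / 2) : ℝ) * s ^ (-(1 / 2) : ℝ) := by
      rw [← Real.mul_rpow hσ₀p.le hs.le]
      exact Real.rpow_le_rpow_of_nonpos (by positivity) (by gcongr) (by norm_num)
    have e2 : (1 + (σ * s) ^ 2)⁻¹ ≤ (σ₀ ^ 2)⁻¹ * (1 + s ^ 2)⁻¹ := by
      rw [← mul_inv]
      refine inv_anti₀ (by positivity) ?_
      have : σ₀ ^ 2 ≤ 1 := pow_le_one₀ hσ₀p.le (min_le_right _ _)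
      have : σ₀ ^ 2 * s ^ 2 ≤ (σ * s) ^ 2 := by rw [mul_pow]; gcongr
      nlinarith
    calc majorant (σ * s) ≤ (σ₀ ^ (-(1 / 2) : ℝ) * s ^ (-(1 / 2) : ℝ)) * ((σ₀ ^ 2)⁻¹ * (1 + s ^ 2)⁻¹) := by
          unfold majorant; gcongr
      _ = _ := by unfold majorant; ring
  calc s ^ a * ‖ell η σ s‖ ^ c * (σ * s) ^ (b * α) *
      Real.exp (-(y * s * Real.sin η) - (σ * s) ^ α * Real.cos (α * η))
      ≤ ((σ₀⁻¹) ^ a * (σ * s) ^ (a : ℝ)) * (|Real.log (σ * s)| + 1) ^ c * (σ * s) ^ (b * α) *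
        Real.exp (-((σ * s) ^ α / 2)) := by gcongr
    _ = (σ₀⁻¹) ^ a * ((σ * s) ^ (a + b * α) * (|Real.log (σ * s)| + 1) ^ c *
        Real.exp (-((σ * s) ^ α / 2))) := by rw [Real.rpow_add hσs]; ring
    _ ≤ (σ₀⁻¹) ^ a * (C * majorant (σ * s)) := by gcongr
    _ ≤ (σ₀⁻¹) ^ a * (C * ((σ₀ ^ (-(1 / 2) : ℝ) * (σ₀ ^ 2)⁻¹) * majorant s)) := by gcongr
    _ = _ := by ring

lemma measurable_kern (a b c : ℕ) (η y σ α : ℝ) : Measurable (kern a b c η y σ α) := by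
  unfold kern ell; fun_prop

lemma integrableOn_kern {η y σ α : ℝ} (a b c : ℕ) (hη : 0 ≤ η) (hη2 : η ≤ 1 / 4)
    (hyη : 0 ≤ y * η) (hσ : 0 < σ) (hα : 0 < α) (hα2 : α ≤ 2) :
    IntegrableOn (kern a b c η y σ α) (Set.Ioi 0) := by
  obtain ⟨C, hC, h⟩ := norm_kern_le (σ₂ := σ) hα hσ a b c
  refine (integrableOn_majorant.const_mul C).mono' (measurable_kern a b c η y σ α).aestronglyMeasurable ?_
  exact (ae_restrict_iff' measurableSet_Ioi).2 (ae_of_all _ fun s hs =>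
    h η y σ α s hη hη2 hyη le_rfl le_rfl le_rfl hα2 hs)

/-- The kernel `kern` in the logarithmic variable `v = log z`. -/
def logKern (a b c : ℕ) (y : ℝ) (σ α : ℝ) (v : ℂ) : ℂ :=
  Complex.exp (a * v) * (Real.log σ + v) ^ c * Complex.exp (b * α * (Real.log σ + v)) *
    Complex.exp (-(Complex.I * y * Complex.exp v) - Complex.exp (α * (Real.log σ + v)))

/-- In the variable v = log z = log s - iη the kernel on every ray is the restriction of one entire
function, so that its derivatives in the radius and in the angle come from a single complex
derivative. -/
lemma kern_eq_logKern {σ s : ℝ} (hσ : 0 < σ) (hs : 0 < s) (a b c : ℕ) (η y α : ℝ) :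
    kern a b c η y σ α s = logKern a b c y σ α (Real.log s - η * Complex.I) := by
  have h1 : ell η σ s = Real.log σ + (Real.log s - η * Complex.I) := by
    unfold ell; rw [Real.log_mul hσ.ne' hs.ne']; push_cast; ring
  have h2 : (s : ℂ) * Complex.exp (-(η * Complex.I)) =
      Complex.exp (Real.log s - η * Complex.I) := by
    rw [sub_eq_add_neg, Complex.exp_add, ← Complex.ofReal_exp, Real.exp_log hs]
  unfold kern logKern
  rw [h1, h2, ← Complex.exp_nat_mul]

/-- The derivative of `logKern` with respect to the logarithmic variable. -/
def logKernDeriv (a b c : ℕ) (y : ℝ) (σ α : ℝ) (v : ℂ) : ℂ :=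
  a * logKern a b c y σ α v + c * logKern a b (c - 1) y σ α v + b * α * logKern a b c y σ α v -
    Complex.I * y * logKern (a + 1) b c y σ α v - α * logKern a (b + 1) c y σ α v

lemma hasDerivAt_logKern (a b c : ℕ) (y σ α : ℝ) (v : ℂ) :
    HasDerivAt (logKern a b c y σ α) (logKernDeriv a b c y σ α v) v := by
  have hv := hasDerivAt_id v
  have hu : HasDerivAt (fun v : ℂ => (Real.log σ : ℂ) + v) 1 v := hv.const_add _
  have h1 : HasDerivAt (fun v : ℂ => Complex.exp (a * v)) (Complex.exp (a * v) * (a * 1)) v :=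
    (hv.const_mul (a : ℂ)).cexp
  have h2 := hu.pow c
  have h3 := (hu.const_mul ((b : ℂ) * α)).cexp
  have h4 := (((hv.cexp.const_mul (Complex.I * y)).neg).sub (hu.const_mul (α : ℂ)).cexp).cexp
  refine (((h1.mul h2).mul h3).mul h4).congr_deriv ?_
  have e1 : Complex.exp ((a + 1 : ℕ) * v) = Complex.exp (a * v) * Complex.exp v := by
    rw [← Complex.exp_add]; push_cast; ring_nf
  have e2 : Complex.exp ((b + 1 : ℕ) * α * (Real.log σ + v)) =
      Complex.exp (b * α * (Real.log σ + v)) * Complex.exp (α * (Real.log σ + v)) := by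
    rw [← Complex.exp_add]; push_cast; ring_nf
  simp only [logKernDeriv, logKern, e1, e2, Pi.mul_apply, Pi.pow_apply, Pi.neg_apply, Pi.sub_apply, id]
  ring

/-- `d/dv (exp v * logKern v)`, written with `kern`. -/
def rayDeriv (a b c : ℕ) (η y σ α s : ℝ) : ℂ :=
  Complex.exp (-(η * Complex.I)) * ((a + 1 + b * α) * kern a b c η y σ α s +
    c * kern a b (c - 1) η y σ α s - Complex.I * y * kern (a + 1) b c η y σ α s -
    α * kern a (b + 1) c η y σ α s)

lemma hasDerivAt_exp_mul_logKern {σ s : ℝ} (hσ : 0 < σ) (hs : 0 < s) (a b c : ℕ) (η y α : ℝ) :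
    HasDerivAt (fun v => Complex.exp v * logKern a b c y σ α v) (s * rayDeriv a b c η y σ α s)
      (Real.log s - η * Complex.I) := by
  refine ((Complex.hasDerivAt_exp _).mul (hasDerivAt_logKern a b c y σ α _)).congr_deriv ?_
  have h2 : Complex.exp (Real.log s - η * Complex.I) =
      (s : ℂ) * Complex.exp (-(η * Complex.I)) := by
    rw [sub_eq_add_neg, Complex.exp_add, ← Complex.ofReal_exp, Real.exp_log hs]
  unfold rayDeriv logKernDeriv
  simp only [kern_eq_logKern hσ hs, h2]
  ring

lemma exp_mul_logKern_eq {σ s : ℝ} (hσ : 0 < σ) (hs : 0 < s) (a b c : ℕ) (η y α : ℝ) :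
    Complex.exp (Real.log s - η * Complex.I) * logKern a b c y σ α (Real.log s - η * Complex.I) =
      s * (Complex.exp (-(η * Complex.I)) * kern a b c η y σ α s) := by
  rw [kern_eq_logKern hσ hs, sub_eq_add_neg, Complex.exp_add, ← Complex.ofReal_exp,
    Real.exp_log hs]
  ring

/-- Since ∂v/∂η = -i and ∂v/∂s = 1/s, this angular derivative is -i times the radial derivative in
`hasDerivAt_ray_radius`. It is the Cauchy–Riemann relation in polar form. -/
lemma hasDerivAt_ray_angle {σ s : ℝ} (hσ : 0 < σ) (hs : 0 < s) (a b c : ℕ) (η y α : ℝ) :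
    HasDerivAt (fun η : ℝ => Complex.exp (-(η * Complex.I)) * kern a b c η y σ α s)
      (-Complex.I * rayDeriv a b c η y σ α s) η := by
  have h1 : HasDerivAt (fun η : ℝ => (Real.log s : ℂ) - η * Complex.I) (-Complex.I) η := by
    simpa using ((Complex.ofRealCLM.hasDerivAt (x := η)).mul_const Complex.I).const_sub (Real.log s : ℂ)
  have h2 := ((hasDerivAt_exp_mul_logKern hσ hs a b c η y α).scomp η h1).const_mul ((s : ℂ)⁻¹)
  have hs' : (s : ℂ) ≠ 0 := by exact_mod_cast hs.ne'
  refine (h2.congr_of_eventuallyEq (Eventually.of_forall fun t => ?_)).congr_deriv ?_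
  · simp only [Function.comp]
    rw [exp_mul_logKern_eq hσ hs]
    field_simp
  · simp only [smul_eq_mul]; field_simp

lemma hasDerivAt_ray_radius {σ s : ℝ} (hσ : 0 < σ) (hs : 0 < s) (a b c : ℕ) (η y α : ℝ) :
    HasDerivAt (fun s : ℝ => s * (Complex.exp (-(η * Complex.I)) * kern a b c η y σ α s))
      (rayDeriv a b c η y σ α s) s := by
  have h1 : HasDerivAt (fun s : ℝ => (Real.log s : ℂ) - η * Complex.I) ((s⁻¹ : ℝ) : ℂ) s :=
    ((Real.hasDerivAt_log hs.ne').ofReal_comp).sub_const _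
  have h2 := (hasDerivAt_exp_mul_logKern hσ hs a b c η y α).scomp s h1
  have hs' : (s : ℂ) ≠ 0 := by exact_mod_cast hs.ne'
  refine (h2.congr_of_eventuallyEq ?_).congr_deriv ?_
  · filter_upwards [eventually_gt_nhds hs] with t ht
    simp only [Function.comp]
    rw [exp_mul_logKern_eq hσ ht]
  · simp only [smul_eq_mul]; push_cast; field_simp

lemma norm_rayDeriv_le {σ α : ℝ} (y : ℝ) (hσ : 0 < σ) (hα : 0 < α) (hα2 : α ≤ 2) (a b c : ℕ) :
    ∃ C : ℝ, ∀ η s : ℝ, 0 ≤ η → η ≤ 1 / 4 → 0 ≤ y * η → 0 < s →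
      ‖rayDeriv a b c η y σ α s‖ ≤ C * majorant s := by
  obtain ⟨C1, hC1, h1⟩ := norm_kern_le (σ₂ := σ) hα hσ a b c
  obtain ⟨C2, hC2, h2⟩ := norm_kern_le (σ₂ := σ) hα hσ a b (c - 1)
  obtain ⟨C3, hC3, h3⟩ := norm_kern_le (σ₂ := σ) hα hσ (a + 1) b c
  obtain ⟨C4, hC4, h4⟩ := norm_kern_le (σ₂ := σ) hα hσ a (b + 1) c
  refine ⟨‖(a + 1 + b * α : ℂ)‖ * C1 + c * C2 + |y| * C3 + α * C4, fun η s hη hη2 hy hs => ?_⟩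
  have g1 := h1 η y σ α s hη hη2 hy le_rfl le_rfl le_rfl hα2 hs
  have g2 := h2 η y σ α s hη hη2 hy le_rfl le_rfl le_rfl hα2 hs
  have g3 := h3 η y σ α s hη hη2 hy le_rfl le_rfl le_rfl hα2 hs
  have g4 := h4 η y σ α s hη hη2 hy le_rfl le_rfl le_rfl hα2 hs
  unfold rayDeriv
  generalize (a + 1 + b * α : ℂ) = A
  rw [norm_mul, norm_exp_neg_mul_I, one_mul]
  refine (norm_sub_le _ _).trans ?_
  refine (add_le_add_left (norm_sub_le _ _) _).trans ?_
  refine (add_le_add_left (add_le_add_left (norm_add_le _ _) _) _).trans ?_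
  simp only [norm_mul, Complex.norm_I, one_mul, Complex.norm_real, Real.norm_eq_abs,
    Complex.norm_natCast, abs_of_pos hα, add_mul, mul_assoc]
  gcongr

lemma measurable_rayDeriv (a b c : ℕ) (η y σ α : ℝ) : Measurable (rayDeriv a b c η y σ α) := by
  unfold rayDeriv
  have h1 := measurable_kern a b c η y σ α
  have h2 := measurable_kern a b (c - 1) η y σ α
  have h3 := measurable_kern (a + 1) b c η y σ α
  have h4 := measurable_kern a (b + 1) c η y σ α
  fun_prop

lemma tendsto_mul_majorant_zero : Tendsto (fun s : ℝ => s * majorant s) (𝓝[>] 0) (𝓝 0) := by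
  have h : Tendsto (fun s : ℝ => s ^ (1 / 2 : ℝ)) (𝓝[>] 0) (𝓝 0) := by
    have := (Real.continuousAt_rpow_const 0 (1 / 2 : ℝ) (Or.inr (by norm_num))).tendsto
    rw [Real.zero_rpow (by norm_num)] at this
    exact this.mono_left nhdsWithin_le_nhds
  refine squeeze_zero' ?_ ?_ h
  · filter_upwards [self_mem_nhdsWithin] with s hs
    exact mul_nonneg (le_of_lt hs) (majorant_nonneg hs)
  · filter_upwards [self_mem_nhdsWithin] with s hs
    have hs : 0 < s := hs
    have h1 : s * s ^ (-(1 / 2) : ℝ) = s ^ (1 / 2 : ℝ) := by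
      nth_rewrite 1 [← Real.rpow_one s]; rw [← Real.rpow_add hs]; norm_num
    have h2 : (1 + s ^ 2)⁻¹ ≤ 1 := inv_le_one_of_one_le₀ (by nlinarith [sq_nonneg s])
    unfold majorant
    rw [← mul_assoc, h1]
    have : 0 < s ^ (1 / 2 : ℝ) := Real.rpow_pos_of_pos hs _
    nlinarith

lemma tendsto_mul_majorant_atTop : Tendsto (fun s : ℝ => s * majorant s) atTop (𝓝 0) := by
  refine squeeze_zero' ?_ ?_ tendsto_inv_atTop_zero
  · filter_upwards [eventually_gt_atTop 0] with s hs
    exact mul_nonneg (le_of_lt hs) (majorant_nonneg hs)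
  · filter_upwards [eventually_ge_atTop 1] with s hs
    have h1 : s ^ (-(1 / 2) : ℝ) ≤ 1 := Real.rpow_le_one_of_one_le_of_nonpos hs (by norm_num)
    have h2 : (1 + s ^ 2)⁻¹ ≤ (s ^ 2)⁻¹ := inv_anti₀ (by positivity) (by linarith)
    calc s * majorant s ≤ s * (1 * (s ^ 2)⁻¹) := by
          unfold majorant; gcongr
      _ = s⁻¹ := by field_simp

/-- `rayDeriv` is the radial derivative of s exp(-iη) `kern`, and this primitive vanishes at both
ends because s · `majorant` does. Together with `hasDerivAt_ray_angle` this shows that `kernInt`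
does not depend on the angle, which replaces Cauchy's theorem on a sector. -/
lemma integral_rayDeriv {η y σ α : ℝ} (a b c : ℕ) (hη : 0 ≤ η) (hη2 : η ≤ 1 / 4)
    (hyη : 0 ≤ y * η) (hσ : 0 < σ) (hα : 0 < α) (hα2 : α ≤ 2) :
    ∫ s in Set.Ioi (0 : ℝ), rayDeriv a b c η y σ α s = 0 := by
  obtain ⟨C, hC⟩ := norm_rayDeriv_le y hσ hα hα2 a b c
  obtain ⟨C', hC', hb⟩ := norm_kern_le (σ₂ := σ) hα hσ a b c
  have hint : IntegrableOn (rayDeriv a b c η y σ α) (Set.Ioi 0) :=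
    (integrableOn_majorant.const_mul C).mono' (measurable_rayDeriv a b c η y σ α).aestronglyMeasurable
      ((ae_restrict_iff' measurableSet_Ioi).2 (ae_of_all _ fun s hs => hC η s hη hη2 hyη hs))
  have hle : ∀ s : ℝ, 0 < s → ‖(s : ℂ) * (Complex.exp (-(η * Complex.I)) * kern a b c η y σ α s)‖ ≤
      C' * (s * majorant s) := by
    intro s hs
    rw [norm_mul, norm_mul, norm_exp_neg_mul_I, one_mul, Complex.norm_of_nonneg hs.le]
    have := hb η y σ α s hη hη2 hyη le_rfl le_rfl le_rfl hα2 hs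
    calc s * ‖kern a b c η y σ α s‖ ≤ s * (C' * majorant s) := by gcongr
      _ = _ := by ring
  have key := integral_Ioi_of_hasDerivAt_of_tendsto (a := 0) (m := 0)
    (f := fun s : ℝ => s * (Complex.exp (-(η * Complex.I)) * kern a b c η y σ α s))
    ?_ (fun s hs => hasDerivAt_ray_radius hσ hs a b c η y α) hint ?_
  · simpa using key
  · rw [← continuousWithinAt_Ioi_iff_Ici]
    unfold ContinuousWithinAt
    simp only [Complex.ofReal_zero, zero_mul]
    refine squeeze_zero_norm' ?_ (by simpa using tendsto_mul_majorant_zero.const_mul C')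
    filter_upwards [self_mem_nhdsWithin] with s hs using hle s hs
  · refine squeeze_zero_norm' ?_ (by simpa using tendsto_mul_majorant_atTop.const_mul C')
    filter_upwards [eventually_gt_atTop 0] with s hs using hle s hs

lemma continuousOn_kernInt_angle {y σ α : ℝ} (a b c : ℕ)
    (hy : 0 ≤ y) (hσ : 0 < σ) (hα : 0 < α) (hα2 : α ≤ 2) :
    ContinuousOn (fun η => kernInt a b c η y σ α) (Set.Icc 0 (1 / 4)) := by
  obtain ⟨C', hC', hb⟩ := norm_kern_le (σ₂ := σ) hα hσ a b c
  refine continuousOn_of_dominated (bound := fun s => C' * majorant s) ?_ ?_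
    (integrableOn_majorant.const_mul C') ?_
  · intro η _
    exact ((measurable_kern a b c η y σ α).const_mul _).aestronglyMeasurable
  · intro η hη
    refine (ae_restrict_iff' measurableSet_Ioi).2 (ae_of_all _ fun s hs => ?_)
    rw [norm_mul, norm_exp_neg_mul_I, one_mul]
    exact hb η y σ α s hη.1 hη.2 (mul_nonneg hy hη.1) le_rfl le_rfl le_rfl hα2 hs
  · refine (ae_restrict_iff' measurableSet_Ioi).2 (ae_of_all _ fun s hs => ?_)
    exact fun η _ => (hasDerivAt_ray_angle hσ hs a b c η y α).continuousAt.continuousWithinAt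

/-- Rotation of the ray of integration. -/
lemma kernInt_rotate {η y σ α : ℝ} (a b c : ℕ) (hη : 0 ≤ η) (hη2 : η ≤ 1 / 4)
    (hy : 0 ≤ y) (hσ : 0 < σ) (hα : 0 < α) (hα2 : α ≤ 2) :
    kernInt a b c η y σ α = kernInt a b c 0 y σ α := by
  obtain ⟨C, hC⟩ := norm_rayDeriv_le y hσ hα hα2 a b c
  have hderiv : ∀ η' ∈ Set.Ioo 0 η, HasDerivAt (fun η => kernInt a b c η y σ α) 0 η' := by
    intro η' hη'
    have hmem : ∀ t ∈ Set.Ioo (0 : ℝ) (1 / 4), 0 ≤ t ∧ t ≤ 1 / 4 ∧ 0 ≤ y * t := fun t ht =>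
      ⟨ht.1.le, ht.2.le, mul_nonneg hy ht.1.le⟩
    have hη'm : η' ∈ Set.Ioo (0 : ℝ) (1 / 4) := ⟨hη'.1, hη'.2.trans_le hη2⟩
    obtain ⟨m1, m2, m3⟩ := hmem η' hη'm
    have := (hasDerivAt_integral_of_dominated_loc_of_deriv_le (μ := volume.restrict (Set.Ioi (0 : ℝ)))
      (F := fun (η : ℝ) s => Complex.exp (-(η * Complex.I)) * kern a b c η y σ α s)
      (F' := fun (η : ℝ) s => -Complex.I * rayDeriv a b c η y σ α s) (x₀ := η')
      (bound := fun s => C * majorant s)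
      (Ioo_mem_nhds hη'm.1 hη'm.2)
      (Eventually.of_forall fun t => ((measurable_kern a b c t y σ α).const_mul _).aestronglyMeasurable)
      ((integrableOn_kern a b c m1 m2 m3 hσ hα hα2).const_mul _)
      ((measurable_rayDeriv a b c η' y σ α).const_mul _).aestronglyMeasurable
      ((ae_restrict_iff' measurableSet_Ioi).2 (ae_of_all _ fun s hs t ht => by
        obtain ⟨m1, m2, m3⟩ := hmem t ht
        simpa using hC t s m1 m2 m3 hs))
      (integrableOn_majorant.const_mul C)
      ((ae_restrict_iff' measurableSet_Ioi).2 (ae_of_all _ fun s hs t ht =>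
        hasDerivAt_ray_angle hσ hs a b c t y α))).2
    rw [integral_const_mul, integral_rayDeriv a b c m1 m2 m3 hσ hα hα2, mul_zero] at this
    exact this
  have h := intervalIntegral.integral_eq_sub_of_hasDerivAt_of_le hη
    ((continuousOn_kernInt_angle a b c hy hσ hα hα2).mono (Set.Icc_subset_Icc_right hη2))
    hderiv (by simp)
  simp only [intervalIntegral.integral_zero] at h
  exact (sub_eq_zero.1 h.symm)

/-- Rotation towards negative arguments needs y ≥ 0. This symmetry transfers norms and real parts to
negative y. -/
lemma kernInt_neg (a b c : ℕ) (y σ α : ℝ) :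
    kernInt a b c 0 (-y) σ α = (starRingEnd ℂ) (kernInt a b c 0 y σ α) := by
  unfold kernInt
  rw [← integral_conj]
  congr 1
  ext s
  simp only [kern, ell, map_mul, map_pow, ← Complex.exp_conj, map_sub, map_neg, Complex.conj_ofReal,
    Complex.conj_I, map_natCast]
  push_cast
  simp

lemma norm_kernInt_abs (a b c : ℕ) (y σ α : ℝ) :
    ‖kernInt a b c 0 |y| σ α‖ = ‖kernInt a b c 0 y σ α‖ := by
  rcases abs_choice y with h | h <;> rw [h]
  rw [kernInt_neg, RCLike.norm_conj]

lemma norm_kernInt_le {α₁ σ₁ σ₂ : ℝ} (hα₁ : 0 < α₁) (hσ₁ : 0 < σ₁) (a b c : ℕ) :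
    ∃ C : ℝ, 0 < C ∧ ∀ y σ α : ℝ, σ₁ ≤ σ → σ ≤ σ₂ → α₁ ≤ α → α ≤ 2 →
      ‖kernInt a b c 0 y σ α‖ ≤ C := by
  obtain ⟨C, hC, h⟩ := norm_kern_le (σ₂ := σ₂) hα₁ hσ₁ a b c
  have hm : 0 ≤ ∫ s in Set.Ioi (0 : ℝ), majorant s :=
    setIntegral_nonneg measurableSet_Ioi fun s hs => majorant_nonneg hs
  refine ⟨C * (∫ s in Set.Ioi (0 : ℝ), majorant s) + 1, by positivity,
    fun y σ α hσ hσ2 hα hα2 => ?_⟩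
  have := norm_integral_le_of_norm_le (μ := volume.restrict (Set.Ioi (0 : ℝ)))
    (f := fun s => Complex.exp (-((0 : ℝ) * Complex.I)) * kern a b c 0 y σ α s)
    (integrableOn_majorant.const_mul C) ((ae_restrict_iff' measurableSet_Ioi).2
      (ae_of_all _ fun s hs => by
        rw [norm_mul, norm_exp_neg_mul_I, one_mul]
        exact h 0 y σ α s le_rfl (by norm_num) (by simp) hσ hσ2 hα hα2 hs))
  rw [integral_const_mul C] at this
  exact this.trans (by linarith)

/-! ### Tail bounds for the kernel integrals with exponent near one -/

lemma integrableOn_rpow_mul_exp_neg {q r : ℝ} (hq : -1 < q) (hr : 0 < r) :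
    IntegrableOn (fun s : ℝ => s ^ q * Real.exp (-(r * s))) (Set.Ioi 0) := by
  simpa using integrableOn_rpow_mul_exp_neg_mul_rpow hq one_pos hr

lemma integral_rpow_mul_exp_neg {q r : ℝ} (hq : -1 < q) (hr : 0 < r) :
    ∫ s in Set.Ioi (0 : ℝ), s ^ q * Real.exp (-(r * s)) = (1 / r) ^ (q + 1) * Real.Gamma (q + 1) := by
  simpa using Real.integral_rpow_mul_exp_neg_mul_Ioi (a := q + 1) (by linarith) hr

lemma fifth_lt_sin_quarter : (1 : ℝ) / 5 < Real.sin (1 / 4) := by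
  have := Real.sin_gt_sub_cube (x := 1 / 4) (by norm_num)
  norm_num at this ⊢
  linarith

/-- Tail bound for the derivatives of stable densities with exponent near `1`. -/
lemma norm_kernInt_tail_le (a b c : ℕ) (hab : 1 ≤ a + b) :
    ∃ C : ℝ, 0 < C ∧ ∀ y σ α : ℝ, 1 / 2 ≤ σ → σ ≤ 2 → 31 / 32 ≤ α → α ≤ 2 →
      ‖kernInt a b c 0 y σ α‖ ≤ C * (1 + |y|) ^ (-(31 / 16) : ℝ) := by
  obtain ⟨C₁, hC₁, h₁⟩ := norm_kernInt_le (α₁ := 31 / 32) (σ₁ := 1 / 2) (σ₂ := 2)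
    (by norm_num) (by norm_num) a b c
  -- As `a + b ≥ 1` and α ≥ 31/32, the total power of s is at least 31/32. The logarithms cost 1/32,
  -- leaving s^(15/16), whose integral against exponential decay of rate |y|/5 is of order
  -- |y|^(-31/16).
  obtain ⟨C₂, hC₂, h₂⟩ := rpow_mul_log_le (δ := 1 / 32) (by norm_num) (31 / 32) (a + 2 * b) c
  set N := a + 2 * b + c with hN
  have hN1 : 1 ≤ N := by omega
  set B : ℝ := 2 ^ a * C₂ * 2 ^ N with hB
  set C₃ : ℝ := B * (5 ^ (31 / 16 : ℝ) * Real.Gamma (31 / 16) + 5 ^ (N + 1 : ℝ) * Real.Gamma (N + 1))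
    with hC₃
  have hG1 : 0 < Real.Gamma (31 / 16) := Real.Gamma_pos_of_pos (by norm_num)
  have hG2 : 0 < Real.Gamma (N + 1) := Real.Gamma_pos_of_pos (by positivity)
  have hC₃p : 0 < C₃ := by positivity
  refine ⟨4 * (C₁ + C₃), by positivity, fun y σ α hσ hσ2 hα hα2 => ?_⟩
  have hσp : 0 < σ := by linarith
  have hαp : 0 < α := by linarith
  have hfour : (1 : ℝ) ≤ 4 * 2 ^ (-(31 / 16) : ℝ) := by
    have : (2 : ℝ) ^ (-(2 : ℝ)) ≤ 2 ^ (-(31 / 16) : ℝ) :=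
      Real.rpow_le_rpow_of_exponent_le (by norm_num) (by norm_num)
    rw [Real.rpow_neg (by norm_num)] at this
    norm_num at this ⊢
    linarith
  rcases le_total |y| 1 with h1 | h1
  · have h2 : (2 : ℝ) ^ (-(31 / 16) : ℝ) ≤ (1 + |y|) ^ (-(31 / 16) : ℝ) :=
      Real.rpow_le_rpow_of_nonpos (by positivity) (by linarith) (by norm_num)
    have h3 := h₁ y σ α hσ hσ2 hα hα2
    have h5 : 0 < (1 + |y|) ^ (-(31 / 16) : ℝ) := Real.rpow_pos_of_pos (by positivity) _
    nlinarith [mul_pos hC₃p h5]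
  · rw [← norm_kernInt_abs]
    set x := |y| with hx
    have hxp : 0 < x := by linarith
    have hr : 0 < x / 5 := by positivity
    -- On the ray of argument -1/4 the oscillating factor has modulus exp(-x s sin(1/4)), at most
    -- exp(-xs/5), while α/4 ≤ 1/2 keeps the real part of (σz)^α positive.
    rw [← kernInt_rotate (η := 1 / 4) a b c (by norm_num) le_rfl hxp.le hσp hαp hα2]
    have hI := ((integrableOn_rpow_mul_exp_neg (q := 15 / 16) (by norm_num) hr).add
      (integrableOn_rpow_mul_exp_neg (q := N) (by linarith [Nat.cast_nonneg (α := ℝ) N]) hr)).const_mul B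
    have hbd := norm_integral_le_of_norm_le (μ := volume.restrict (Set.Ioi (0 : ℝ)))
      (f := fun s => Complex.exp (-((1 / 4 : ℝ) * Complex.I)) * kern a b c (1 / 4) x σ α s)
      hI ((ae_restrict_iff' measurableSet_Ioi).2
        (ae_of_all _ fun s hs => by
          have hs : 0 < s := hs
          have hσs : 0 < σ * s := mul_pos hσp hs
          rw [norm_mul, norm_exp_neg_mul_I, one_mul, norm_kern hσp hs]
          have g1 := norm_ell_le (η := 1 / 4) (σ := σ) (s := s) (by rw [abs_of_pos] <;> norm_num)
          have g2 : Real.exp (-(x * s * Real.sin (1 / 4)) - (σ * s) ^ α * Real.cos (α * (1 / 4))) ≤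
              Real.exp (-(x / 5 * s)) := by
            have := half_le_cos_mul hαp.le hα2 (η := 1 / 4) (by norm_num) (by norm_num)
            have h3 : 0 < (σ * s) ^ α := Real.rpow_pos_of_pos hσs _
            have h4 := fifth_lt_sin_quarter
            have h5 : 0 < x * s := by positivity
            gcongr
            nlinarith
          have g3 : s ^ a ≤ 2 ^ a * (σ * s) ^ (a : ℝ) := by
            rw [Real.rpow_natCast, ← mul_pow]
            gcongr
            nlinarith
          have hab' : (1 : ℝ) ≤ a + b := by exact_mod_cast hab
          have g4 := h₂ (σ * s) (a + b * α) hσs (by nlinarith [Nat.cast_nonneg (α := ℝ) a, Nat.cast_nonneg (α := ℝ) b])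
            (by push_cast; nlinarith [Nat.cast_nonneg (α := ℝ) b])
          have g5 : (σ * s) ^ (31 / 32 - 1 / 32 : ℝ) ≤ 2 ^ N * s ^ (15 / 16 : ℝ) := by
            rw [Real.mul_rpow hσp.le hs.le]
            norm_num1
            have e1 : σ ^ (15 / 16 : ℝ) ≤ 2 ^ (15 / 16 : ℝ) := by gcongr
            have e2 : (2 : ℝ) ^ (15 / 16 : ℝ) ≤ 2 ^ N := by
              rw [← Real.rpow_natCast]
              refine Real.rpow_le_rpow_of_exponent_le (by norm_num) ?_
              have : (1 : ℝ) ≤ N := by exact_mod_cast hN1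
              linarith
            gcongr
            exact e1.trans e2
          have g6 : (σ * s) ^ N ≤ 2 ^ N * s ^ (N : ℝ) := by
            rw [Real.rpow_natCast, mul_pow]
            gcongr
          calc s ^ a * ‖ell (1 / 4) σ s‖ ^ c * (σ * s) ^ (b * α) *
              Real.exp (-(x * s * Real.sin (1 / 4)) - (σ * s) ^ α * Real.cos (α * (1 / 4)))
              ≤ (2 ^ a * (σ * s) ^ (a : ℝ)) * (|Real.log (σ * s)| + 1) ^ c * (σ * s) ^ (b * α) *
                Real.exp (-(x / 5 * s)) := by gcongr
            _ = 2 ^ a * ((σ * s) ^ (a + b * α) * (|Real.log (σ * s)| + 1) ^ c) *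
                Real.exp (-(x / 5 * s)) := by rw [Real.rpow_add hσs]; ring
            _ ≤ 2 ^ a * (C₂ * (2 ^ N * s ^ (15 / 16 : ℝ) + 2 ^ N * s ^ (N : ℝ))) *
                Real.exp (-(x / 5 * s)) := by
                refine mul_le_mul_of_nonneg_right (mul_le_mul_of_nonneg_left (g4.trans ?_)
                  (by positivity)) (by positivity)
                gcongr
            _ = _ := by simp only [Pi.add_apply]; ring))
    refine hbd.trans ?_
    have hval : ∫ s in Set.Ioi (0 : ℝ), B * ((fun s : ℝ => s ^ (15 / 16 : ℝ) * Real.exp (-(x / 5 * s))) +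
        fun s : ℝ => s ^ (N : ℝ) * Real.exp (-(x / 5 * s))) s =
        B * ((5 / x) ^ (31 / 16 : ℝ) * Real.Gamma (31 / 16) + (5 / x) ^ (N + 1 : ℝ) * Real.Gamma (N + 1)) := by
      rw [integral_const_mul]
      simp only [Pi.add_apply]
      rw [integral_add (integrableOn_rpow_mul_exp_neg (q := 15 / 16) (by norm_num) hr)
        (integrableOn_rpow_mul_exp_neg (q := N) (by linarith [Nat.cast_nonneg (α := ℝ) N]) hr),
        integral_rpow_mul_exp_neg (by norm_num) hr,
        integral_rpow_mul_exp_neg (by linarith [Nat.cast_nonneg (α := ℝ) N]) hr]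
      rw [one_div_div]
      norm_num
    rw [hval]
    have e1 : (5 / x) ^ (31 / 16 : ℝ) = 5 ^ (31 / 16 : ℝ) * x ^ (-(31 / 16) : ℝ) := by
      rw [Real.div_rpow (by norm_num) hxp.le, Real.rpow_neg hxp.le]; rfl
    have e2 : (5 / x) ^ (N + 1 : ℝ) ≤ 5 ^ (N + 1 : ℝ) * x ^ (-(31 / 16) : ℝ) := by
      rw [Real.div_rpow (by norm_num) hxp.le, div_eq_mul_inv, ← Real.rpow_neg hxp.le]
      gcongr
      have : (1 : ℝ) ≤ N := by exact_mod_cast hN1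
      linarith
    have e3 : x ^ (-(31 / 16) : ℝ) ≤ 4 * (1 + x) ^ (-(31 / 16) : ℝ) := by
      have h6 : (2 * x) ^ (-(31 / 16) : ℝ) ≤ (1 + x) ^ (-(31 / 16) : ℝ) :=
        Real.rpow_le_rpow_of_nonpos (by positivity) (by linarith) (by norm_num)
      rw [Real.mul_rpow (by norm_num) hxp.le] at h6
      have h7 : 0 < x ^ (-(31 / 16) : ℝ) := Real.rpow_pos_of_pos hxp _
      nlinarith
    have h8 : 0 < (1 + x) ^ (-(31 / 16) : ℝ) := Real.rpow_pos_of_pos (by positivity) _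
    calc B * ((5 / x) ^ (31 / 16 : ℝ) * Real.Gamma (31 / 16) + (5 / x) ^ (N + 1 : ℝ) * Real.Gamma (N + 1))
        ≤ B * (5 ^ (31 / 16 : ℝ) * x ^ (-(31 / 16) : ℝ) * Real.Gamma (31 / 16) +
          5 ^ (N + 1 : ℝ) * x ^ (-(31 / 16) : ℝ) * Real.Gamma (N + 1)) := by rw [e1]; gcongr
      _ = C₃ * x ^ (-(31 / 16) : ℝ) := by rw [hC₃]; ring
      _ ≤ C₃ * (4 * (1 + x) ^ (-(31 / 16) : ℝ)) := by gcongr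
      _ ≤ _ := by nlinarith [mul_pos hC₁ h8]

/-! ### The density as a kernel integral -/

lemma integral_of_conj_symm {g : ℝ → ℂ} (hg : IntegrableOn g (Set.Ioi 0))
    (hsymm : ∀ t, g (-t) = (starRingEnd ℂ) (g t)) :
    Integrable g ∧ ∫ t, g t = ((2 * (∫ t in Set.Ioi (0 : ℝ), g t).re : ℝ) : ℂ) := by
  have h1 : IntegrableOn g (Set.Iic 0) := by
    rw [integrableOn_Iic_iff_integrableOn_Iio]
    have h2 : IntegrableOn (fun t => (starRingEnd ℂ) (g t)) (Set.Ioi 0) :=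
      (RCLike.conjCLE (K := ℂ)).toContinuousLinearMap.integrable_comp hg
    have h3 := (Measure.measurePreserving_neg (volume : Measure ℝ)).integrableOn_comp_preimage
      (MeasurableEquiv.neg ℝ).measurableEmbedding (f := fun t => (starRingEnd ℂ) (g t)) (s := Set.Ioi 0)
    have h4 := h3.2 h2
    have h5 : (Neg.neg ⁻¹' Set.Ioi (0 : ℝ)) = Set.Iio 0 := by ext; simp
    rw [h5] at h4
    refine h4.congr_fun (fun t _ => ?_) measurableSet_Iio
    simp [hsymm]
  have h2 : Integrable g := by
    have := h1.union hg
    rwa [Set.Iic_union_Ioi, integrableOn_univ] at this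
  refine ⟨h2, ?_⟩
  rw [← intervalIntegral.integral_Iic_add_Ioi h1 hg]
  have h3 : ∫ t in Set.Iic (0 : ℝ), g t = (starRingEnd ℂ) (∫ t in Set.Ioi (0 : ℝ), g t) := by
    rw [← integral_conj]
    have := integral_comp_neg_Ioi (0 : ℝ) g
    rw [neg_zero] at this
    rw [← this]
    simp [hsymm]
  rw [h3, add_comm, Complex.add_conj]

lemma kern_zero_angle {σ t : ℝ} (hσ : 0 < σ) (ht : 0 < t) (a b c : ℕ) (y α : ℝ) :
    kern a b c 0 y σ α t = ((t ^ a * Real.log (σ * t) ^ c * (σ * t) ^ (b * α) *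
      Real.exp (-(σ * t) ^ α) : ℝ) : ℂ) * Complex.exp (-(Complex.I * t * y)) := by
  have h1 := exp_ell (η := 0) hσ ht α
  have h2 := exp_ell (η := 0) hσ ht (b * α)
  push_cast at h1 h2
  unfold kern
  rw [h1, h2, sub_eq_add_neg, Complex.exp_add]
  simp only [ell]
  push_cast
  simp
  ring_nf

lemma exp_mul_charFn_eq_kern {θ : Param} (hσ : 0 < θ 1) {t : ℝ} (ht : 0 < t) (x : ℝ) :
    Complex.exp (-(Complex.I * (t : ℂ) * (x : ℂ))) * charFn θ t =
      kern 0 0 0 0 (x - θ 0) (θ 1) (θ 2) t := by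
  rw [kern_zero_angle hσ ht]
  unfold charFn
  rw [abs_of_pos (mul_pos hσ ht)]
  simp only [pow_zero, Nat.cast_zero, zero_mul, Real.rpow_zero, one_mul]
  push_cast
  rw [← Complex.exp_add, ← Complex.exp_add]
  congr 1
  ring

lemma exp_mul_charFn_symm (θ : Param) (x t : ℝ) :
    Complex.exp (-(Complex.I * ((-t : ℝ) : ℂ) * (x : ℂ))) * charFn θ (-t) =
      (starRingEnd ℂ) (Complex.exp (-(Complex.I * (t : ℂ) * (x : ℂ))) * charFn θ t) := by
  unfold charFn
  simp only [map_mul, ← Complex.exp_conj, map_sub, map_neg, Complex.conj_ofReal, Complex.conj_I,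
    mul_neg, abs_neg]
  push_cast
  simp

lemma integral_exp_mul_charFn {θ : Param} (hσ : 0 < θ 1) (hα : 0 < θ 2) (hα2 : θ 2 ≤ 2) (x : ℝ) :
    Integrable (fun t : ℝ => Complex.exp (-(Complex.I * (t : ℂ) * (x : ℂ))) * charFn θ t) ∧
    ∫ t : ℝ, Complex.exp (-(Complex.I * (t : ℂ) * (x : ℂ))) * charFn θ t =
      ((2 * (kernInt 0 0 0 0 (x - θ 0) (θ 1) (θ 2)).re : ℝ) : ℂ) := by
  have h0 : ∀ t ∈ Set.Ioi (0 : ℝ), kern 0 0 0 0 (x - θ 0) (θ 1) (θ 2) t =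
      Complex.exp (-(Complex.I * (t : ℂ) * (x : ℂ))) * charFn θ t := fun t ht =>
    (exp_mul_charFn_eq_kern hσ ht x).symm
  have h1 : IntegrableOn (fun t : ℝ => Complex.exp (-(Complex.I * (t : ℂ) * (x : ℂ))) * charFn θ t)
      (Set.Ioi 0) :=
    (integrableOn_kern 0 0 0 le_rfl (by norm_num) (by simp) hσ hα hα2).congr_fun h0
      measurableSet_Ioi
  obtain ⟨h2, h3⟩ := integral_of_conj_symm h1 (exp_mul_charFn_symm θ x)
  refine ⟨h2, ?_⟩
  rw [h3, ← setIntegral_congr_fun measurableSet_Ioi h0]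
  simp [kernInt]

lemma density_eq {θ : Param} (hσ : 0 < θ 1) (hα : 0 < θ 2) (hα2 : θ 2 ≤ 2) (x : ℝ) :
    density θ x = (1 / Real.pi) * (kernInt 0 0 0 0 (x - θ 0) (θ 1) (θ 2)).re := by
  unfold density
  rw [(integral_exp_mul_charFn hσ hα hα2 x).2, Complex.ofReal_re]
  field_simp

lemma norm_charFn (θ : Param) (t : ℝ) : ‖charFn θ t‖ = Real.exp (-|θ 1 * t| ^ θ 2) := by
  unfold charFn
  rw [Complex.norm_exp]
  congr 1
  rw [Complex.sub_re, Complex.ofReal_re, mul_assoc, ← Complex.ofReal_mul, Complex.I_mul_re]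
  simp

lemma continuous_charFn {θ : Param} (hα : 0 < θ 2) : Continuous (charFn θ) := by
  unfold charFn
  have : Continuous fun t : ℝ => |θ 1 * t| ^ θ 2 :=
    (by fun_prop : Continuous fun t : ℝ => |θ 1 * t|).rpow_const fun _ => Or.inr hα.le
  fun_prop

lemma integrable_charFn {θ : Param} (hσ : 0 < θ 1) (hα : 0 < θ 2) (hα2 : θ 2 ≤ 2) :
    Integrable (charFn θ) := by
  simpa using (integral_exp_mul_charFn hσ hα hα2 0).1

/-! ### Gamma integrals with complex rate, and the size and tails of the densities -/

/-- Both sides are analytic in r on the right half-plane and agree for positive real r. The identity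
theorem applies along the points 1 + 1/(n+1), which accumulate at 1. -/
lemma integral_cpow_mul_exp_neg_mul_complex {a r : ℂ} (ha : 0 < a.re) (hr : 0 < r.re) :
    ∫ t in Set.Ioi (0 : ℝ), (t : ℂ) ^ (a - 1) * Complex.exp (-(r * t)) =
      (1 / r) ^ a * Complex.Gamma a := by
  have hopen : IsOpen {r : ℂ | 0 < r.re} := isOpen_lt continuous_const Complex.continuous_re
  have hnorm : ∀ r : ℂ, ∀ t ∈ Set.Ioi (0 : ℝ), ‖(t : ℂ) ^ (a - 1) * Complex.exp (-(r * t))‖ =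
      t ^ (a.re - 1) * Real.exp (-(r.re * t)) := by
    intro r t ht
    rw [norm_mul, Complex.norm_cpow_eq_rpow_re_of_pos ht, Complex.norm_exp]
    simp
  have hmeas : ∀ b r : ℂ, AEStronglyMeasurable (fun t : ℝ => (t : ℂ) ^ b * Complex.exp (-(r * t)))
      (volume.restrict (Set.Ioi 0)) := fun b r =>
    (by fun_prop : Measurable fun t : ℝ => (t : ℂ) ^ b * Complex.exp (-(r * t))).aestronglyMeasurable
  have hdiff : DifferentiableOn ℂ (fun r : ℂ => ∫ t in Set.Ioi (0 : ℝ), (t : ℂ) ^ (a - 1) *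
      Complex.exp (-(r * t))) {r : ℂ | 0 < r.re} := by
    intro r hr
    have hr : 0 < r.re := hr
    refine (hasDerivAt_integral_of_dominated_loc_of_deriv_le (x₀ := r)
      (s := {z : ℂ | r.re / 2 < z.re})
      (F' := fun r t => (t : ℂ) ^ (a - 1) * (Complex.exp (-(r * t)) * (-(1 * t))))
      (bound := fun t => t ^ a.re * Real.exp (-(r.re / 2 * t)))
      ((isOpen_lt continuous_const Complex.continuous_re).mem_nhds (by simp; linarith))
      (Eventually.of_forall fun z => hmeas (a - 1) z) ?_ ?_ ?_
      (integrableOn_rpow_mul_exp_neg (by linarith) (by linarith)) ?_).2.differentiableAt.differentiableWithinAt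
    · refine (integrableOn_rpow_mul_exp_neg (q := a.re - 1) (r := r.re) (by linarith) hr).mono' (hmeas _ _) ?_
      exact (ae_restrict_iff' measurableSet_Ioi).2 (ae_of_all _ fun t ht => (hnorm r t ht).le)
    · exact (by fun_prop : Measurable fun t : ℝ => (t : ℂ) ^ (a - 1) * (Complex.exp (-(r * t)) * (-(1 * t)))).aestronglyMeasurable
    · refine (ae_restrict_iff' measurableSet_Ioi).2 (ae_of_all _ fun t ht z hz => ?_)
      have ht' : 0 < t := ht
      have hz : r.re / 2 < z.re := hz
      rw [← mul_assoc, norm_mul, hnorm z t ht, norm_neg, one_mul, Complex.norm_of_nonneg ht'.le]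
      have : t ^ a.re = t ^ (a.re - 1) * t := by
        rw [← Real.rpow_add_one ht'.ne']; ring_nf
      rw [this]
      have h2 : 0 < t ^ (a.re - 1) := Real.rpow_pos_of_pos ht' _
      have h3 : Real.exp (-(z.re * t)) ≤ Real.exp (-(r.re / 2 * t)) := by gcongr
      calc _ ≤ t ^ (a.re - 1) * Real.exp (-(r.re / 2 * t)) * t := by gcongr
        _ = _ := by ring
    · refine ae_of_all _ fun t z _ => ?_
      exact (((hasDerivAt_id z).mul_const (t : ℂ)).neg.cexp).const_mul _
  have hdiff2 : DifferentiableOn ℂ (fun r : ℂ => (1 / r) ^ a * Complex.Gamma a) {r : ℂ | 0 < r.re} := by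
    intro z hz
    have hz : 0 < z.re := hz
    have hz0 : z ≠ 0 := by rintro rfl; simp at hz
    have : 0 < (1 / z).re := by
      rw [one_div, Complex.inv_re]
      exact div_pos hz (Complex.normSq_pos.2 hz0)
    refine DifferentiableAt.differentiableWithinAt ?_
    refine DifferentiableAt.mul_const ?_ _
    exact ((differentiableAt_const _).div differentiableAt_id hz0).cpow_const (Or.inl this)
  have hpre : IsPreconnected {r : ℂ | 0 < r.re} := (convex_halfSpace_re_gt 0).isPreconnected
  refine (hdiff.analyticOnNhd hopen).eqOn_of_preconnected_of_frequently_eq (hdiff2.analyticOnNhd hopen)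
    hpre (z₀ := 1) (by simp) ?_ hr
  have hu : Tendsto (fun n : ℕ => ((1 + 1 / ((n : ℝ) + 1) : ℝ) : ℂ)) atTop (𝓝[≠] 1) := by
    refine tendsto_nhdsWithin_iff.2 ⟨?_, Eventually.of_forall fun n => ?_⟩
    · have := (tendsto_one_div_add_atTop_nhds_zero_nat (𝕜 := ℝ)).const_add 1
      rw [add_zero] at this
      have h2 := (Complex.continuous_ofReal.tendsto (1 : ℝ)).comp this
      rw [Complex.ofReal_one] at h2
      exact h2
    · have : (0 : ℝ) < 1 / ((n : ℝ) + 1) := by positivity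
      simp only [Set.mem_compl_iff, Set.mem_singleton_iff]
      rw [← Complex.ofReal_one, Complex.ofReal_inj]
      linarith
  refine hu.frequently (Eventually.frequently (Eventually.of_forall fun n => ?_))
  exact Complex.integral_cpow_mul_exp_neg_mul_Ioi ha (by positivity)

lemma norm_exp_neg_sub_one_le {w : ℂ} (hw : 0 ≤ w.re) : ‖Complex.exp (-w) - 1‖ ≤ 2 * ‖w‖ := by
  rcases le_total ‖w‖ 1 with h | h
  · simpa using Complex.norm_exp_sub_one_le (x := -w) (by simpa using h)
  · have h1 : ‖Complex.exp (-w)‖ ≤ 1 := by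
      rw [Complex.norm_exp, Real.exp_le_one_iff, Complex.neg_re]; linarith
    have := norm_sub_le (Complex.exp (-w)) 1
    rw [norm_one] at this
    linarith

/-- The Taylor estimate is needed on the whole half-plane, since w = (σz)^α is unbounded along the
ray. For ‖w‖ ≥ 1 the trivial bound is already quadratic. -/
lemma norm_exp_neg_sub_one_add_le {w : ℂ} (hw : 0 ≤ w.re) :
    ‖Complex.exp (-w) - 1 + w‖ ≤ 3 * ‖w‖ ^ 2 := by
  rcases le_total ‖w‖ 1 with h | h
  · have := Complex.norm_exp_sub_one_sub_id_le (x := -w) (by simpa using h)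
    rw [sub_neg_eq_add, norm_neg] at this
    nlinarith [sq_nonneg ‖w‖]
  · have h1 := norm_exp_neg_sub_one_le hw
    have h2 := norm_add_le (Complex.exp (-w) - 1) w
    nlinarith

lemma rpow_mul_exp_main {y α : ℝ} (hy : 0 < y) (hα : -1 < α) :
    ∫ s in Set.Ioi (0 : ℝ), Complex.exp (-((1 / 4 : ℝ) * Complex.I)) *
      ((s ^ α : ℝ) * Complex.exp (-((α * (1 / 4) : ℝ) * Complex.I)) *
        Complex.exp (-(Complex.I * y * (s * Complex.exp (-((1 / 4 : ℝ) * Complex.I)))))) =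
      ((y ^ (-(1 + α)) * Real.Gamma (1 + α) : ℝ) : ℂ) *
        Complex.exp (-((Real.pi / 2 * (1 + α) : ℝ) * Complex.I)) := by
  set η : ℝ := 1 / 4 with hη
  set r : ℂ := Complex.I * y * Complex.exp (-(η * Complex.I)) with hr
  have hyc : (y : ℂ) ≠ 0 := by exact_mod_cast hy.ne'
  -- The imaginary part η - π/2 lies in (-π, π], which fixes the branch of the power (1/r)^(1+α).
  have hrexp : 1 / r = Complex.exp (((-Real.log y : ℝ) : ℂ) + ((η - Real.pi / 2 : ℝ) : ℂ) * Complex.I) := by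
    have hy' : (y : ℂ) = Complex.exp ((Real.log y : ℝ) : ℂ) := by
      rw [← Complex.ofReal_exp, Real.exp_log hy]
    have hI : Complex.I = Complex.exp ((Real.pi / 2 : ℝ) * Complex.I) := by
      push_cast; rw [Complex.exp_pi_div_two_mul_I]
    rw [hr, hy']
    nth_rewrite 1 [hI]
    rw [← Complex.exp_add, ← Complex.exp_add, one_div, ← Complex.exp_neg]
    congr 1
    push_cast
    ring
  have hrre : 0 < r.re := by
    have h2 : (Complex.exp (-(η * Complex.I))).im = -Real.sin η := by
      rw [Complex.exp_im]; simp
    rw [hr, mul_assoc, Complex.I_mul_re, Complex.im_ofReal_mul, h2]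
    have := fifth_lt_sin_quarter
    nlinarith
  have key := integral_cpow_mul_exp_neg_mul_complex (a := ((1 + α : ℝ) : ℂ)) (r := r)
    (by rw [Complex.ofReal_re]; linarith) hrre
  have hlhs : ∀ s ∈ Set.Ioi (0 : ℝ), Complex.exp (-(η * Complex.I)) *
      ((s ^ α : ℝ) * Complex.exp (-((α * η : ℝ) * Complex.I)) *
        Complex.exp (-(Complex.I * y * (s * Complex.exp (-(η * Complex.I)))))) =
      (Complex.exp (-(η * Complex.I)) * Complex.exp (-((α * η : ℝ) * Complex.I))) *
       ((s : ℂ) ^ (((1 + α : ℝ) : ℂ) - 1) * Complex.exp (-(r * s))) := by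
    intro s hs
    have e1 : (s : ℂ) ^ (((1 + α : ℝ) : ℂ) - 1) = ((s ^ α : ℝ) : ℂ) := by
      rw [Complex.ofReal_cpow (le_of_lt hs)]; push_cast; ring_nf
    have e2 : Complex.I * y * (s * Complex.exp (-(η * Complex.I))) = r * s := by rw [hr]; ring
    rw [e1, e2]; ring
  rw [setIntegral_congr_fun measurableSet_Ioi hlhs, integral_const_mul, key, hrexp,
    Complex.cpow_def_of_ne_zero (Complex.exp_ne_zero _), Complex.log_exp]
  · rw [Complex.Gamma_ofReal, Complex.ofReal_mul (y ^ _), Real.rpow_def_of_pos hy, Complex.ofReal_exp]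
    simp only [← mul_assoc, ← Complex.exp_add]
    rw [mul_right_comm, ← Complex.exp_add]
    congr 2
    push_cast
    ring
  · simp only [Complex.add_im, Complex.ofReal_im, Complex.mul_im, Complex.ofReal_re, Complex.I_im,
      Complex.I_re]
    linarith [Real.pi_gt_three]
  · simp only [Complex.add_im, Complex.ofReal_im, Complex.mul_im, Complex.ofReal_re, Complex.I_im,
      Complex.I_re]
    linarith [Real.pi_gt_three]

lemma integrable_exp_neg_ray {y : ℝ} (hy : 0 < y) {q : ℝ} (hq : -1 < q) :
    IntegrableOn (fun s : ℝ => Complex.exp (-((1 / 4 : ℝ) * Complex.I)) *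
      ((s ^ q : ℝ) * Complex.exp (-((q * (1 / 4) : ℝ) * Complex.I)) *
        Complex.exp (-(Complex.I * y * (s * Complex.exp (-((1 / 4 : ℝ) * Complex.I)))))))
      (Set.Ioi 0) := by
  refine (integrableOn_rpow_mul_exp_neg hq (show 0 < y / 5 by positivity)).mono'
    (by fun_prop : Measurable _).aestronglyMeasurable ?_
  refine (ae_restrict_iff' measurableSet_Ioi).2 (ae_of_all _ fun s hs => ?_)
  have hs : 0 < s := hs
  have h2 : (Complex.exp (-((1 / 4 : ℝ) * Complex.I))).im = -Real.sin (1 / 4) := by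
    rw [Complex.exp_im]; simp
  rw [norm_mul, norm_mul, norm_mul, norm_exp_neg_mul_I, norm_exp_neg_mul_I, one_mul, mul_one,
    Complex.norm_of_nonneg (Real.rpow_nonneg hs.le _), Complex.norm_exp]
  have : (-(Complex.I * y * (s * Complex.exp (-((1 / 4 : ℝ) * Complex.I))))).re =
      -(y * s * Real.sin (1 / 4)) := by
    rw [Complex.neg_re, mul_assoc, Complex.I_mul_re, Complex.im_ofReal_mul, Complex.im_ofReal_mul, h2]
    ring
  rw [this]
  have h4 := fifth_lt_sin_quarter
  have h5 : 0 < y * s := by positivity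
  exact mul_le_mul_of_nonneg_left (Real.exp_le_exp.2 (by nlinarith)) (by positivity)

lemma kern_rotated_eq {σ s : ℝ} (hσ : 0 < σ) (hs : 0 < s) (y α : ℝ) :
    kern 0 0 0 (1 / 4) y σ α s =
      Complex.exp (-(Complex.I * y * (s * Complex.exp (-((1 / 4 : ℝ) * Complex.I))))) *
        Complex.exp (-(((σ ^ α : ℝ) : ℂ) * ((s ^ α : ℝ) * Complex.exp (-((α * (1 / 4) : ℝ) * Complex.I))))) := by
  unfold kern
  rw [exp_ell hσ hs, sub_eq_add_neg, Complex.exp_add, Real.mul_rpow hσ.le hs.le]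
  push_cast
  simp
  ring_nf

lemma re_ray_pos {σ s α : ℝ} (hσ : 0 < σ) (hs : 0 < s) (hα : 0 < α) (hα2 : α ≤ 2) :
    0 ≤ (((σ ^ α : ℝ) : ℂ) * ((s ^ α : ℝ) * Complex.exp (-((α * (1 / 4) : ℝ) * Complex.I)))).re := by
  have h3 : (Complex.exp (-((α * (1 / 4) : ℝ) * Complex.I))).re = Real.cos (α * (1 / 4)) := by
    rw [Complex.exp_re]; simp
  rw [Complex.re_ofReal_mul, Complex.re_ofReal_mul, h3]
  have := half_le_cos_mul hα.le hα2 (η := 1 / 4) (by norm_num) (by norm_num)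
  have : 0 ≤ Real.cos (α * (1 / 4)) := by linarith
  positivity

lemma norm_ray {σ s : ℝ} (hσ : 0 < σ) (hs : 0 < s) (α : ℝ) :
    ‖((σ ^ α : ℝ) : ℂ) * ((s ^ α : ℝ) * Complex.exp (-((α * (1 / 4) : ℝ) * Complex.I)))‖ =
      σ ^ α * s ^ α := by
  rw [norm_mul, norm_mul, norm_exp_neg_mul_I, mul_one, Complex.norm_of_nonneg (by positivity),
    Complex.norm_of_nonneg (by positivity)]

lemma norm_exp_ray_le {y s : ℝ} (hy : 0 < y) (hs : 0 < s) :
    ‖Complex.exp (-(Complex.I * y * (s * Complex.exp (-((1 / 4 : ℝ) * Complex.I)))))‖ ≤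
      Real.exp (-(y / 5 * s)) := by
  have h2 : (Complex.exp (-((1 / 4 : ℝ) * Complex.I))).im = -Real.sin (1 / 4) := by
    rw [Complex.exp_im]; simp
  rw [Complex.norm_exp]
  have : (-(Complex.I * y * (s * Complex.exp (-((1 / 4 : ℝ) * Complex.I))))).re =
      -(y * s * Real.sin (1 / 4)) := by
    rw [Complex.neg_re, mul_assoc, Complex.I_mul_re, Complex.im_ofReal_mul, Complex.im_ofReal_mul, h2]
    ring
  rw [this]
  have h4 := fifth_lt_sin_quarter
  have h5 : 0 < y * s := by positivity
  exact Real.exp_le_exp.2 (by nlinarith)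

/-- The term of order zero in the expansion of exp(-(σz)^α) integrates to 1/(iy), which is purely
imaginary. It does not contribute to the density and may be subtracted freely. -/
lemma integral_exp_neg_ray {y : ℝ} (hy : 0 < y) :
    (∫ s in Set.Ioi (0 : ℝ), Complex.exp (-((1 / 4 : ℝ) * Complex.I)) *
      ((s ^ (0 : ℝ) : ℝ) * Complex.exp (-((0 * (1 / 4) : ℝ) * Complex.I)) *
        Complex.exp (-(Complex.I * y * (s * Complex.exp (-((1 / 4 : ℝ) * Complex.I))))))).re = 0 := by
  rw [rpow_mul_exp_main hy (by norm_num), Complex.re_ofReal_mul, Complex.exp_re]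
  simp

/-- Power tails of the stable densities, uniformly in the scale. -/
lemma abs_re_kernInt_le {y σ α : ℝ} (hy : 0 < y) (hσ : 0 < σ) (hα : 0 < α) (hα2 : α ≤ 2) :
    |(kernInt 0 0 0 0 y σ α).re| ≤ 2 * σ ^ α * ((5 / y) ^ (α + 1) * Real.Gamma (α + 1)) := by
  have h0 := integral_exp_neg_ray hy
  have hi0 := integrable_exp_neg_ray hy (q := 0) (by norm_num)
  have hi1 := (integrableOn_kern 0 0 0 (η := 1 / 4) (y := y) (σ := σ) (α := α) (by norm_num) le_rfl
    (by positivity) hσ hα hα2).const_mul (Complex.exp (-((1 / 4 : ℝ) * Complex.I)))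
  rw [← kernInt_rotate (η := 1 / 4) 0 0 0 (by norm_num) le_rfl hy.le hσ hα hα2, ← sub_zero (kernInt _ _ _ _ _ _ _).re,
    ← h0, ← Complex.sub_re]
  refine (Complex.abs_re_le_norm _).trans ?_
  unfold kernInt
  rw [← integral_sub hi1 hi0]
  have hr : 0 < y / 5 := by positivity
  have hI := (integrableOn_rpow_mul_exp_neg (q := α) (by linarith) hr).const_mul (2 * σ ^ α)
  refine (norm_integral_le_of_norm_le hI ((ae_restrict_iff' measurableSet_Ioi).2
    (ae_of_all _ fun s hs => ?_))).trans ?_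
  · have hs : 0 < s := hs
    rw [kern_rotated_eq hσ hs]
    have e : ∀ A B C : ℂ, A * (B * C) - A * (((s ^ (0 : ℝ) : ℝ) : ℂ) *
        Complex.exp (-((0 * (1 / 4) : ℝ) * Complex.I)) * B) = A * (B * (C - 1)) := by
      intro A B C; simp; ring
    rw [e, norm_mul, norm_mul, norm_exp_neg_mul_I, one_mul]
    have h1 := norm_exp_neg_sub_one_le (re_ray_pos hσ hs hα hα2)
    rw [norm_ray hσ hs] at h1
    have h2 := norm_exp_ray_le hy hs
    calc _ ≤ Real.exp (-(y / 5 * s)) * (2 * (σ ^ α * s ^ α)) := by gcongr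
      _ = _ := by ring
  · rw [integral_const_mul, integral_rpow_mul_exp_neg (by linarith) hr, one_div_div]

/-- The leading term of the tail of the stable densities. -/
lemma le_re_kernInt {y σ α : ℝ} (hy : 0 < y) (hσ : 0 < σ) (hα : 0 < α) (hα2 : α ≤ 2) :
    σ ^ α * (y ^ (-(1 + α)) * Real.Gamma (1 + α) * Real.sin (Real.pi / 2 * α)) -
      3 * (σ ^ α) ^ 2 * ((5 / y) ^ (2 * α + 1) * Real.Gamma (2 * α + 1)) ≤
      (kernInt 0 0 0 0 y σ α).re := by
  have h0 := integral_exp_neg_ray hy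
  have hα' := rpow_mul_exp_main hy (show -1 < α by linarith)
  have hi0 := integrable_exp_neg_ray hy (q := 0) (by norm_num)
  have hiα := (integrable_exp_neg_ray hy (q := α) (by linarith)).const_mul ((σ ^ α : ℝ) : ℂ)
  have hi1 := (integrableOn_kern 0 0 0 (η := 1 / 4) (y := y) (σ := σ) (α := α) (by norm_num) le_rfl
    (by positivity) hσ hα hα2).const_mul (Complex.exp (-((1 / 4 : ℝ) * Complex.I)))
  set J := ∫ s in Set.Ioi (0 : ℝ), Complex.exp (-((1 / 4 : ℝ) * Complex.I)) *
      ((s ^ (0 : ℝ) : ℝ) * Complex.exp (-((0 * (1 / 4) : ℝ) * Complex.I)) *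
        Complex.exp (-(Complex.I * y * (s * Complex.exp (-((1 / 4 : ℝ) * Complex.I)))))) with hJ
  have hmain : (((σ ^ α : ℝ) : ℂ) * (((y ^ (-(1 + α)) * Real.Gamma (1 + α) : ℝ) : ℂ) *
        Complex.exp (-((Real.pi / 2 * (1 + α) : ℝ) * Complex.I)))).re =
      -(σ ^ α * (y ^ (-(1 + α)) * Real.Gamma (1 + α) * Real.sin (Real.pi / 2 * α))) := by
    have : (Complex.exp (-((Real.pi / 2 * (1 + α) : ℝ) * Complex.I))).re = -Real.sin (Real.pi / 2 * α) := by
      rw [Complex.exp_re, show Real.pi / 2 * (1 + α) = Real.pi / 2 * α + Real.pi / 2 by ring]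
      simp only [Complex.neg_re, Complex.mul_re, Complex.ofReal_re, Complex.I_re, mul_zero,
        Complex.ofReal_im, Complex.I_im, mul_one, sub_self, neg_zero, Real.exp_zero, Complex.neg_im,
        Complex.mul_im, add_zero, one_mul, Real.cos_neg, Real.cos_add_pi_div_two]
    rw [Complex.re_ofReal_mul, Complex.re_ofReal_mul, this]
    ring
  rw [← kernInt_rotate (η := 1 / 4) 0 0 0 (by norm_num) le_rfl hy.le hσ hα hα2]
  rw [← hα', ← integral_const_mul] at hmain
  -- After removing the terms of orders zero and α in w = (σz)^α, the remainder exp(-w) - 1 + w is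
  -- at most 3‖w‖², whose integral has the smaller order y^(-(1+2α)).
  suffices h : |(kernInt 0 0 0 (1 / 4) y σ α).re - J.re -
      σ ^ α * (y ^ (-(1 + α)) * Real.Gamma (1 + α) * Real.sin (Real.pi / 2 * α))| ≤
      3 * (σ ^ α) ^ 2 * ((5 / y) ^ (2 * α + 1) * Real.Gamma (2 * α + 1)) by
    have := (abs_le.1 h).1
    rw [h0] at this
    linarith
  rw [sub_eq_add_neg, ← hmain, ← Complex.sub_re, ← Complex.add_re]
  refine (Complex.abs_re_le_norm _).trans ?_
  rw [hJ]
  unfold kernInt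
  have hadd := integral_add (hi1.sub hi0) hiα
  simp only [Pi.sub_apply] at hadd
  rw [← integral_sub hi1 hi0, ← hadd]
  have hr : 0 < y / 5 := by positivity
  have hI := (integrableOn_rpow_mul_exp_neg (q := 2 * α) (by linarith) hr).const_mul (3 * (σ ^ α) ^ 2)
  refine (norm_integral_le_of_norm_le hI ((ae_restrict_iff' measurableSet_Ioi).2
    (ae_of_all _ fun s hs => ?_))).trans ?_
  · have hs : 0 < s := hs
    rw [kern_rotated_eq hσ hs]
    have e : ∀ A B C D E : ℂ, A * (B * C) - A * (((s ^ (0 : ℝ) : ℝ) : ℂ) *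
        Complex.exp (-((0 * (1 / 4) : ℝ) * Complex.I)) * B) + D * (A * (E * B)) =
          A * (B * (C - 1 + D * E)) := by
      intro A B C D E; simp; ring
    rw [e, norm_mul, norm_mul, norm_exp_neg_mul_I, one_mul]
    have h1 := norm_exp_neg_sub_one_add_le (re_ray_pos hσ hs hα hα2)
    rw [norm_ray hσ hs] at h1
    have h2 := norm_exp_ray_le hy hs
    have h3 : s ^ (2 * α) = (s ^ α) ^ 2 := by
      rw [mul_comm, Real.rpow_mul hs.le]; norm_num
    calc _ ≤ Real.exp (-(y / 5 * s)) * (3 * (σ ^ α * s ^ α) ^ 2) := by gcongr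
      _ = _ := by rw [h3]; ring
  · rw [integral_const_mul, integral_rpow_mul_exp_neg (by linarith) hr, one_div_div]

lemma re_kernInt_abs (a b c : ℕ) (y σ α : ℝ) :
    (kernInt a b c 0 |y| σ α).re = (kernInt a b c 0 y σ α).re := by
  rcases abs_choice y with h | h <;> rw [h]
  rw [kernInt_neg, Complex.conj_re]

/-- Convexity between Γ(1) = 1 and Γ(3) = 2. -/
lemma Gamma_le_two {u : ℝ} (h1 : 1 ≤ u) (h3 : u ≤ 3) : Real.Gamma u ≤ 2 := by
  have h := Real.convexOn_Gamma.2 (show (1 : ℝ) ∈ Set.Ioi 0 by simp) (show (3 : ℝ) ∈ Set.Ioi 0 by simp)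
    (show 0 ≤ (3 - u) / 2 by linarith) (show 0 ≤ (u - 1) / 2 by linarith) (by ring)
  have h3' : Real.Gamma 3 = 2 := by
    have := Real.Gamma_nat_eq_factorial 2
    rw [show ((2 : ℕ) : ℝ) + 1 = 3 by norm_num] at this
    rw [this]; norm_num [Nat.factorial]
  simp only [smul_eq_mul, Real.Gamma_one, h3'] at h
  rw [show (3 - u) / 2 * 1 + (u - 1) / 2 * 3 = u by ring] at h
  linarith

/-- The constant is 2 · 5³ · 2: the Taylor constant, the bound 5^(1+α) ≤ 5³, and Γ(α+1) ≤ 2. The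
factor 1/π is dropped. No positive lower bound on α is needed. -/
lemma abs_density_le {θ : Param} (hσ : 0 < θ 1) (hα : 0 < θ 2) (hα2 : θ 2 ≤ 2) {x : ℝ}
    (hx : x ≠ θ 0) :
    |density θ x| ≤ 500 * (θ 1) ^ θ 2 * |x - θ 0| ^ (-(1 + θ 2)) := by
  have hy : 0 < |x - θ 0| := abs_pos.2 (sub_ne_zero.2 hx)
  rw [density_eq hσ hα hα2, ← re_kernInt_abs, abs_mul, abs_of_pos (by positivity)]
  have h1 := abs_re_kernInt_le hy hσ hα hα2
  have h2 : (5 / |x - θ 0|) ^ (θ 2 + 1) ≤ 125 * |x - θ 0| ^ (-(1 + θ 2)) := by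
    rw [Real.div_rpow (by norm_num) hy.le, div_eq_mul_inv, ← Real.rpow_neg hy.le, add_comm (θ 2)]
    gcongr
    calc (5 : ℝ) ^ (1 + θ 2) ≤ 5 ^ (3 : ℝ) :=
          Real.rpow_le_rpow_of_exponent_le (by norm_num) (by linarith)
      _ = 125 := by norm_num
  have h3 := Gamma_le_two (u := θ 2 + 1) (by linarith) (by linarith)
  have h4 : 1 / Real.pi ≤ 1 := by
    rw [div_le_one Real.pi_pos]; linarith [Real.pi_gt_three]
  have h5 : 0 < Real.Gamma (θ 2 + 1) := Real.Gamma_pos_of_pos (by linarith)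
  calc _ ≤ 1 * (2 * (θ 1) ^ θ 2 * (125 * |x - θ 0| ^ (-(1 + θ 2)) * 2)) := by
        refine mul_le_mul h4 (h1.trans ?_) (abs_nonneg _) zero_le_one
        gcongr
    _ = _ := by ring

lemma norm_kernInt_zero_le (y : ℝ) {σ α : ℝ} (hσ : 0 < σ) :
    ‖kernInt 0 0 0 0 y σ α‖ ≤ ∫ s in Set.Ioi (0 : ℝ), Real.exp (-(σ * s) ^ α) := by
  refine (norm_integral_le_integral_norm _).trans_eq ?_
  refine setIntegral_congr_fun measurableSet_Ioi fun s hs => ?_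
  rw [norm_mul, norm_exp_neg_mul_I, one_mul, norm_kern hσ hs]
  simp

/-- The densities are bounded by a multiple of the inverse scale. -/
lemma abs_density_le_inv {ε : ℝ} (hε : 0 < ε) :
    ∃ C : ℝ, 0 < C ∧ ∀ θ : Param, 0 < θ 1 → ε ≤ θ 2 → θ 2 ≤ 2 → ∀ x, |density θ x| ≤ C * (θ 1)⁻¹ := by
  have hint := integrableOn_rpow_mul_exp_neg_rpow (s := 0) (p := ε) (by norm_num) hε
  simp only [Real.rpow_zero, one_mul] at hint
  set J := ∫ s in Set.Ioi (0 : ℝ), Real.exp (-s ^ ε) with hJ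
  have hJ0 : 0 ≤ J := integral_nonneg fun s => (Real.exp_pos _).le
  refine ⟨Real.exp 1 * J + 1, by positivity, fun θ hσ hα hα2 x => ?_⟩
  have hα0 : 0 < θ 2 := hε.trans_le hα
  rw [density_eq hσ hα0 hα2, abs_mul, abs_of_pos (by positivity)]
  have h4 : 1 / Real.pi ≤ 1 := by
    rw [div_le_one Real.pi_pos]; linarith [Real.pi_gt_three]
  have h1 : ‖kernInt 0 0 0 0 (x - θ 0) (θ 1) (θ 2)‖ ≤ (θ 1)⁻¹ * (Real.exp 1 * J) := by
    refine (norm_kernInt_zero_le _ hσ).trans ?_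
    have := integral_comp_mul_left_Ioi (fun s => Real.exp (-s ^ θ 2)) 0 hσ
    rw [mul_zero] at this
    rw [this, smul_eq_mul]
    refine mul_le_mul_of_nonneg_left ?_ (by positivity)
    rw [hJ, ← integral_const_mul]
    have hint2 := integrableOn_rpow_mul_exp_neg_rpow (s := 0) (p := θ 2) (by norm_num) hα0
    simp only [Real.rpow_zero, one_mul] at hint2
    refine setIntegral_mono_on hint2 (hint.const_mul _) measurableSet_Ioi fun s hs => ?_
    have hs : 0 < s := hs
    rw [← Real.exp_add]
    gcongr
    -- For s ≥ 1 lowering the exponent to ε increases exp(-s^α). For s ≤ 1 it may decrease it, and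
    -- the factor e compensates.
    rcases le_total s 1 with h | h
    · have := Real.rpow_le_one hs.le h hε.le
      have := Real.rpow_nonneg hs.le (θ 2)
      linarith
    · have := Real.rpow_le_rpow_of_exponent_le h hα
      linarith
  calc _ ≤ 1 * ((θ 1)⁻¹ * (Real.exp 1 * J)) :=
        mul_le_mul h4 ((Complex.abs_re_le_norm _).trans h1) (abs_nonneg _) zero_le_one
    _ ≤ _ := by
        have : 0 < (θ 1)⁻¹ := by positivity
        nlinarith

/-- Lower bound for the tails of the stable densities with exponent near `1`. -/
lemma density_tail_lower : ∃ c R : ℝ, 0 < c ∧ 1 ≤ R ∧ ∀ θ : Param, 1 / 2 ≤ θ 1 → θ 1 ≤ 2 →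
    31 / 32 ≤ θ 2 → θ 2 ≤ 33 / 32 → ∀ x, R ≤ |x - θ 0| →
      c * |x - θ 0| ^ (-(65 / 32) : ℝ) ≤ density θ x := by
  -- `Q` collects the error constants: (σ^α)² ≤ 4², 5^(2α+1) ≤ 5⁴ and Γ(2α+1) ≤ 6. With R = (64Q)²
  -- one has y^(-1/2) ≤ 1/(64Q), so the error is at most y^(-(1+α))/64, half of the lower bound
  -- y^(-(1+α))/32 for the leading term. The exponent 65/32 is the largest value of 1 + α.
  set Q := 3 * 4 ^ 2 * (5 ^ 4 * 6 : ℝ) with hQ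
  refine ⟨1 / (64 * Real.pi), (64 * Q) ^ 2, by positivity, by rw [hQ]; norm_num,
    fun θ hσ hσ2 hα hα2 x hx => ?_⟩
  have hσp : 0 < θ 1 := by linarith
  have hαp : 0 < θ 2 := by linarith
  set y := |x - θ 0| with hy
  set α := θ 2 with hαdef
  have hQ1 : 1 ≤ 64 * Q := by rw [hQ]; norm_num
  have hy1 : 1 ≤ y := le_trans (by nlinarith) hx
  have hyp : 0 < y := by linarith
  rw [density_eq hσp hαp (by linarith), ← re_kernInt_abs]
  have h1 := le_re_kernInt hyp hσp hαp (by linarith)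
  have hσα1 : 1 / 4 ≤ θ 1 ^ α := by
    have e1 : (1 / 2 : ℝ) ^ α ≤ θ 1 ^ α := by gcongr
    have e2 : (1 / 2 : ℝ) ^ (2 : ℝ) ≤ (1 / 2) ^ α :=
      Real.rpow_le_rpow_of_exponent_ge (by norm_num) (by norm_num) (by linarith)
    norm_num at e2 ⊢
    norm_num at e1
    linarith
  have hσα2 : θ 1 ^ α ≤ 4 := by
    have e1 : θ 1 ^ α ≤ 2 ^ α := by gcongr
    have e2 : (2 : ℝ) ^ α ≤ 2 ^ (2 : ℝ) :=
      Real.rpow_le_rpow_of_exponent_le (by norm_num) (by linarith)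
    norm_num at e2
    linarith
  -- `1 + α` may lie below 2, so the functional equation moves the comparison with Γ(2) = 1 to `2 +
  -- α`, where Γ is increasing.
  have hΓ : 1 / 4 ≤ Real.Gamma (1 + α) := by
    have h := Real.Gamma_add_one (s := 1 + α) (by linarith)
    have h2 : Real.Gamma 2 ≤ Real.Gamma (1 + α + 1) :=
      Real.Gamma_strictMonoOn_Ici.monotoneOn (by simp) (by simp; linarith) (by linarith)
    rw [Real.Gamma_two, h] at h2
    nlinarith
  have hΓ2 : Real.Gamma (2 * α + 1) ≤ 6 := by
    have h2 : Real.Gamma (2 * α + 1) ≤ Real.Gamma 4 :=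
      Real.Gamma_strictMonoOn_Ici.monotoneOn (by simp; linarith) (by norm_num) (by linarith)
    have := Real.Gamma_nat_eq_factorial 3
    rw [show ((3 : ℕ) : ℝ) + 1 = 4 by norm_num] at this
    rw [this] at h2
    norm_num [Nat.factorial] at h2
    exact h2
  have hΓ2p : 0 < Real.Gamma (2 * α + 1) := Real.Gamma_pos_of_pos (by linarith)
  have hsin : 1 / 2 ≤ Real.sin (Real.pi / 2 * α) := by
    rw [← Real.cos_sub_pi_div_two]
    have h1 := Real.one_sub_sq_div_two_le_cos (x := Real.pi / 2 * α - Real.pi / 2)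
    have h2 : |Real.pi / 2 * α - Real.pi / 2| ≤ 1 := by
      rw [show Real.pi / 2 * α - Real.pi / 2 = Real.pi / 2 * (α - 1) by ring, abs_mul, abs_of_pos (by positivity)]
      have : |α - 1| ≤ 1 / 32 := abs_le.2 ⟨by linarith, by linarith⟩
      nlinarith [Real.pi_lt_four, Real.pi_pos]
    have h3 := (sq_le_one_iff_abs_le_one _).2 h2
    linarith
  have hmain : y ^ (-(1 + α)) / 32 ≤ θ 1 ^ α * (y ^ (-(1 + α)) * Real.Gamma (1 + α) * Real.sin (Real.pi / 2 * α)) := by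
    have : 0 < y ^ (-(1 + α)) := Real.rpow_pos_of_pos hyp _
    calc y ^ (-(1 + α)) / 32 = 1 / 4 * (y ^ (-(1 + α)) * (1 / 4) * (1 / 2)) := by ring
      _ ≤ _ := by gcongr
  have herr : 3 * (θ 1 ^ α) ^ 2 * ((5 / y) ^ (2 * α + 1) * Real.Gamma (2 * α + 1)) ≤ y ^ (-(1 + α)) / 64 := by
    have e1 : (5 / y) ^ (2 * α + 1) ≤ 5 ^ 4 * (y ^ (-(1 + α)) * y ^ (-(1 / 2) : ℝ)) := by
      rw [Real.div_rpow (by norm_num) hyp.le, div_eq_mul_inv, ← Real.rpow_neg hyp.le, ← Real.rpow_add hyp]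
      gcongr
      · rw [← Real.rpow_natCast]
        exact Real.rpow_le_rpow_of_exponent_le (by norm_num) (by push_cast; linarith)
      linarith
    have e2 : y ^ (-(1 / 2) : ℝ) ≤ (64 * Q)⁻¹ := by
      rw [Real.rpow_neg hyp.le, ← Real.sqrt_eq_rpow]
      refine inv_anti₀ (by positivity) (Real.le_sqrt_of_sq_le hx)
    have : 0 < y ^ (-(1 + α)) := Real.rpow_pos_of_pos hyp _
    calc _ ≤ 3 * 4 ^ 2 * ((5 ^ 4 * (y ^ (-(1 + α)) * (64 * Q)⁻¹)) * 6) := by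
          gcongr
          exact e1.trans (by gcongr)
      _ = Q * (64 * Q)⁻¹ * y ^ (-(1 + α)) := by rw [hQ]; ring
      _ = _ := by rw [mul_inv, mul_comm (64 : ℝ)⁻¹, ← mul_assoc, mul_inv_cancel₀ (by rw [hQ]; norm_num)]; ring
  have hpow : y ^ (-(65 / 32) : ℝ) ≤ y ^ (-(1 + α)) :=
    Real.rpow_le_rpow_of_exponent_le hy1 (by linarith)
  calc 1 / (64 * Real.pi) * y ^ (-(65 / 32) : ℝ) ≤ 1 / (64 * Real.pi) * y ^ (-(1 + α)) := by gcongr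
    _ = 1 / Real.pi * (y ^ (-(1 + α)) / 64) := by field_simp
    _ ≤ _ := by gcongr; linarith

/-! ### Differentiation in the parameter -/

/-- The linear functional on the parameter space with gradient `g`. -/
def gradCLM {E : Type*} [NormedAddCommGroup E] [NormedSpace ℝ E] (g : Fin 3 → E) : Param →L[ℝ] E :=
  ∑ i, (ContinuousLinearMap.proj (R := ℝ) (φ := fun _ : Fin 3 => ℝ) i).smulRight (g i)

lemma gradCLM_apply {E : Type*} [NormedAddCommGroup E] [NormedSpace ℝ E] (g : Fin 3 → E) (v : Param) :
    gradCLM g v = ∑ i, v i • g i := by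
  simp [gradCLM]

lemma gradCLM_single {E : Type*} [NormedAddCommGroup E] [NormedSpace ℝ E] (g : Fin 3 → E) (i : Fin 3) :
    gradCLM g (Pi.single i 1) = g i := by
  rw [gradCLM_apply, Finset.sum_eq_single i] <;> simp +contextual

lemma norm_gradCLM_le {E : Type*} [NormedAddCommGroup E] [NormedSpace ℝ E] (g : Fin 3 → E) :
    ‖gradCLM g‖ ≤ ∑ i, ‖g i‖ := by
  refine ContinuousLinearMap.opNorm_le_bound _ (by positivity) fun v => ?_
  rw [gradCLM_apply, Finset.sum_mul]
  refine (norm_sum_le _ _).trans (Finset.sum_le_sum fun i _ => ?_)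
  rw [norm_smul, mul_comm]
  gcongr
  exact norm_le_pi_norm v i

/-- A neighbourhood of the Cauchy parameter. -/
def nearCauchy : Set Param := {θ | 1 / 2 < θ 1 ∧ θ 1 < 2 ∧ 31 / 32 < θ 2 ∧ θ 2 < 33 / 32}

lemma isOpen_nearCauchy : IsOpen nearCauchy := by
  have h1 : Continuous fun θ : Param => θ 1 := continuous_apply 1
  have h2 : Continuous fun θ : Param => θ 2 := continuous_apply 2
  exact (isOpen_lt continuous_const h1).inter ((isOpen_lt h1 continuous_const).inter
    ((isOpen_lt continuous_const h2).inter (isOpen_lt h2 continuous_const)))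

lemma cauchyParam_mem_nearCauchy : cauchyParam ∈ nearCauchy := by
  simp only [nearCauchy, cauchyParam, Set.mem_ofPred_eq, Matrix.cons_val_one, Matrix.cons_val]
  norm_num

/-- The gradient in `θ` of the kernels. -/
def kernGrad (a b c : ℕ) (x : ℝ) (θ : Param) (s : ℝ) : Fin 3 → ℂ :=
  ![Complex.I * kern (a + 1) b c 0 (x - θ 0) (θ 1) (θ 2) s,
    ((θ 1)⁻¹ : ℝ) * (c * kern a b (c - 1) 0 (x - θ 0) (θ 1) (θ 2) s +
      (b : ℂ) * ((θ 2 : ℝ) * kern a b c 0 (x - θ 0) (θ 1) (θ 2) s) +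
      (-1 : ℂ) * ((θ 2 : ℝ) * kern a (b + 1) c 0 (x - θ 0) (θ 1) (θ 2) s)),
    b * kern a b (c + 1) 0 (x - θ 0) (θ 1) (θ 2) s +
      (-1 : ℂ) * kern a (b + 1) (c + 1) 0 (x - θ 0) (θ 1) (θ 2) s]

/-- Each partial derivative is again a combination of kernels. The location raises `a`; the scale
acts on log(σz) and on the powers of σz; the exponent brings down one logarithm, with or without one
more factor (σz)^α. So `norm_kern_le` also bounds the gradient. -/
lemma hasFDerivAt_kern (a b c : ℕ) (x : ℝ) {θ : Param} (hσ : 0 < θ 1) {s : ℝ} (hs : 0 < s) :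
    HasFDerivAt (fun θ : Param => kern a b c 0 (x - θ 0) (θ 1) (θ 2) s)
      (gradCLM (kernGrad a b c x θ s)) θ := by
  have hp : ∀ i : Fin 3, HasFDerivAt (fun θ : Param => ((θ i : ℝ) : ℂ))
      (Complex.ofRealCLM.comp (ContinuousLinearMap.proj (R := ℝ) (φ := fun _ : Fin 3 => ℝ) i)) θ :=
    fun i => (Complex.ofRealCLM.comp
      (ContinuousLinearMap.proj (R := ℝ) (φ := fun _ : Fin 3 => ℝ) i)).hasFDerivAt
  have hl : HasFDerivAt (fun θ : Param => ell 0 (θ 1) s)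
      (((θ 1 : ℂ)⁻¹) • (Complex.ofRealCLM.comp (ContinuousLinearMap.proj (R := ℝ) (φ := fun _ : Fin 3 => ℝ) 1))) θ := by
    have h1 : HasDerivAt (fun u : ℝ => ell 0 u s) (((θ 1)⁻¹ : ℝ) : ℂ) (θ 1) := by
      have := (((hasDerivAt_id (θ 1)).mul_const s).log (mul_pos hσ hs).ne').ofReal_comp.sub_const
        (((0 : ℝ) : ℂ) * Complex.I)
      refine this.congr_deriv ?_
      simp only [id, one_mul]
      congr 1
      field_simp
    refine (h1.hasFDerivAt.comp θ (ContinuousLinearMap.proj (R := ℝ) (φ := fun _ : Fin 3 => ℝ) 1).hasFDerivAt).congr_fderiv ?_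
    ext v
    simp [mul_comm]
  have hE := (hp 2).mul hl
  have h2 := hl.pow c
  have h3 := (hE.const_mul (b : ℂ)).cexp
  have h4 := (((((hp 0).const_sub (x : ℂ)).const_mul Complex.I).mul_const
    ((s : ℂ) * Complex.exp (-((0 : ℝ) * Complex.I)))).neg.sub hE.cexp).cexp
  have key := ((h2.const_mul (((s : ℂ) * Complex.exp (-((0 : ℝ) * Complex.I))) ^ a)).mul h3).mul h4
  refine (key.congr_of_eventuallyEq (Eventually.of_forall fun θ' => ?_)).congr_fderiv ?_
  · simp only [kern, Pi.mul_apply, Pi.neg_apply, Pi.sub_apply]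
    push_cast
    ring_nf
  · ext v
    have e2 : Complex.exp ((b + 1 : ℕ) * (θ 2) * ell 0 (θ 1) s) =
      Complex.exp (b * θ 2 * ell 0 (θ 1) s) * Complex.exp (θ 2 * ell 0 (θ 1) s) := by
      rw [← Complex.exp_add]; push_cast; ring_nf
    rw [gradCLM_apply, Fin.sum_univ_three]
    simp only [kernGrad, kern, e2, Matrix.cons_val_zero, Matrix.cons_val_one, Matrix.cons_val]
    simp [mul_assoc]
    ring_nf

/-- The gradient in `θ` of the kernel integrals. -/
def kernIntGrad (a b c : ℕ) (x : ℝ) (θ : Param) : Fin 3 → ℂ :=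
  ![Complex.I * kernInt (a + 1) b c 0 (x - θ 0) (θ 1) (θ 2),
    ((θ 1)⁻¹ : ℝ) * (c * kernInt a b (c - 1) 0 (x - θ 0) (θ 1) (θ 2) +
      (b : ℂ) * ((θ 2 : ℝ) * kernInt a b c 0 (x - θ 0) (θ 1) (θ 2)) +
      (-1 : ℂ) * ((θ 2 : ℝ) * kernInt a (b + 1) c 0 (x - θ 0) (θ 1) (θ 2))),
    b * kernInt a b (c + 1) 0 (x - θ 0) (θ 1) (θ 2) +
      (-1 : ℂ) * kernInt a (b + 1) (c + 1) 0 (x - θ 0) (θ 1) (θ 2)]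

lemma kernInt_zero_angle (a b c : ℕ) (y σ α : ℝ) :
    kernInt a b c 0 y σ α = ∫ s in Set.Ioi (0 : ℝ), kern a b c 0 y σ α s := by
  simp [kernInt]

lemma norm_kernGrad_le (a b c : ℕ) : ∃ C : ℝ, ∀ θ ∈ nearCauchy, ∀ x s : ℝ, 0 < s →
    ‖gradCLM (kernGrad a b c x θ s)‖ ≤ C * majorant s := by
  have hb : ∀ a b c : ℕ, ∃ C : ℝ, 0 < C ∧ ∀ θ ∈ nearCauchy, ∀ x s : ℝ, 0 < s →
      ‖kern a b c 0 (x - θ 0) (θ 1) (θ 2) s‖ ≤ C * majorant s := by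
    intro a b c
    obtain ⟨C, hC, h⟩ := norm_kern_le (α₁ := 31 / 32) (σ₁ := 1 / 2) (σ₂ := 2) (by norm_num) (by norm_num) a b c
    exact ⟨C, hC, fun θ hθ x s hs => h 0 (x - θ 0) (θ 1) (θ 2) s le_rfl (by norm_num) (by simp)
      hθ.1.le hθ.2.1.le hθ.2.2.1.le (by linarith [hθ.2.2.2]) hs⟩
  obtain ⟨C1, p1, h1⟩ := hb (a + 1) b c
  obtain ⟨C2, p2, h2⟩ := hb a b (c - 1)
  obtain ⟨C3, p3, h3⟩ := hb a b c
  obtain ⟨C4, p4, h4⟩ := hb a (b + 1) c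
  obtain ⟨C5, p5, h5⟩ := hb a b (c + 1)
  obtain ⟨C6, p6, h6⟩ := hb a (b + 1) (c + 1)
  refine ⟨C1 + 2 * (c * C2 + b * (2 * C3) + 2 * C4) + (b * C5 + C6), fun θ hθ x s hs => ?_⟩
  refine (norm_gradCLM_le _).trans ?_
  have g1 := h1 θ hθ x s hs
  have g2 := h2 θ hθ x s hs
  have g3 := h3 θ hθ x s hs
  have g4 := h4 θ hθ x s hs
  have g5 := h5 θ hθ x s hs
  have g6 := h6 θ hθ x s hs
  have hσ : 0 < θ 1 := by linarith [hθ.1]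
  have hσi : (θ 1)⁻¹ ≤ 2 := by
    rw [inv_le_comm₀ hσ (by norm_num)]; linarith [hθ.1]
  have hα : θ 2 ≤ 2 := by linarith [hθ.2.2.2]
  have hα0 : 0 ≤ θ 2 := by linarith [hθ.2.2.1]
  have hm := majorant_nonneg hs
  rw [Fin.sum_univ_three]
  simp only [kernGrad, Matrix.cons_val_zero, Matrix.cons_val_one, Matrix.cons_val]
  have n0 : ∀ z : ℂ, ‖((θ 2 : ℝ) : ℂ) * z‖ ≤ 2 * ‖z‖ := fun z => by
    rw [norm_mul, Complex.norm_of_nonneg hα0]; gcongr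
  have n1 : ∀ z : ℂ, ‖(((θ 1)⁻¹ : ℝ) : ℂ) * z‖ ≤ 2 * ‖z‖ := fun z => by
    rw [norm_mul, Complex.norm_of_nonneg (by positivity)]; gcongr
  have n2 : ∀ (n : ℕ) (z : ℂ), ‖(n : ℂ) * z‖ = n * ‖z‖ := fun n z => by
    rw [norm_mul, Complex.norm_natCast]
  have n3 : ∀ z : ℂ, ‖(-1 : ℂ) * z‖ = ‖z‖ := fun z => by simp
  have n4 : ∀ z : ℂ, ‖Complex.I * z‖ = ‖z‖ := fun z => by simp
  have t1 : ‖(((θ 1)⁻¹ : ℝ) : ℂ) * (c * kern a b (c - 1) 0 (x - θ 0) (θ 1) (θ 2) s +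
      (b : ℂ) * ((θ 2 : ℝ) * kern a b c 0 (x - θ 0) (θ 1) (θ 2) s) +
      (-1 : ℂ) * ((θ 2 : ℝ) * kern a (b + 1) c 0 (x - θ 0) (θ 1) (θ 2) s))‖ ≤
      2 * (c * (C2 * majorant s) + b * (2 * (C3 * majorant s)) + 2 * (C4 * majorant s)) := by
    refine (n1 _).trans (mul_le_mul_of_nonneg_left ?_ zero_le_two)
    refine (norm_add₃_le).trans ?_
    rw [n2, n2, n3]
    gcongr
    · exact (n0 _).trans (by gcongr)
    · exact (n0 _).trans (by gcongr)
  have t2 : ‖(b : ℂ) * kern a b (c + 1) 0 (x - θ 0) (θ 1) (θ 2) s +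
      (-1 : ℂ) * kern a (b + 1) (c + 1) 0 (x - θ 0) (θ 1) (θ 2) s‖ ≤
      b * (C5 * majorant s) + C6 * majorant s := by
    refine (norm_add_le _ _).trans ?_
    rw [n2, n3]
    gcongr
  rw [n4]
  calc _ ≤ C1 * majorant s +
      2 * (c * (C2 * majorant s) + b * (2 * (C3 * majorant s)) + 2 * (C4 * majorant s)) +
      (b * (C5 * majorant s) + C6 * majorant s) := by gcongr
    _ = _ := by ring

lemma integrableOn_kern_nearCauchy (a b c : ℕ) {θ : Param} (hθ : θ ∈ nearCauchy) (x : ℝ) :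
    IntegrableOn (kern a b c 0 (x - θ 0) (θ 1) (θ 2)) (Set.Ioi 0) :=
  integrableOn_kern a b c le_rfl (by norm_num) (by simp) (by linarith [hθ.1]) (by linarith [hθ.2.2.1])
    (by linarith [hθ.2.2.2])

lemma measurable_kernGrad (a b c : ℕ) (x : ℝ) (θ : Param) (i : Fin 3) :
    Measurable fun s => kernGrad a b c x θ s i := by
  have h := fun a b c => measurable_kern a b c 0 (x - θ 0) (θ 1) (θ 2)
  have h1 := h (a + 1) b c
  have h2 := h a b (c - 1)
  have h3 := h a b c
  have h4 := h a (b + 1) c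
  have h5 := h a b (c + 1)
  have h6 := h a (b + 1) (c + 1)
  fin_cases i <;> simp only [kernGrad, Fin.zero_eta, Fin.mk_one, Fin.reduceFinMk,
    Matrix.cons_val_zero, Matrix.cons_val_one, Matrix.cons_val] <;> fun_prop

lemma aestronglyMeasurable_gradCLM {f : ℝ → Fin 3 → ℂ} (hf : ∀ i, Measurable fun s => f s i)
    (μ : Measure ℝ) : AEStronglyMeasurable (fun s => gradCLM (f s)) μ := by
  unfold gradCLM
  refine Finset.aestronglyMeasurable_fun_sum _ fun i _ => ?_
  exact (ContinuousLinearMap.smulRightL ℝ Param ℂ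
    (ContinuousLinearMap.proj (R := ℝ) (φ := fun _ : Fin 3 => ℝ) i)).continuous.comp_aestronglyMeasurable
      (hf i).aestronglyMeasurable

lemma hasFDerivAt_kernInt (a b c : ℕ) (x : ℝ) {θ : Param} (hθ : θ ∈ nearCauchy) :
    HasFDerivAt (fun θ : Param => kernInt a b c 0 (x - θ 0) (θ 1) (θ 2))
      (gradCLM (kernIntGrad a b c x θ)) θ := by
  obtain ⟨C, hC⟩ := norm_kernGrad_le a b c
  have hint := fun a b c => integrableOn_kern_nearCauchy a b c hθ x
  have key := hasFDerivAt_integral_of_dominated_of_fderiv_le (𝕜 := ℝ)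
    (μ := volume.restrict (Set.Ioi (0 : ℝ)))
    (F := fun θ : Param => kern a b c 0 (x - θ 0) (θ 1) (θ 2))
    (F' := fun θ s => gradCLM (kernGrad a b c x θ s)) (x₀ := θ) (bound := fun s => C * majorant s)
    (isOpen_nearCauchy.mem_nhds hθ)
    (Eventually.of_forall fun θ => (measurable_kern a b c _ _ _ _).aestronglyMeasurable)
    (hint a b c)
    (aestronglyMeasurable_gradCLM (measurable_kernGrad a b c x θ) _)
    ((ae_restrict_iff' measurableSet_Ioi).2 (ae_of_all _ fun s hs θ' hθ' => hC θ' hθ' x s hs))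
    (integrableOn_majorant.const_mul C)
    ((ae_restrict_iff' measurableSet_Ioi).2 (ae_of_all _ fun s hs θ' hθ' =>
      hasFDerivAt_kern a b c x (by linarith [hθ'.1]) hs))
  simp only [kernInt_zero_angle]
  refine key.congr_fderiv ?_
  have hgi : ∀ i, Integrable (fun s => kernGrad a b c x θ s i) (volume.restrict (Set.Ioi (0 : ℝ))) := by
    intro i
    fin_cases i <;> simp only [kernGrad, Fin.zero_eta, Fin.mk_one, Fin.reduceFinMk,
      Matrix.cons_val_zero, Matrix.cons_val_one, Matrix.cons_val]
    · exact (hint _ _ _).const_mul _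
    · exact ((((hint _ _ _).const_mul _).add (((hint _ _ _).const_mul _).const_mul _)).add
        (((hint _ _ _).const_mul _).const_mul _)).const_mul _
    · exact ((hint _ _ _).const_mul _).add ((hint _ _ _).const_mul _)
  have hgval : ∀ i, ∫ s in Set.Ioi (0 : ℝ), kernGrad a b c x θ s i = kernIntGrad a b c x θ i := by
    intro i
    fin_cases i <;> simp only [kernGrad, kernIntGrad, Fin.zero_eta, Fin.mk_one, Fin.reduceFinMk,
      Matrix.cons_val_zero, Matrix.cons_val_one, Matrix.cons_val, kernInt_zero_angle]
    · rw [integral_const_mul]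
    · have i1 := (hint a b (c - 1)).const_mul (c : ℂ)
      have i2 := (((hint a b c).const_mul ((θ 2 : ℝ) : ℂ)).const_mul (b : ℂ))
      have i3 := (((hint a (b + 1) c).const_mul ((θ 2 : ℝ) : ℂ)).const_mul (-1 : ℂ))
      have e := integral_add (i1.add i2) i3
      simp only [Pi.add_apply] at e
      rw [integral_const_mul, e, integral_add i1 i2]
      simp only [integral_const_mul]
    · rw [integral_add ((hint _ _ _).const_mul _) ((hint _ _ _).const_mul _)]
      simp only [integral_const_mul]
  have hint' : Integrable (fun s => gradCLM (kernGrad a b c x θ s)) (volume.restrict (Set.Ioi (0 : ℝ))) :=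
    (integrableOn_majorant.const_mul C).mono'
      (aestronglyMeasurable_gradCLM (measurable_kernGrad a b c x θ) _)
      ((ae_restrict_iff' measurableSet_Ioi).2 (ae_of_all _ fun s hs => hC θ hθ x s hs))
  refine ContinuousLinearMap.ext fun v => ?_
  rw [ContinuousLinearMap.integral_apply hint', gradCLM_apply]
  simp only [gradCLM_apply]
  have e := integral_finsetSum Finset.univ fun i _ => (hgi i).smul (v i)
  simp only [Pi.smul_apply] at e
  rw [e]
  refine Finset.sum_congr rfl fun i _ => ?_
  rw [integral_smul, hgval]

/-- Functions obtained from the decaying kernel integrals by operations that preserve their tail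
bound; this class is closed under differentiation in the parameter. -/
inductive TailGen : (Param → ℝ → ℂ) → Prop
  | kernInt (a b c : ℕ) (h : 1 ≤ a + b) :
      TailGen fun θ x => kernInt a b c 0 (x - θ 0) (θ 1) (θ 2)
  | add {g h : Param → ℝ → ℂ} (hg : TailGen g) (hh : TailGen h) : TailGen fun θ x => g θ x + h θ x
  | const_mul (z : ℂ) {g : Param → ℝ → ℂ} (hg : TailGen g) : TailGen fun θ x => z * g θ x
  | exponent_mul {g : Param → ℝ → ℂ} (hg : TailGen g) : TailGen fun θ x => ((θ 2 : ℝ) : ℂ) * g θ x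
  | inv_scale_mul {g : Param → ℝ → ℂ} (hg : TailGen g) :
      TailGen fun θ x => (((θ 1)⁻¹ : ℝ) : ℂ) * g θ x

lemma TailGen.kernIntGrad (a b c : ℕ) (h : 1 ≤ a + b) (i : Fin 3) :
    TailGen fun θ x => SymmStable.kernIntGrad a b c x θ i := by
  fin_cases i
  · exact .const_mul _ (.kernInt _ _ _ (by omega))
  · exact .inv_scale_mul (.add (.add (.const_mul _ (.kernInt _ _ _ h))
      (.const_mul _ (.exponent_mul (.kernInt _ _ _ h))))
      (.const_mul _ (.exponent_mul (.kernInt _ _ _ (by omega)))))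
  · exact .add (.const_mul _ (.kernInt _ _ _ h)) (.const_mul _ (.kernInt _ _ _ (by omega)))

/-- The integral with a = b = 0 is outside the class `TailGen`, but its gradient is inside: the
terms with unchanged `a` and `b` carry the coefficients b = 0 or c = 0, and the others have a + b =
1. -/
lemma tailGen_kernIntGrad_zero (i : Fin 3) :
    ∃ g : Param → ℝ → ℂ, TailGen g ∧ ∀ θ x, kernIntGrad 0 0 0 x θ i = g θ x := by
  fin_cases i
  · exact ⟨_, .const_mul Complex.I (.kernInt 1 0 0 (by omega)), fun θ x => rfl⟩
  · refine ⟨_, .inv_scale_mul (.const_mul (-1) (.exponent_mul (.kernInt 0 1 0 (by omega)))),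
      fun θ x => ?_⟩
    simp [kernIntGrad]
  · refine ⟨_, .const_mul (-1) (.kernInt 0 1 1 (by omega)), fun θ x => ?_⟩
    simp [kernIntGrad]

/-- Induction with the product rule. The multipliers α and 1/σ each add one term, in their own
direction, and that term stays in the class. -/
lemma TailGen.hasFDerivAt {g : Param → ℝ → ℂ} (hg : TailGen g) :
    ∃ g' : Fin 3 → Param → ℝ → ℂ, (∀ i, TailGen (g' i)) ∧
      ∀ θ ∈ nearCauchy, ∀ x, HasFDerivAt (fun θ => g θ x) (gradCLM fun i => g' i θ x) θ := by
  have hproj : ∀ (i : Fin 3) (θ : Param), HasFDerivAt (fun θ : Param => θ i)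
      (ContinuousLinearMap.proj (R := ℝ) (φ := fun _ : Fin 3 => ℝ) i) θ :=
    fun i θ => (ContinuousLinearMap.proj (R := ℝ) (φ := fun _ : Fin 3 => ℝ) i).hasFDerivAt
  induction hg with
  | kernInt a b c h =>
    exact ⟨fun i θ x => SymmStable.kernIntGrad a b c x θ i, TailGen.kernIntGrad a b c h,
      fun θ hθ x => hasFDerivAt_kernInt a b c x hθ⟩
  | add hg hh ihg ihh =>
    obtain ⟨g', hg', dg⟩ := ihg
    obtain ⟨h', hh', dh⟩ := ihh
    refine ⟨fun i θ x => g' i θ x + h' i θ x, fun i => .add (hg' i) (hh' i), fun θ hθ x => ?_⟩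
    refine ((dg θ hθ x).add (dh θ hθ x)).congr_fderiv ?_
    ext v; simp [gradCLM_apply, Fin.sum_univ_three]; ring
  | const_mul z hg ih =>
    obtain ⟨g', hg', dg⟩ := ih
    refine ⟨fun i θ x => z * g' i θ x, fun i => .const_mul z (hg' i), fun θ hθ x => ?_⟩
    refine ((dg θ hθ x).const_mul z).congr_fderiv ?_
    ext v; simp [gradCLM_apply, Fin.sum_univ_three]; ring
  | @exponent_mul g hg ih =>
    obtain ⟨g', hg', dg⟩ := ih
    refine ⟨![fun θ x => ((θ 2 : ℝ) : ℂ) * g' 0 θ x, fun θ x => ((θ 2 : ℝ) : ℂ) * g' 1 θ x,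
      fun θ x => ((θ 2 : ℝ) : ℂ) * g' 2 θ x + g θ x], fun i => ?_, fun θ hθ x => ?_⟩
    · fin_cases i
      · exact .exponent_mul (hg' 0)
      · exact .exponent_mul (hg' 1)
      · exact .add (.exponent_mul (hg' 2)) hg
    · refine ((Complex.ofRealCLM.hasFDerivAt.comp θ (hproj 2 θ)).mul (dg θ hθ x)).congr_fderiv ?_
      ext v; simp [gradCLM_apply, Fin.sum_univ_three]; ring
  | @inv_scale_mul g hg ih =>
    obtain ⟨g', hg', dg⟩ := ih
    refine ⟨![fun θ x => (((θ 1)⁻¹ : ℝ) : ℂ) * g' 0 θ x,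
      fun θ x => (((θ 1)⁻¹ : ℝ) : ℂ) * g' 1 θ x +
        (-1 : ℂ) * ((((θ 1)⁻¹ : ℝ) : ℂ) * ((((θ 1)⁻¹ : ℝ) : ℂ) * g θ x)),
      fun θ x => (((θ 1)⁻¹ : ℝ) : ℂ) * g' 2 θ x], fun i => ?_, fun θ hθ x => ?_⟩
    · fin_cases i
      · exact .inv_scale_mul (hg' 0)
      · exact .add (.inv_scale_mul (hg' 1)) (.const_mul _ (.inv_scale_mul (.inv_scale_mul hg)))
      · exact .inv_scale_mul (hg' 2)
    · have hσ : θ 1 ≠ 0 := by have := hθ.1; intro h; rw [h] at this; linarith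
      have hinv : HasFDerivAt (fun θ : Param => (θ 1)⁻¹)
          ((-((θ 1) ^ 2)⁻¹) • ContinuousLinearMap.proj (R := ℝ) (φ := fun _ : Fin 3 => ℝ) 1) θ :=
        (hasDerivAt_inv hσ).comp_hasFDerivAt θ (hproj 1 θ)
      refine ((Complex.ofRealCLM.hasFDerivAt.comp θ hinv).mul (dg θ hθ x)).congr_fderiv ?_
      ext v; simp [gradCLM_apply, Fin.sum_univ_three]; ring

lemma TailGen.norm_le {g : Param → ℝ → ℂ} (hg : TailGen g) :
    ∃ C : ℝ, 0 < C ∧ ∀ θ ∈ nearCauchy, ∀ x,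
      ‖g θ x‖ ≤ C * (1 + |x - θ 0|) ^ (-(31 / 16) : ℝ) := by
  induction hg with
  | kernInt a b c h =>
    obtain ⟨C, hC, hb⟩ := norm_kernInt_tail_le a b c h
    exact ⟨C, hC, fun θ hθ x => hb _ _ _ hθ.1.le hθ.2.1.le hθ.2.2.1.le (by linarith [hθ.2.2.2])⟩
  | add hg hh ihg ihh =>
    obtain ⟨C, hC, hb⟩ := ihg
    obtain ⟨C', hC', hb'⟩ := ihh
    refine ⟨C + C', by positivity, fun θ hθ x => (norm_add_le _ _).trans ?_⟩
    rw [add_mul]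
    exact add_le_add (hb θ hθ x) (hb' θ hθ x)
  | const_mul z hg ih =>
    obtain ⟨C, hC, hb⟩ := ih
    refine ⟨(‖z‖ + 1) * C, by positivity, fun θ hθ x => ?_⟩
    rw [norm_mul, mul_assoc]
    exact mul_le_mul (by linarith) (hb θ hθ x) (norm_nonneg _) (by positivity)
  | exponent_mul hg ih =>
    obtain ⟨C, hC, hb⟩ := ih
    refine ⟨2 * C, by positivity, fun θ hθ x => ?_⟩
    rw [norm_mul, mul_assoc, Complex.norm_of_nonneg (by linarith [hθ.2.2.1])]
    exact mul_le_mul (by linarith [hθ.2.2.2]) (hb θ hθ x) (norm_nonneg _) (by positivity)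
  | inv_scale_mul hg ih =>
    obtain ⟨C, hC, hb⟩ := ih
    refine ⟨2 * C, by positivity, fun θ hθ x => ?_⟩
    have hσ : 0 < θ 1 := by linarith [hθ.1]
    rw [norm_mul, mul_assoc, Complex.norm_of_nonneg (by positivity)]
    refine mul_le_mul ?_ (hb θ hθ x) (norm_nonneg _) (by positivity)
    rw [inv_le_comm₀ hσ (by norm_num)]; linarith [hθ.1]

lemma TailGen.measurable {g : Param → ℝ → ℂ} (hg : TailGen g) (θ : Param) :
    Measurable fun x => g θ x := by
  induction hg with
  | kernInt a b c h =>
    have h1 : StronglyMeasurable (Function.uncurry fun x s : ℝ =>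
        Complex.exp (-((0 : ℝ) * Complex.I)) * kern a b c 0 (x - θ 0) (θ 1) (θ 2) s) := by
      refine Measurable.stronglyMeasurable ?_
      unfold kern ell Function.uncurry
      fun_prop
    exact (h1.integral_prod_right (ν := volume.restrict (Set.Ioi (0 : ℝ)))).measurable
  | add hg hh ihg ihh => exact ihg.add ihh
  | const_mul z hg ih => exact ih.const_mul z
  | exponent_mul hg ih => exact ih.const_mul _
  | inv_scale_mul hg ih => exact ih.const_mul _

lemma measurable_density (θ : Param) (hσ : 0 < θ 1) (hα : 0 < θ 2) (hα2 : θ 2 ≤ 2) :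
    Measurable (density θ) := by
  have h1 : StronglyMeasurable (Function.uncurry fun x s : ℝ =>
      Complex.exp (-((0 : ℝ) * Complex.I)) * kern 0 0 0 0 (x - θ 0) (θ 1) (θ 2) s) := by
    refine Measurable.stronglyMeasurable ?_
    unfold kern ell Function.uncurry
    fun_prop
  have h2 := (h1.integral_prod_right (ν := volume.restrict (Set.Ioi (0 : ℝ)))).measurable
  have h3 : density θ = fun x => (1 / Real.pi) * (kernInt 0 0 0 0 (x - θ 0) (θ 1) (θ 2)).re :=
    funext fun x => density_eq hσ hα hα2 x
  rw [h3]
  exact (Complex.measurable_re.comp h2).const_mul _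

/-- The density `density θ x` near the Cauchy parameter and its partial derivatives
in `θ` up to order three, with their tail bounds. -/
structure DensityDerivs (f₁ : Fin 3 → Param → ℝ → ℝ) (f₂ : Fin 3 → Fin 3 → Param → ℝ → ℝ)
    (f₃ : Fin 3 → Fin 3 → Fin 3 → Param → ℝ → ℝ) (C : ℝ) : Prop where
  pos : 0 < C
  deriv₁ : ∀ θ ∈ nearCauchy, ∀ x, HasFDerivAt (fun θ => density θ x) (gradCLM fun i => f₁ i θ x) θ
  deriv₂ : ∀ i, ∀ θ ∈ nearCauchy, ∀ x,
    HasFDerivAt (fun θ => f₁ i θ x) (gradCLM fun j => f₂ i j θ x) θ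
  deriv₃ : ∀ i j, ∀ θ ∈ nearCauchy, ∀ x,
    HasFDerivAt (fun θ => f₂ i j θ x) (gradCLM fun k => f₃ i j k θ x) θ
  bound₁ : ∀ i, ∀ θ ∈ nearCauchy, ∀ x, |f₁ i θ x| ≤ C * (1 + |x - θ 0|) ^ (-(31 / 16) : ℝ)
  bound₂ : ∀ i j, ∀ θ ∈ nearCauchy, ∀ x, |f₂ i j θ x| ≤ C * (1 + |x - θ 0|) ^ (-(31 / 16) : ℝ)
  bound₃ : ∀ i j k, ∀ θ ∈ nearCauchy, ∀ x, |f₃ i j k θ x| ≤ C * (1 + |x - θ 0|) ^ (-(31 / 16) : ℝ)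
  measurable₁ : ∀ i θ, Measurable (f₁ i θ)
  measurable₂ : ∀ i j θ, Measurable (f₂ i j θ)

lemma hasFDerivAt_re {g : Param → ℂ} {g' : Fin 3 → ℂ} {θ : Param}
    (h : HasFDerivAt g (gradCLM g') θ) :
    HasFDerivAt (fun θ => 1 / Real.pi * (g θ).re) (gradCLM fun i => 1 / Real.pi * (g' i).re) θ := by
  refine ((Complex.reCLM.hasFDerivAt.comp θ h).const_mul (1 / Real.pi)).congr_fderiv ?_
  ext v
  simp [gradCLM_apply, Fin.sum_univ_three]
  ring

lemma TailGen.re_bound {ι : Type*} [Finite ι] {g : ι → Param → ℝ → ℂ} (hg : ∀ i, TailGen (g i)) :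
    ∃ C : ℝ, 0 < C ∧ ∀ i, ∀ θ ∈ nearCauchy, ∀ x,
      |1 / Real.pi * (g i θ x).re| ≤ C * (1 + |x - θ 0|) ^ (-(31 / 16) : ℝ) := by
  choose C hC h using fun i => (hg i).norm_le
  have := Fintype.ofFinite ι
  refine ⟨∑ i, C i + 1, by have := Finset.sum_nonneg fun i (_ : i ∈ Finset.univ) => (hC i).le
                           linarith, fun i θ hθ x => ?_⟩
  have h4 : 1 / Real.pi ≤ 1 := by
    rw [div_le_one Real.pi_pos]; linarith [Real.pi_gt_three]
  have h5 : C i ≤ ∑ i, C i := Finset.single_le_sum (fun i _ => (hC i).le) (Finset.mem_univ i)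
  rw [abs_mul, abs_of_pos (by positivity)]
  calc _ ≤ 1 * |(g i θ x).re| := by gcongr
    _ ≤ 1 * (C i * (1 + |x - θ 0|) ^ (-(31 / 16) : ℝ)) := by
        gcongr; exact (Complex.abs_re_le_norm _).trans (h i θ hθ x)
    _ ≤ _ := by
        rw [one_mul]
        have : 0 ≤ (1 + |x - θ 0|) ^ (-(31 / 16) : ℝ) := by positivity
        gcongr
        linarith

/-- The gradient of the density lies in `TailGen`, and closure under differentiation is used twice
more. The third order gives continuity of the Hessian and the remainder of the Taylor expansion of
the score. The last clause keeps the explicit first derivatives, which identify the scores. -/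
lemma exists_densityDerivs : ∃ f₁ f₂ f₃ C, DensityDerivs f₁ f₂ f₃ C ∧
    ∀ i θ x, f₁ i θ x = 1 / Real.pi * (kernIntGrad 0 0 0 x θ i).re := by
  choose g₁ hg₁ e₁ using tailGen_kernIntGrad_zero
  choose g₂ hg₂ d₂ using fun i => (hg₁ i).hasFDerivAt
  choose g₃ hg₃ d₃ using fun i j => (hg₂ i j).hasFDerivAt
  obtain ⟨C₁, p₁, b₁⟩ := TailGen.re_bound hg₁
  obtain ⟨C₂, p₂, b₂⟩ := TailGen.re_bound (ι := Fin 3 × Fin 3) fun p => hg₂ p.1 p.2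
  obtain ⟨C₃, p₃, b₃⟩ := TailGen.re_bound (ι := Fin 3 × Fin 3 × Fin 3) fun p => hg₃ p.1 p.2.1 p.2.2
  refine ⟨fun i θ x => 1 / Real.pi * (g₁ i θ x).re, fun i j θ x => 1 / Real.pi * (g₂ i j θ x).re,
    fun i j k θ x => 1 / Real.pi * (g₃ i j k θ x).re, C₁ + C₂ + C₃, ⟨by positivity, ?_, ?_, ?_, ?_, ?_, ?_, ?_, ?_⟩, ?_⟩
  · intro θ hθ x
    have h1 := hasFDerivAt_re (hasFDerivAt_kernInt 0 0 0 x hθ)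
    simp only [e₁] at h1
    refine h1.congr_of_eventuallyEq ?_
    filter_upwards [isOpen_nearCauchy.mem_nhds hθ] with θ' hθ'
    exact density_eq (by linarith [hθ'.1]) (by linarith [hθ'.2.2.1]) (by linarith [hθ'.2.2.2]) x
  · exact fun i θ hθ x => hasFDerivAt_re (d₂ i θ hθ x)
  · exact fun i j θ hθ x => hasFDerivAt_re (d₃ i j θ hθ x)
  · intro i θ hθ x
    refine (b₁ i θ hθ x).trans ?_
    gcongr
    linarith
  · intro i j θ hθ x
    refine (b₂ (i, j) θ hθ x).trans ?_
    gcongr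
    linarith
  · intro i j k θ hθ x
    refine (b₃ (i, j, k) θ hθ x).trans ?_
    gcongr
    linarith
  · exact fun i θ => (Complex.measurable_re.comp ((hg₁ i).measurable θ)).const_mul _
  · exact fun i j θ => (Complex.measurable_re.comp ((hg₂ i j).measurable θ)).const_mul _
  · intro i θ x
    rw [e₁]

/-! ### Continuity in the parameter, envelopes, total mass and identifiability -/

lemma exp_neg_rpow_le {u v a b : ℝ} (hu : 0 ≤ u) (huv : u ≤ v) (ha : 0 < a) (hab : a ≤ b) :
    Real.exp (-v ^ b) ≤ Real.exp 1 * Real.exp (-u ^ a) := by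
  rw [← Real.exp_add]
  gcongr
  rcases le_total u 1 with h | h
  · have := Real.rpow_le_one hu h ha.le
    have := Real.rpow_nonneg (hu.trans huv) b
    linarith
  · have h1 := Real.rpow_le_rpow_of_exponent_le h hab
    have h2 := Real.rpow_le_rpow hu huv (ha.le.trans hab)
    linarith

lemma norm_charFn_le {θ : Param} {σ α : ℝ} (hσ : 0 ≤ σ) (hσ' : σ ≤ θ 1) (hα : 0 < α) (hα' : α ≤ θ 2)
    (t : ℝ) : ‖charFn θ t‖ ≤ Real.exp 1 * ‖charFn ![0, σ, α] t‖ := by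
  rw [norm_charFn, norm_charFn]
  simp only [Matrix.cons_val_one, Matrix.cons_val_zero, Matrix.cons_val]
  refine exp_neg_rpow_le (abs_nonneg _) ?_ hα hα'
  rw [abs_mul, abs_mul, abs_of_nonneg hσ, abs_of_nonneg (hσ.trans hσ')]
  gcongr

lemma measurable_charFn (θ : Param) : Measurable (charFn θ) := by
  unfold charFn; fun_prop

lemma integrable_charFn' {θ : Param} (hσ : 0 < θ 1) (hα : 0 < θ 2) : Integrable (charFn θ) := by
  have h := integrable_charFn (θ := ![0, θ 1, min (θ 2) 2]) hσ (lt_min hα two_pos) (min_le_right _ _)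
  exact (h.norm.const_mul (Real.exp 1)).mono' (measurable_charFn θ).aestronglyMeasurable
    (ae_of_all _ fun t => norm_charFn_le hσ.le le_rfl (lt_min hα two_pos) (min_le_left _ _) t)

lemma abs_density_sub_le {θ θ' : Param} (h : Integrable (charFn θ)) (h' : Integrable (charFn θ'))
    (x : ℝ) : |density θ x - density θ' x| ≤ ∫ t, ‖charFn θ t - charFn θ' t‖ := by
  have hE : ∀ t : ℝ, ‖Complex.exp (-(Complex.I * (t : ℂ) * (x : ℂ)))‖ = 1 := fun t => by
    rw [Complex.norm_exp]; simp
  have hi : ∀ θ : Param, Integrable (charFn θ) →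
      Integrable fun t : ℝ => Complex.exp (-(Complex.I * (t : ℂ) * (x : ℂ))) * charFn θ t := by
    intro θ h
    refine h.norm.mono' ?_ (ae_of_all _ fun t => by rw [norm_mul, hE, one_mul])
    exact ((by fun_prop : Measurable fun t : ℝ => Complex.exp (-(Complex.I * (t : ℂ) * (x : ℂ)))).mul
      (measurable_charFn θ)).aestronglyMeasurable
  unfold density
  rw [← mul_sub, ← Complex.sub_re, ← integral_sub (hi θ h) (hi θ' h'), abs_mul,
    abs_of_pos (by positivity)]
  have h4 : 1 / (2 * Real.pi) ≤ 1 := by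
    rw [div_le_one (by positivity)]; linarith [Real.pi_gt_three]
  have h5 := (Complex.abs_re_le_norm (∫ t : ℝ, (Complex.exp (-(Complex.I * (t : ℂ) * (x : ℂ))) * charFn θ t -
    Complex.exp (-(Complex.I * (t : ℂ) * (x : ℂ))) * charFn θ' t))).trans (norm_integral_le_integral_norm _)
  simp only [← mul_sub, norm_mul, hE, one_mul] at h5 ⊢
  calc _ ≤ 1 * ∫ t, ‖charFn θ t - charFn θ' t‖ := mul_le_mul h4 h5 (abs_nonneg _) zero_le_one
    _ = _ := one_mul _

/-- The densities depend continuously on the parameter, uniformly in the argument. -/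
lemma eventually_abs_density_sub_le {θ₁ : Param} (hσ : 0 < θ₁ 1) (hα : 0 < θ₁ 2) {r : ℝ} (hr : 0 < r) :
    ∀ᶠ θ in 𝓝 θ₁, ∀ x, |density θ x - density θ₁ x| ≤ r := by
  have c1 : ContinuousAt (fun θ : Param => θ 1) θ₁ := (continuous_apply 1).continuousAt
  have c2 : ContinuousAt (fun θ : Param => θ 2) θ₁ := (continuous_apply 2).continuousAt
  have ev1 : ∀ᶠ θ in 𝓝 θ₁, θ₁ 1 / 2 < θ 1 := c1.eventually_const_lt (by linarith)
  -- The exponent of θ₁ is not assumed to be at most 2. The minimum keeps the dominating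
  -- characteristic function in the range covered by `integrable_charFn`.
  have ev2 : ∀ᶠ θ in 𝓝 θ₁, min (θ₁ 2 / 2) 2 < θ 2 :=
    c2.eventually_const_lt ((min_le_left _ _).trans_lt (by linarith))
  have hmin : 0 < min (θ₁ 2 / 2) 2 := lt_min (by linarith) two_pos
  have hint := integrable_charFn (θ := ![0, θ₁ 1 / 2, min (θ₁ 2 / 2) 2]) (half_pos hσ) hmin (min_le_right _ _)
  have hlim : Tendsto (fun θ => ∫ t, ‖charFn θ t - charFn θ₁ t‖) (𝓝 θ₁) (𝓝 0) := by
    have := tendsto_integral_filter_of_dominated_convergence (μ := (volume : Measure ℝ)) (l := 𝓝 θ₁)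
      (F := fun θ t => ‖charFn θ t - charFn θ₁ t‖) (f := fun _ => 0)
      (fun t => Real.exp 1 * ‖charFn ![0, θ₁ 1 / 2, min (θ₁ 2 / 2) 2] t‖ + ‖charFn θ₁ t‖)
      (Eventually.of_forall fun θ =>
        ((measurable_charFn θ).sub (measurable_charFn θ₁)).norm.aestronglyMeasurable) ?_
      ((hint.norm.const_mul _).add (integrable_charFn' hσ hα).norm) ?_
    · simpa using this
    · filter_upwards [ev1, ev2] with θ h1 h2
      refine ae_of_all _ fun t => ?_
      rw [norm_norm]
      refine (norm_sub_le _ _).trans ?_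
      gcongr
      exact norm_charFn_le (half_pos hσ).le h1.le hmin h2.le t
    · have h0 : ∀ᵐ t : ℝ, t ≠ 0 := by simp [ae_iff, measure_singleton]
      filter_upwards [h0] with t ht
      have hc : ContinuousAt (fun θ : Param => charFn θ t) θ₁ := by
        unfold charFn
        have e1 : ContinuousAt (fun θ : Param => |θ 1 * t| ^ θ 2) θ₁ := by
          refine ContinuousAt.rpow (c1.mul continuousAt_const).abs c2 (Or.inl ?_)
          exact abs_ne_zero.2 (mul_ne_zero hσ.ne' ht)
        have e2 : ContinuousAt (fun θ : Param => ((θ 0 : ℝ) : ℂ)) θ₁ :=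
          (Complex.continuous_ofReal.comp (continuous_apply 0)).continuousAt
        have e3 := Complex.continuous_ofReal.continuousAt.comp e1
        refine Complex.continuous_exp.continuousAt.comp (f := fun θ : Param => Complex.I * ((θ 0 : ℝ) : ℂ) * (t : ℂ) - ((|θ 1 * t| ^ θ 2 : ℝ) : ℂ)) ?_
        exact ((continuousAt_const.mul e2).mul continuousAt_const).sub e3
      have := ((hc.sub (continuousAt_const (y := charFn θ₁ t))).norm).tendsto
      simpa using this
  filter_upwards [hlim.eventually_le_const hr, ev1, ev2] with θ h h1 h2 x
  exact (abs_density_sub_le (integrable_charFn' (by linarith) (hmin.trans h2)) (integrable_charFn' hσ hα) x).trans h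

/-- A common integrable majorant for the densities with bounded parameters. -/
lemma abs_density_le_envelope {ε s : ℝ} (hε : 0 < ε) (hs : 0 < s) (M S : ℝ) :
    ∃ C : ℝ, 0 < C ∧ ∀ θ : Param, |θ 0| ≤ M → s ≤ θ 1 → θ 1 ≤ S → ε ≤ θ 2 → θ 2 ≤ 2 → ∀ x,
      |density θ x| ≤ C * (1 + |x|) ^ (-(1 + ε)) := by
  obtain ⟨A, hA, hAb⟩ := abs_density_le_inv hε
  set M' := |M| with hM'
  set S' := |S| + 1 with hS'
  refine ⟨A * s⁻¹ * (2 * M' + 3) ^ (1 + ε) + 500 * S' ^ 2 * 2 ^ (1 + ε), by positivity,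
    fun θ hμ hσ hσ2 hα hα2 x => ?_⟩
  have hσ0 : 0 < θ 1 := hs.trans_le hσ
  have hα0 : 0 < θ 2 := hε.trans_le hα
  have hμ' : |θ 0| ≤ M' := hμ.trans (le_abs_self M)
  have hp : 0 < (1 + |x|) ^ (-(1 + ε)) := by positivity
  rw [add_mul]
  -- On this bounded range the sup bound `abs_density_le_inv` suffices. Beyond it |x - μ| ≥ (1 +
  -- |x|)/2, and the power tail applies.
  rcases le_total |x| (2 * M' + 2) with h | h
  · have h1 : (1 : ℝ) ≤ (2 * M' + 3) ^ (1 + ε) * (1 + |x|) ^ (-(1 + ε)) := by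
      rw [Real.rpow_neg (by positivity), ← div_eq_mul_inv, one_le_div (by positivity)]
      exact Real.rpow_le_rpow (by positivity) (by linarith) (by linarith)
    have h2 : |density θ x| ≤ A * s⁻¹ := (hAb θ hσ0 hα hα2 x).trans (by gcongr)
    have h3 : 0 ≤ 500 * S' ^ 2 * 2 ^ (1 + ε) * (1 + |x|) ^ (-(1 + ε)) := by positivity
    have h4 : 0 < A * s⁻¹ := by positivity
    nlinarith
  · have h1 : (1 + |x|) / 2 ≤ |x - θ 0| := by
      have := abs_sub_abs_le_abs_sub x (θ 0)
      linarith
    have h0 : (0 : ℝ) ≤ M' := abs_nonneg M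
    have h2 : 1 ≤ |x - θ 0| := by linarith
    have h3 : x ≠ θ 0 := by
      rintro rfl; simp at h2; linarith
    have h4 := abs_density_le hσ0 hα0 hα2 h3
    have h5 : θ 1 ^ θ 2 ≤ S' ^ 2 := by
      have e1 : θ 1 ^ θ 2 ≤ S' ^ θ 2 := by
        gcongr; exact hσ2.trans ((le_abs_self S).trans (by linarith))
      have e2 : S' ^ θ 2 ≤ S' ^ (2 : ℝ) :=
        Real.rpow_le_rpow_of_exponent_le (by have := abs_nonneg S; linarith) hα2
      rw [Real.rpow_two] at e2
      linarith
    have h6 : |x - θ 0| ^ (-(1 + θ 2)) ≤ 2 ^ (1 + ε) * (1 + |x|) ^ (-(1 + ε)) := by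
      calc |x - θ 0| ^ (-(1 + θ 2)) ≤ |x - θ 0| ^ (-(1 + ε)) :=
            Real.rpow_le_rpow_of_exponent_le h2 (by linarith)
        _ ≤ ((1 + |x|) / 2) ^ (-(1 + ε)) :=
            Real.rpow_le_rpow_of_nonpos (by positivity) h1 (by linarith)
        _ = _ := by
            rw [Real.div_rpow (by positivity) (by norm_num), Real.rpow_neg (by norm_num : (0 : ℝ) ≤ 2),
              div_inv_eq_mul, mul_comm]
    have h7 : 0 ≤ A * s⁻¹ * (2 * M' + 3) ^ (1 + ε) * (1 + |x|) ^ (-(1 + ε)) := by positivity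
    calc |density θ x| ≤ 500 * S' ^ 2 * (2 ^ (1 + ε) * (1 + |x|) ^ (-(1 + ε))) :=
          h4.trans (by gcongr)
      _ ≤ _ := by linarith

lemma integrable_envelope {r : ℝ} (hr : 1 < r) : Integrable fun x : ℝ => (1 + |x|) ^ (-r) := by
  have := integrable_one_add_norm (E := ℝ) (μ := volume) (r := r) (by simpa using hr)
  simpa using this

lemma integrable_density {θ : Param} (hσ : 0 < θ 1) (hα : 0 < θ 2) (hα2 : θ 2 ≤ 2) :
    Integrable (density θ) := by
  obtain ⟨C, hC, h⟩ := abs_density_le_envelope hα hσ |θ 0| (θ 1)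
  exact ((integrable_envelope (r := 1 + θ 2) (by linarith)).const_mul C).mono'
    (measurable_density θ hσ hα hα2).aestronglyMeasurable
    (ae_of_all _ fun x => h θ le_rfl le_rfl le_rfl le_rfl hα2 x)

open FourierTransform in
lemma fourier_charFn {θ : Param} (hσ : 0 < θ 1) (hα : 0 < θ 2) (hα2 : θ 2 ≤ 2) (w : ℝ) :
    𝓕 (charFn θ) w = ((2 * Real.pi * density θ (2 * Real.pi * w) : ℝ) : ℂ) := by
  rw [Real.fourier_eq' , density_eq hσ hα hα2]
  have := (integral_exp_mul_charFn hσ hα hα2 (2 * Real.pi * w)).2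
  rw [show 2 * Real.pi * (1 / Real.pi * (kernInt 0 0 0 0 (2 * Real.pi * w - θ 0) (θ 1) (θ 2)).re) =
    2 * (kernInt 0 0 0 0 (2 * Real.pi * w - θ 0) (θ 1) (θ 2)).re by field_simp, ← this]
  congr 1
  ext t
  rw [smul_eq_mul]
  congr 2
  simp
  ring

open FourierTransform in
-- Fourier inversion of the characteristic function, evaluated at 0, where it equals 1. The power
-- tail makes the transform integrable.
lemma integral_density {θ : Param} (hσ : 0 < θ 1) (hα : 0 < θ 2) (hα2 : θ 2 ≤ 2) :
    ∫ x, density θ x = 1 := by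
  have hF : 𝓕 (charFn θ) = fun w => ((2 * Real.pi * density θ (2 * Real.pi * w) : ℝ) : ℂ) :=
    funext (fourier_charFn hσ hα hα2)
  have hi : Integrable (𝓕 (charFn θ)) := by
    rw [hF]
    exact (((integrable_density hσ hα hα2).comp_mul_left' (by positivity)).const_mul _).ofReal
  have h := congrFun ((continuous_charFn hα).fourierInv_fourier_eq (integrable_charFn hσ hα hα2) hi) 0
  rw [Real.fourierInv_eq', hF] at h
  have h0 : charFn θ 0 = 1 := by simp [charFn, Real.zero_rpow hα.ne']
  rw [h0] at h
  simp only [inner_zero_right, mul_zero, Complex.ofReal_zero, zero_mul, Complex.exp_zero, one_smul] at h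
  rw [integral_complex_ofReal, integral_const_mul,
    Measure.integral_comp_mul_left (fun x => density θ x), smul_eq_mul,
    abs_of_pos (by positivity), ← mul_assoc, mul_inv_cancel₀ (by positivity), one_mul] at h
  exact_mod_cast h

open FourierTransform in
/-- The densities identify the parameter. -/
lemma density_injective {θ θ' : Param} (hσ : 0 < θ 1) (hα : 0 < θ 2) (hα2 : θ 2 ≤ 2)
    (hσ' : 0 < θ' 1) (hα' : 0 < θ' 2) (hα2' : θ' 2 ≤ 2) (h : ∀ x, density θ x = density θ' x) :
    θ = θ' := by
  have hF : 𝓕 (charFn θ) = 𝓕 (charFn θ') := by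
    ext w; rw [fourier_charFn hσ hα hα2, fourier_charFn hσ' hα' hα2', h]
  have hi : ∀ θ : Param, 0 < θ 1 → 0 < θ 2 → θ 2 ≤ 2 → Integrable (𝓕 (charFn θ)) := by
    intro θ hσ hα hα2
    rw [funext (fourier_charFn hσ hα hα2)]
    exact (((integrable_density hσ hα hα2).comp_mul_left' (by positivity)).const_mul _).ofReal
  have hc : charFn θ = charFn θ' := by
    rw [← (continuous_charFn hα).fourierInv_fourier_eq (integrable_charFn hσ hα hα2) (hi θ hσ hα hα2),
      ← (continuous_charFn hα').fourierInv_fourier_eq (integrable_charFn hσ' hα' hα2')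
        (hi θ' hσ' hα' hα2'), hF]
  have hn : ∀ t, |θ 1 * t| ^ θ 2 = |θ' 1 * t| ^ θ' 2 := by
    intro t
    have := congrArg (fun f => ‖f t‖) hc
    simp only [norm_charFn, Real.exp_eq_exp] at this
    linarith
  have hpow : ∀ t : ℝ, 0 < t → θ 2 * (Real.log (θ 1) + Real.log t) = θ' 2 * (Real.log (θ' 1) + Real.log t) := by
    intro t ht
    have := hn t
    rw [abs_of_pos (by positivity), abs_of_pos (by positivity)] at this
    have h2 := congrArg Real.log this
    rwa [Real.log_rpow (by positivity), Real.log_rpow (by positivity), Real.log_mul hσ.ne' ht.ne',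
      Real.log_mul hσ'.ne' ht.ne'] at h2
  -- The values at t = 1 and t = e separate the unknowns: their difference gives the exponents, and
  -- then t = 1 gives the scales.
  have h1 := hpow 1 one_pos
  have h2 := hpow (Real.exp 1) (Real.exp_pos 1)
  simp only [Real.log_one, add_zero, Real.log_exp] at h1 h2
  have e2 : θ 2 = θ' 2 := by linarith
  have e1 : θ 1 = θ' 1 := by
    rw [e2] at h1
    exact Real.log_injOn_pos hσ hσ' (mul_left_cancel₀ hα'.ne' h1)
  have e0 : θ 0 = θ' 0 := by
    by_contra hne
    have hd : θ 0 - θ' 0 ≠ 0 := sub_ne_zero.2 hne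
    -- At this t the moduli agree and cancel, while the two phases differ by exp(iπ) = -1.
    set t := Real.pi / (θ 0 - θ' 0) with ht
    have := congrFun hc t
    unfold charFn at this
    rw [hn t, sub_eq_add_neg, sub_eq_add_neg, Complex.exp_add, Complex.exp_add] at this
    have h3 := mul_right_cancel₀ (Complex.exp_ne_zero _) this
    have h4 : Complex.exp (Complex.I * (θ 0 : ℂ) * (t : ℂ)) =
        Complex.exp (Complex.I * (θ' 0 : ℂ) * (t : ℂ)) * Complex.exp (Real.pi * Complex.I) := by
      rw [← Complex.exp_add]
      congr 1
      have : (θ 0 - θ' 0) * t = Real.pi := by rw [ht]; field_simp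
      rw [← this]; push_cast; ring
    rw [h4, Complex.exp_pi_mul_I, mul_neg_one] at h3
    have h6 : (2 : ℂ) * Complex.exp (Complex.I * (θ' 0 : ℂ) * (t : ℂ)) = 0 := by linear_combination -h3
    simp at h6
  ext i
  fin_cases i
  exacts [e0, e1, e2]

/-! ### Cauchy densities and nonnegativity of the stable densities -/

lemma kernInt_cauchy (y : ℝ) {σ : ℝ} (hσ : 0 < σ) :
    kernInt 0 0 0 0 y σ 1 = 1 / (σ + Complex.I * y) := by
  have h := integral_cpow_mul_exp_neg_mul_complex (a := 1) (r := σ + Complex.I * y) (by simp)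
    (by simpa using hσ)
  rw [Complex.cpow_one, Complex.Gamma_one, mul_one] at h
  rw [← h, kernInt_zero_angle]
  refine setIntegral_congr_fun measurableSet_Ioi fun t ht => ?_
  rw [kern_zero_angle hσ ht]
  simp only [pow_zero, Nat.cast_zero, zero_mul, Real.rpow_zero, one_mul, Real.rpow_one, sub_self,
    Complex.cpow_zero]
  push_cast
  rw [← Complex.exp_add]
  congr 1
  ring

lemma density_cauchy_scale (μ x : ℝ) {σ : ℝ} (hσ : 0 < σ) :
    density ![μ, σ, 1] x = 1 / Real.pi * (σ / (σ ^ 2 + (x - μ) ^ 2)) := by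
  rw [density_eq (by simpa using hσ) (by simp) (by simp)]
  simp only [Matrix.cons_val_zero, Matrix.cons_val_one, Matrix.cons_val]
  rw [kernInt_cauchy _ hσ, one_div (_ + _), Complex.inv_re]
  congr 2
  · simp
  · rw [Complex.normSq_apply]; simp; ring

/-- By Fubini the integral is, up to the factor 2π, the convolution of ν with the Cauchy density of
scale δ. -/
lemma integral_exp_mul_charFun_nonneg (ν : Measure ℝ) [IsProbabilityMeasure ν] (x : ℝ) {δ : ℝ}
    (hδ : 0 < δ) :
    0 ≤ (∫ t : ℝ, Complex.exp (-(Complex.I * (t : ℂ) * (x : ℂ))) * charFun ν t *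
      charFn ![0, δ, 1] t).re := by
  have hc : Integrable (charFn ![0, δ, 1]) := integrable_charFn (by simpa using hδ) (by simp) (by simp)
  have hF : Integrable (Function.uncurry fun t y : ℝ =>
      Complex.exp (-(Complex.I * (t : ℂ) * ((x - y : ℝ) : ℂ))) * charFn ![0, δ, 1] t)
      (volume.prod ν) := by
    refine (hc.comp_fst ν).norm.mono' ?_ (ae_of_all _ fun p => ?_)
    · have h1 : Measurable fun p : ℝ × ℝ => charFn ![0, δ, 1] p.1 :=
        (measurable_charFn _).comp measurable_fst
      unfold Function.uncurry
      exact ((by fun_prop : Measurable fun p : ℝ × ℝ =>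
        Complex.exp (-(Complex.I * (p.1 : ℂ) * ((x - p.2 : ℝ) : ℂ)))).mul h1).aestronglyMeasurable
    · simp only [Function.uncurry, norm_mul]
      rw [Complex.norm_exp]
      simp
  have h1 : ∀ t : ℝ, Complex.exp (-(Complex.I * (t : ℂ) * (x : ℂ))) * charFun ν t *
      charFn ![0, δ, 1] t = ∫ y, Complex.exp (-(Complex.I * (t : ℂ) * ((x - y : ℝ) : ℂ))) *
        charFn ![0, δ, 1] t ∂ν := by
    intro t
    rw [integral_mul_const, charFun_apply_real, ← integral_const_mul]
    congr 2
    ext y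
    rw [← Complex.exp_add]
    congr 1
    push_cast
    ring
  simp only [h1]
  rw [integral_integral_swap hF]
  have h2 : ∀ y : ℝ, ∫ t : ℝ, Complex.exp (-(Complex.I * (t : ℂ) * ((x - y : ℝ) : ℂ))) *
      charFn ![0, δ, 1] t = ((2 * (δ / (δ ^ 2 + (x - y) ^ 2)) : ℝ) : ℂ) := by
    intro y
    rw [(integral_exp_mul_charFn (θ := ![0, δ, 1]) (by simpa using hδ) (by simp) (by simp) (x - y)).2]
    have h3 := density_cauchy_scale 0 (x - y) hδ
    rw [density_eq (by simpa using hδ) (by simp) (by simp)] at h3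
    have h4 := mul_left_cancel₀ (by positivity) h3
    rw [h4, sub_zero]
  simp only [h2]
  rw [integral_complex_ofReal, Complex.ofReal_re]
  exact integral_nonneg fun y => by positivity

/-- The characteristic functions of ν n need not be integrable, so they are multiplied by that of a
Cauchy law of scale δ, which dominates the limit n → ∞. Then δ → 0 is dominated by the integrable φ.
-/
lemma integral_exp_mul_nonneg_of_tendsto_charFun {ν : ℕ → Measure ℝ}
    (hν : ∀ n, IsProbabilityMeasure (ν n)) {φ : ℝ → ℂ} (hφ : Integrable φ)
    (hlim : ∀ t, Tendsto (fun n => charFun (ν n) t) atTop (𝓝 (φ t))) (x : ℝ) :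
    0 ≤ (∫ t : ℝ, Complex.exp (-(Complex.I * (t : ℂ) * (x : ℂ))) * φ t).re := by
  have hE : ∀ t : ℝ, ‖Complex.exp (-(Complex.I * (t : ℂ) * (x : ℂ)))‖ = 1 := fun t => by
    rw [Complex.norm_exp]; simp
  have hEm : Measurable fun t : ℝ => Complex.exp (-(Complex.I * (t : ℂ) * (x : ℂ))) := by fun_prop
  have hδ : ∀ δ : ℝ, 0 < δ → 0 ≤ (∫ t : ℝ, Complex.exp (-(Complex.I * (t : ℂ) * (x : ℂ))) * φ t *
      charFn ![0, δ, 1] t).re := by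
    intro δ hδ
    have hc : Integrable (charFn ![0, δ, 1]) := integrable_charFn (by simpa using hδ) (by simp) (by simp)
    have key := tendsto_integral_of_dominated_convergence (μ := (volume : Measure ℝ))
      (F := fun (n : ℕ) t => Complex.exp (-(Complex.I * (t : ℂ) * (x : ℂ))) * charFun (ν n) t *
        charFn ![0, δ, 1] t)
      (f := fun t => Complex.exp (-(Complex.I * (t : ℂ) * (x : ℂ))) * φ t * charFn ![0, δ, 1] t)
      (fun t => ‖charFn ![0, δ, 1] t‖)
      (fun n => ((hEm.mul measurable_charFun).mul (measurable_charFn _)).aestronglyMeasurable)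
      hc.norm
      (fun n => ae_of_all _ fun t => by
        rw [norm_mul, norm_mul, hE, one_mul]
        exact mul_le_of_le_one_left (norm_nonneg _) (norm_charFun_le_one t))
      (ae_of_all _ fun t => ((hlim t).const_mul _).mul_const _)
    refine ge_of_tendsto' ((Complex.continuous_re.tendsto _).comp key) fun n => ?_
    exact integral_exp_mul_charFun_nonneg (ν n) x hδ
  have hseq : Tendsto (fun n : ℕ => 1 / ((n : ℝ) + 1)) atTop (𝓝 0) := tendsto_one_div_add_atTop_nhds_zero_nat
  have key := tendsto_integral_of_dominated_convergence (μ := (volume : Measure ℝ))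
    (F := fun (n : ℕ) t => Complex.exp (-(Complex.I * (t : ℂ) * (x : ℂ))) * φ t *
      charFn ![0, 1 / ((n : ℝ) + 1), 1] t)
    (f := fun t => Complex.exp (-(Complex.I * (t : ℂ) * (x : ℂ))) * φ t)
    (fun t => ‖φ t‖)
    (fun n => (hEm.aestronglyMeasurable.mul hφ.1).mul (measurable_charFn _).aestronglyMeasurable)
    hφ.norm
    (fun n => ae_of_all _ fun t => by
      rw [norm_mul, norm_mul, hE, one_mul, norm_charFn]
      refine mul_le_of_le_one_right (norm_nonneg _) ?_
      rw [Real.exp_le_one_iff, neg_nonpos]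
      positivity)
    (ae_of_all _ fun t => by
      have h1 : Tendsto (fun n : ℕ => charFn ![0, 1 / ((n : ℝ) + 1), 1] t) atTop (𝓝 1) := by
        have : Tendsto (fun n : ℕ => Complex.exp (-((|1 / ((n : ℝ) + 1) * t| : ℝ) : ℂ))) atTop (𝓝 1) := by
          have h2 := (hseq.mul_const t).abs
          rw [zero_mul, abs_zero] at h2
          have h3 := (Complex.continuous_exp.comp (Complex.continuous_ofReal.neg)).tendsto (0 : ℝ)
          have h4 := h3.comp h2
          simpa [Function.comp_def] using h4
        refine this.congr fun n => ?_
        simp [charFn]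
      simpa using h1.const_mul (Complex.exp (-(Complex.I * (t : ℂ) * (x : ℂ))) * φ t))
  refine ge_of_tendsto' ((Complex.continuous_re.tendsto _).comp key) fun n => ?_
  exact hδ _ (by positivity)

lemma exists_charFun_pow (ν : Measure ℝ) [IsProbabilityMeasure ν] (n : ℕ) :
    ∃ ρ : Measure ℝ, IsProbabilityMeasure ρ ∧ ∀ t, charFun ρ t = charFun ν t ^ n := by
  induction n with
  | zero => exact ⟨Measure.dirac 0, inferInstance, fun t => by simp [charFun_dirac]⟩
  | succ n ih =>
    obtain ⟨ρ, hρ, h⟩ := ih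
    exact ⟨ρ ∗ ν, inferInstance, fun t => by rw [charFun_conv, h, pow_succ]⟩

/-- The two-sided Pareto density. -/
def paretoDensity (α x : ℝ) : ℝ := if 1 < |x| then α / 2 * |x| ^ (-1 - α) else 0

lemma paretoDensity_nonneg {α : ℝ} (hα : 0 < α) (x : ℝ) : 0 ≤ paretoDensity α x := by
  unfold paretoDensity; split_ifs <;> positivity

lemma measurable_paretoDensity (α : ℝ) : Measurable (paretoDensity α) := by
  unfold paretoDensity
  exact Measurable.ite (measurableSet_lt measurable_const (by fun_prop)) (by fun_prop) measurable_const

lemma paretoDensity_eq_indicator {α x : ℝ} (hx : 0 < x) :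
    paretoDensity α x = (Set.Ioi 1).indicator (fun x : ℝ => α / 2 * x ^ (-1 - α)) x := by
  unfold paretoDensity
  rw [abs_of_pos hx, Set.indicator_apply]
  rfl

lemma integrable_paretoDensity {α : ℝ} (hα : 0 < α) :
    Integrable (paretoDensity α) ∧ ∫ x, paretoDensity α x = 1 := by
  have hI := (integrableOn_Ioi_rpow_of_lt (show -1 - α < -1 by linarith) zero_lt_one).const_mul (α / 2)
  have h0 : IntegrableOn (paretoDensity α) (Set.Ioi 0) := by
    have h1 : IntegrableOn ((Set.Ioi 1).indicator (fun x : ℝ => α / 2 * x ^ (-1 - α))) (Set.Ioi 0) :=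
      ((integrable_indicator_iff measurableSet_Ioi).2 hI).integrableOn
    exact h1.congr_fun (fun x hx => (paretoDensity_eq_indicator hx).symm) measurableSet_Ioi
  have h2 := integral_of_conj_symm (g := fun x => ((paretoDensity α x : ℝ) : ℂ)) h0.ofReal
    (fun t => by simp [paretoDensity])
  have h3 : ∫ x in Set.Ioi (0 : ℝ), paretoDensity α x = 1 / 2 := by
    rw [setIntegral_congr_fun measurableSet_Ioi fun x hx => paretoDensity_eq_indicator hx,
      setIntegral_indicator measurableSet_Ioi, Set.Ioi_inter_Ioi, integral_const_mul]
    simp only [zero_le_one, sup_of_le_right]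
    rw [integral_Ioi_rpow_of_lt (by linarith) zero_lt_one, Real.one_rpow]
    have : -1 - α + 1 ≠ 0 := by intro h; linarith
    field_simp
    ring
  refine ⟨by simpa using h2.1.re, ?_⟩
  have h4 := h2.2
  rw [integral_complex_ofReal, integral_complex_ofReal, Complex.ofReal_re, h3] at h4
  norm_num at h4
  exact_mod_cast h4

/-- The symmetric Pareto distribution with tail exponent `α`. -/
def paretoLaw (α : ℝ) : Measure ℝ := volume.withDensity fun x => ENNReal.ofReal (paretoDensity α x)

lemma isProbabilityMeasure_paretoLaw {α : ℝ} (hα : 0 < α) : IsProbabilityMeasure (paretoLaw α) := by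
  refine ⟨?_⟩
  rw [paretoLaw, withDensity_apply _ MeasurableSet.univ, setLIntegral_univ,
    ← ofReal_integral_eq_lintegral_ofReal (integrable_paretoDensity hα).1
    (ae_of_all _ (paretoDensity_nonneg hα)), (integrable_paretoDensity hα).2, ENNReal.ofReal_one]

/-- The integral of `(1 - cos u) u ^ (-1 - α)` over `(T, ∞)`. -/
def cosTail (α T : ℝ) : ℝ := ∫ u in Set.Ioi T, (1 - Real.cos u) * u ^ (-1 - α)

lemma integrableOn_cosTail {α : ℝ} (hα : 0 < α) (hα2 : α < 2) :
    IntegrableOn (fun u : ℝ => (1 - Real.cos u) * u ^ (-1 - α)) (Set.Ioi 0) := by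
  have hm : Measurable fun u : ℝ => (1 - Real.cos u) * u ^ (-1 - α) := by fun_prop
  have h1 : IntegrableOn (fun u : ℝ => (1 - Real.cos u) * u ^ (-1 - α)) (Set.Ioc 0 1) := by
    have h0 : IntegrableOn (fun s : ℝ => s ^ (1 - α)) (Set.Ioc 0 1) :=
      (intervalIntegrable_iff_integrableOn_Ioc_of_le zero_le_one).1
        (intervalIntegral.intervalIntegrable_rpow' (by linarith))
    refine h0.mono' hm.aestronglyMeasurable ?_
    refine (ae_restrict_iff' measurableSet_Ioc).2 (ae_of_all _ fun u hu => ?_)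
    have hu0 : 0 < u := hu.1
    have := Real.one_sub_sq_div_two_le_cos (x := u)
    have h3 := Real.cos_le_one u
    rw [Real.norm_of_nonneg (mul_nonneg (by linarith) (by positivity))]
    have e : u ^ (1 - α) = u ^ 2 * u ^ (-1 - α) := by
      rw [← Real.rpow_two, ← Real.rpow_add hu0]; ring_nf
    rw [e]
    gcongr
    nlinarith
  have h2 : IntegrableOn (fun u : ℝ => (1 - Real.cos u) * u ^ (-1 - α)) (Set.Ioi 1) := by
    have hI := (integrableOn_Ioi_rpow_of_lt (show -1 - α < -1 by linarith) zero_lt_one).const_mul 2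
    refine hI.mono' hm.aestronglyMeasurable ?_
    refine (ae_restrict_iff' measurableSet_Ioi).2 (ae_of_all _ fun u hu => ?_)
    have hu0 : (0 : ℝ) < u := lt_trans one_pos hu
    have h3 := Real.cos_le_one u
    have h4 := Real.neg_one_le_cos u
    rw [Real.norm_of_nonneg (mul_nonneg (by linarith) (by positivity))]
    gcongr
    linarith
  have := h1.union h2
  rwa [Set.Ioc_union_Ioi_eq_Ioi zero_le_one] at this

lemma cosTail_pos {α : ℝ} (hα : 0 < α) (hα2 : α < 2) : 0 < cosTail α 0 := by
  unfold cosTail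
  have hnn : ∀ u ∈ Set.Ioi (0 : ℝ), 0 ≤ (1 - Real.cos u) * u ^ (-1 - α) := fun u hu =>
    mul_nonneg (by linarith [Real.cos_le_one u]) (Real.rpow_nonneg (le_of_lt hu) _)
  rw [setIntegral_pos_iff_support_of_nonneg_ae
    ((ae_restrict_iff' measurableSet_Ioi).2 (ae_of_all _ hnn)) (integrableOn_cosTail hα hα2)]
  have hsub : Set.Ioo (1 : ℝ) 2 ⊆ Function.support (fun u : ℝ => (1 - Real.cos u) * u ^ (-1 - α)) ∩ Set.Ioi 0 := by
    intro u hu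
    have hu0 : 0 < u := by linarith [hu.1]
    refine ⟨?_, hu0⟩
    have : Real.cos u < Real.cos 0 :=
      Real.cos_lt_cos_of_nonneg_of_le_pi le_rfl (by linarith [hu.2, Real.pi_gt_three]) hu0
    rw [Real.cos_zero] at this
    exact (mul_pos (by linarith) (Real.rpow_pos_of_pos hu0 _)).ne'
  refine lt_of_lt_of_le ?_ (measure_mono hsub)
  rw [Real.volume_Ioo]; norm_num

lemma tendsto_cosTail {α : ℝ} (hα : 0 < α) (hα2 : α < 2) {T : ℕ → ℝ} (hT : ∀ n, 0 ≤ T n)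
    (hT0 : Tendsto T atTop (𝓝 0)) : Tendsto (fun n => cosTail α (T n)) atTop (𝓝 (cosTail α 0)) := by
  have hI := integrableOn_cosTail hα hα2
  set g := fun u : ℝ => (1 - Real.cos u) * u ^ (-1 - α) with hg
  have key := tendsto_integral_of_dominated_convergence (μ := volume.restrict (Set.Ioi (0 : ℝ)))
    (F := fun n => (Set.Ioi (T n)).indicator g) (f := g) (fun u => ‖g u‖)
    (fun n => hI.1.indicator measurableSet_Ioi) hI.norm
    (fun n => ae_of_all _ fun u => norm_indicator_le_norm_self g u)
    ((ae_restrict_iff' measurableSet_Ioi).2 (ae_of_all _ fun u hu => by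
      refine tendsto_const_nhds.congr' ?_
      filter_upwards [hT0.eventually_lt_const hu] with n hn
      exact (Set.indicator_of_mem (show u ∈ Set.Ioi (T n) from hn) g).symm))
  refine key.congr fun n => ?_
  rw [setIntegral_indicator measurableSet_Ioi, Set.Ioi_inter_Ioi, sup_of_le_right (hT n)]
  rfl

/-- Subtracting the total mass turns the cosine integral into one of 1 - cos, and the substitution u
= tx extracts |t|^α. As the formula is exact, the behaviour at t = 0 reduces to `tendsto_cosTail`.
-/
lemma charFun_paretoLaw {α : ℝ} (hα : 0 < α) (t : ℝ) :
    charFun (paretoLaw α) t = ((1 - α * |t| ^ α * cosTail α |t| : ℝ) : ℂ) := by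
  have hpos : ∀ t : ℝ, 0 < t → charFun (paretoLaw α) t = ((1 - α * t ^ α * cosTail α t : ℝ) : ℂ) := by
    intro t ht
    obtain ⟨hp, hp1⟩ := integrable_paretoDensity hα
    rw [charFun_apply_real, paretoLaw, integral_withDensity_eq_integral_toReal_smul
      (measurable_paretoDensity α).ennreal_ofReal (ae_of_all _ fun _ => ENNReal.ofReal_lt_top)]
    simp only [ENNReal.toReal_ofReal (paretoDensity_nonneg hα _)]
    have hg : Integrable fun x : ℝ => paretoDensity α x • Complex.exp (t * x * Complex.I) := by
      refine hp.norm.mono' ((measurable_paretoDensity α).smul (by fun_prop)).aestronglyMeasurable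
        (ae_of_all _ fun x => ?_)
      rw [norm_smul, Complex.norm_exp]
      simp
    have h2 := (integral_of_conj_symm (g := fun x : ℝ => paretoDensity α x • Complex.exp (t * x * Complex.I))
      hg.integrableOn (fun x => by
        simp only [Complex.real_smul, map_mul, Complex.conj_ofReal, ← Complex.exp_conj, Complex.conj_I]
        simp [paretoDensity])).2
    rw [h2]
    congr 1
    have h3 : (∫ x in Set.Ioi (0 : ℝ), paretoDensity α x • Complex.exp (t * x * Complex.I)).re =
        ∫ x in Set.Ioi (0 : ℝ), paretoDensity α x * Real.cos (t * x) := by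
      have := integral_re (𝕜 := ℂ) hg.integrableOn (μ := volume.restrict (Set.Ioi (0 : ℝ)))
      rw [← RCLike.re_eq_complex_re, ← this]
      refine setIntegral_congr_fun measurableSet_Ioi fun x _ => ?_
      simp only [RCLike.re_eq_complex_re, Complex.real_smul, Complex.re_ofReal_mul]
      rw [← Complex.ofReal_mul, Complex.exp_ofReal_mul_I_re]
    have h4 : ∫ x in Set.Ioi (0 : ℝ), paretoDensity α x * Real.cos (t * x) =
        α / 2 * ∫ x in Set.Ioi (1 : ℝ), x ^ (-1 - α) * Real.cos (t * x) := by
      have e : ∀ x ∈ Set.Ioi (0 : ℝ), paretoDensity α x * Real.cos (t * x) =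
          (Set.Ioi 1).indicator (fun x : ℝ => α / 2 * (x ^ (-1 - α) * Real.cos (t * x))) x := by
        intro x hx
        rw [paretoDensity_eq_indicator hx, Set.indicator_apply, Set.indicator_apply]
        split_ifs <;> ring
      rw [setIntegral_congr_fun measurableSet_Ioi e, setIntegral_indicator measurableSet_Ioi,
        Set.Ioi_inter_Ioi, integral_const_mul]
      simp
    have hI := integrableOn_Ioi_rpow_of_lt (show -1 - α < -1 by linarith) zero_lt_one
    have hIc : IntegrableOn (fun x : ℝ => x ^ (-1 - α) * Real.cos (t * x)) (Set.Ioi 1) := by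
      refine hI.norm.mono' (by fun_prop : Measurable _).aestronglyMeasurable (ae_of_all _ fun x => ?_)
      rw [norm_mul]
      exact mul_le_of_le_one_right (norm_nonneg _) (Real.abs_cos_le_one _)
    have h5 : ∫ x in Set.Ioi (1 : ℝ), x ^ (-1 - α) * Real.cos (t * x) = 1 / α - t ^ α * cosTail α t := by
      have e1 : ∫ x in Set.Ioi (1 : ℝ), x ^ (-1 - α) = 1 / α := by
        rw [integral_Ioi_rpow_of_lt (by linarith) zero_lt_one, Real.one_rpow]
        have : -1 - α + 1 ≠ 0 := by intro h; linarith
        field_simp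
        ring
      have e2 : t ^ α * cosTail α t = ∫ x in Set.Ioi (1 : ℝ), (x ^ (-1 - α) - x ^ (-1 - α) * Real.cos (t * x)) := by
        have := integral_comp_mul_left_Ioi (fun u => (1 - Real.cos u) * u ^ (-1 - α)) 1 ht
        rw [mul_one, smul_eq_mul] at this
        unfold cosTail
        have e3 : t ^ α * ∫ u in Set.Ioi t, (1 - Real.cos u) * u ^ (-1 - α) =
            t ^ (α + 1) * (t⁻¹ * ∫ u in Set.Ioi t, (1 - Real.cos u) * u ^ (-1 - α)) := by
          rw [Real.rpow_add_one ht.ne']; field_simp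
        rw [e3, ← this, ← integral_const_mul]
        refine setIntegral_congr_fun measurableSet_Ioi fun x hx => ?_
        have hx0 : (0 : ℝ) < x := lt_trans one_pos hx
        rw [Real.mul_rpow ht.le hx0.le, show -1 - α = -(α + 1) by ring, Real.rpow_neg ht.le]
        have : t ^ (α + 1) ≠ 0 := (Real.rpow_pos_of_pos ht _).ne'
        field_simp
      rw [e2, integral_sub hI hIc, e1]
      ring
    rw [h3, h4, h5]
    field_simp
  rcases lt_trichotomy t 0 with ht | ht | ht
  · have h := hpos (-t) (by linarith)
    rw [abs_of_neg ht, ← h, ← neg_neg t, charFun_neg, neg_neg, h, Complex.conj_ofReal]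
  · have := isProbabilityMeasure_paretoLaw hα
    rw [ht, abs_zero, Real.zero_rpow hα.ne']
    simp
  · rw [abs_of_pos ht, hpos t ht]

/-- Symmetric stable densities with exponent `α < 2` are nonnegative, since the stable law is a limit
of normalized sums of Pareto variables. -/
lemma density_nonneg_of_lt_two {σ α : ℝ} (hσ : 0 < σ) (hα : 0 < α) (hα2 : α < 2) (x : ℝ) :
    0 ≤ density ![0, σ, α] x := by
  have hprob := isProbabilityMeasure_paretoLaw hα
  set c := cosTail α 0 with hc
  have hc0 : 0 < c := cosTail_pos hα hα2
  -- Chosen so that α κ^α c = σ^α. With r n = κ n^(-1/α), the n-fold convolution of the rescaled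
  -- Pareto law then has characteristic function tending to exp(-|σt|^α), by (1 + g n)^n → exp(lim n
  -- g n).
  set κ := (σ ^ α / (α * c)) ^ (1 / α) with hκ
  have hκ0 : 0 ≤ κ := by positivity
  have hκα : κ ^ α = σ ^ α / (α * c) := by
    rw [hκ, ← Real.rpow_mul (by positivity), one_div_mul_cancel hα.ne', Real.rpow_one]
  set r : ℕ → ℝ := fun n => κ * (n : ℝ) ^ (-(1 / α)) with hr
  have hν : ∀ n, IsProbabilityMeasure ((paretoLaw α).map (fun y => r n * y)) := fun n =>
    Measure.isProbabilityMeasure_map (by fun_prop)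
  choose ρ hρ hρc using fun n : ℕ => @exists_charFun_pow ((paretoLaw α).map (fun y => r n * y)) (hν n) n
  have hr0 : Tendsto r atTop (𝓝 0) := by
    have := ((tendsto_rpow_neg_atTop (show 0 < 1 / α by positivity)).comp
      tendsto_natCast_atTop_atTop).const_mul κ
    simpa [hr, Function.comp_def] using this
  have hrn : ∀ n, 0 ≤ r n := fun n => by simp only [hr]; positivity
  have hlim : ∀ t, Tendsto (fun n => charFun (ρ n) t) atTop (𝓝 (charFn ![0, σ, α] t)) := by
    intro t
    set g : ℕ → ℝ := fun n => -(α * |r n * t| ^ α * cosTail α |r n * t|) with hg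
    have hng : Tendsto (fun n : ℕ => n * g n) atTop (𝓝 (-|σ * t| ^ α)) := by
      have hT : Tendsto (fun n => cosTail α |r n * t|) atTop (𝓝 c) := by
        refine tendsto_cosTail hα hα2 (fun n => abs_nonneg _) ?_
        simpa using (hr0.mul_const t).abs
      have h1 : -|σ * t| ^ α = -(α * (κ ^ α * |t| ^ α) * c) := by
        rw [hκα, abs_mul, abs_of_pos hσ, Real.mul_rpow hσ.le (abs_nonneg t)]
        field_simp
      rw [h1]
      refine ((hT.const_mul (α * (κ ^ α * |t| ^ α))).neg).congr' ?_
      filter_upwards [eventually_gt_atTop 0] with n hn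
      have hn' : (0 : ℝ) < n := by exact_mod_cast hn
      have h2 : |r n * t| ^ α = κ ^ α * (n : ℝ)⁻¹ * |t| ^ α := by
        rw [abs_mul, abs_of_nonneg (hrn n), Real.mul_rpow (hrn n) (abs_nonneg t)]
        simp only [hr]
        rw [Real.mul_rpow hκ0 (by positivity), ← Real.rpow_mul hn'.le, neg_mul,
          one_div_mul_cancel hα.ne', Real.rpow_neg_one]
      simp only [hg, h2]
      field_simp
    have h3 := Real.tendsto_one_add_pow_exp_of_tendsto hng
    have h4 := (Complex.continuous_ofReal.tendsto _).comp h3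
    have h5 : charFn ![0, σ, α] t = ((Real.exp (-|σ * t| ^ α) : ℝ) : ℂ) := by
      simp [charFn]
    rw [h5]
    refine h4.congr fun n => ?_
    rw [hρc n t, charFun_map_mul, charFun_paretoLaw hα]
    simp only [Function.comp, hg]
    push_cast
    ring
  have := integral_exp_mul_nonneg_of_tendsto_charFun hρ
    (integrable_charFn (θ := ![0, σ, α]) (by simpa using hσ) (by simpa using hα) (by simpa using hα2.le)) hlim x
  unfold density
  positivity

/-- The Pareto argument needs α < 2. The endpoint α = 2 is reached along 2 - 1/(n+1) by continuity
in the parameter. -/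
lemma density_nonneg {θ : Param} (hσ : 0 < θ 1) (hα : 0 < θ 2) (hα2 : θ 2 ≤ 2) (x : ℝ) :
    0 ≤ density θ x := by
  have hshift : density θ x = density ![0, θ 1, θ 2] (x - θ 0) := by
    rw [density_eq hσ hα hα2, density_eq (by simpa using hσ) (by simpa using hα) (by simpa using hα2)]
    simp
  rw [hshift]
  rcases hα2.lt_or_eq with h | h
  · exact density_nonneg_of_lt_two hσ hα h _
  · rw [h]
    refine le_of_forall_pos_le_add fun r hr => ?_
    have hev := eventually_abs_density_sub_le (θ₁ := ![0, θ 1, 2]) (by simpa using hσ) (by simp) hr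
    have hseq : Tendsto (fun n : ℕ => (![0, θ 1, 2 - 1 / ((n : ℝ) + 1)] : Param)) atTop
        (𝓝 ![0, θ 1, 2]) := by
      rw [tendsto_pi_nhds]
      intro i
      fin_cases i
      · exact tendsto_const_nhds
      · exact tendsto_const_nhds
      · have := (tendsto_one_div_add_atTop_nhds_zero_nat (𝕜 := ℝ)).const_sub 2
        simpa using this
    obtain ⟨n, hn⟩ := (hseq.eventually hev).exists
    have h1 := (abs_le.1 (hn (x - θ 0))).2
    have h2 : (1 : ℝ) / ((n : ℝ) + 1) ≤ 1 := by
      rw [div_le_one (by positivity)]; linarith [Nat.cast_nonneg (α := ℝ) n]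
    have h3 : (0 : ℝ) < 1 / ((n : ℝ) + 1) := by positivity
    have := density_nonneg_of_lt_two (σ := θ 1) (α := 2 - 1 / ((n : ℝ) + 1)) hσ (by linarith)
      (by linarith) (x - θ 0)
    linarith

/-! ### Closed forms of the Cauchy scores -/

lemma density_cauchyParam (x : ℝ) : density cauchyParam x = 1 / Real.pi * (1 / (1 + x ^ 2)) := by
  have := density_cauchy_scale 0 x one_pos
  rw [sub_zero, one_pow] at this
  exact this

lemma density_cauchyParam_pos (x : ℝ) : 0 < density cauchyParam x := by
  rw [density_cauchyParam]; positivity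

lemma one_add_I_mul_ne_zero (x : ℝ) : (1 + Complex.I * x : ℂ) ≠ 0 := by
  intro h
  have := congrArg Complex.re h
  simp at this

lemma Gamma_two_eq_one : Complex.Gamma 2 = 1 := by
  have := Complex.Gamma_nat_eq_factorial 1
  rwa [show ((1 : ℕ) : ℂ) + 1 = 2 by norm_num, Nat.factorial_one, Nat.cast_one] at this

lemma integral_mul_exp_neg (x : ℝ) :
    ∫ t in Set.Ioi (0 : ℝ), (t : ℂ) * Complex.exp (-((1 + Complex.I * x) * t)) =
      (1 / (1 + Complex.I * x)) ^ 2 := by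
  have h := integral_cpow_mul_exp_neg_mul_complex (a := 2) (r := 1 + Complex.I * x) (by simp)
    (by simp)
  rw [show (2 : ℂ) - 1 = 1 by norm_num] at h
  simp only [Complex.cpow_one] at h
  rw [h, Gamma_two_eq_one, mul_one]
  exact_mod_cast Complex.cpow_natCast _ 2

/-- The Mellin transform of exp(-rt) is r^(-s) Γ(s). Its derivative at s = 2 inserts log t under the
integral, and Γ(2) = 1, Γ'(2) = 1 - γ. Decay faster than t^(-3) and boundedness at 0 put s = 2
inside the strip of differentiability. -/
lemma integral_mul_log_mul_exp_neg (x : ℝ) :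
    ∫ t in Set.Ioi (0 : ℝ), (t : ℂ) * Real.log t * Complex.exp (-((1 + Complex.I * x) * t)) =
      (1 / (1 + Complex.I * x)) ^ 2 *
        (1 - Real.eulerMascheroniConstant - Complex.log (1 + Complex.I * x)) := by
  set r : ℂ := 1 + Complex.I * x with hr
  have hr0 : r ≠ 0 := one_add_I_mul_ne_zero x
  have hre : r.re = 1 := by simp [hr]
  set f : ℝ → ℂ := fun t => Complex.exp (-(r * t)) with hf
  have hnorm : ∀ t, ‖f t‖ = Real.exp (-t) := fun t => by
    rw [hf, Complex.norm_exp]; simp [hre]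
  have hcont : Continuous f := by rw [hf]; fun_prop
  have htop : f =O[atTop] (· ^ (-(3 : ℝ))) := by
    have h1 := (isLittleO_exp_neg_mul_rpow_atTop (a := 1) one_pos (-3)).isBigO
    refine Asymptotics.IsBigO.trans ?_ h1
    refine Asymptotics.IsBigO.of_bound 1 (Eventually.of_forall fun t => ?_)
    rw [hnorm, one_mul, neg_one_mul, Real.norm_of_nonneg (Real.exp_pos _).le]
  have hbot : f =O[𝓝[>] 0] (· ^ (-(0 : ℝ))) := by
    refine Asymptotics.IsBigO.of_bound 1 ?_
    filter_upwards [self_mem_nhdsWithin] with t ht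
    rw [hnorm, neg_zero, Real.rpow_zero, norm_one, mul_one, Real.exp_le_one_iff]
    exact neg_nonpos.2 (le_of_lt ht)
  have h1 := (mellin_hasDerivAt_of_isBigO_rpow (s := 2) (hcont.locallyIntegrable.locallyIntegrableOn _)
    htop (by norm_num) hbot (by norm_num)).2
  have hr' : (1 / r) ≠ 0 := one_div_ne_zero hr0
  have hG : HasDerivAt Complex.Gamma (1 - Real.eulerMascheroniConstant : ℂ) 2 := by
    have := Complex.hasDerivAt_Gamma_nat 1
    norm_num at this
    refine this.congr_deriv ?_
    ring
  have h2 : HasDerivAt (fun s : ℂ => (1 / r) ^ s * Complex.Gamma s)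
      ((1 / r) ^ (2 : ℂ) * Complex.log (1 / r) * 1 * Complex.Gamma 2 +
        (1 / r) ^ (2 : ℂ) * (1 - Real.eulerMascheroniConstant)) 2 :=
    ((hasDerivAt_id (2 : ℂ)).const_cpow (Or.inl hr')).mul hG
  have h3 : mellin f =ᶠ[𝓝 2] fun s : ℂ => (1 / r) ^ s * Complex.Gamma s := by
    have ho : IsOpen {s : ℂ | 0 < s.re} := isOpen_lt continuous_const Complex.continuous_re
    filter_upwards [ho.mem_nhds (show (2 : ℂ) ∈ {s : ℂ | 0 < s.re} by simp)] with s hs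
    exact integral_cpow_mul_exp_neg_mul_complex hs (by rw [hre]; exact one_pos)
  have h4 := h1.unique (h2.congr_of_eventuallyEq h3)
  have h5 : mellin (fun t => Real.log t • f t) 2 =
      ∫ t in Set.Ioi (0 : ℝ), (t : ℂ) * Real.log t * Complex.exp (-(r * t)) := by
    unfold mellin
    refine setIntegral_congr_fun measurableSet_Ioi fun t ht => ?_
    simp only [hf]
    rw [show (2 : ℂ) - 1 = 1 by norm_num, Complex.cpow_one, smul_eq_mul, Complex.real_smul]
    ring
  have harg : r.arg ≠ Real.pi := by
    intro h
    have := (Complex.arg_eq_pi_iff.1 h).1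
    rw [hre] at this
    linarith
  have h6 : (1 / r) ^ (2 : ℂ) = (1 / r) ^ 2 := by exact_mod_cast Complex.cpow_natCast (1 / r) 2
  rw [← h5, h4, h6, Gamma_two_eq_one, one_div, Complex.log_inv _ harg]
  ring

lemma log_one_add_I_mul (x : ℝ) :
    Complex.log (1 + Complex.I * x) = ((1 / 2 * Real.log (x ^ 2 + 1) : ℝ) : ℂ) + Real.arctan x * Complex.I := by
  have hn : ‖(1 + Complex.I * x : ℂ)‖ = Real.sqrt (1 + x ^ 2) := by
    rw [Complex.norm_eq_sqrt_sq_add_sq]; simp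
  apply Complex.ext
  · rw [Complex.log_re, hn, Real.log_sqrt (by positivity)]
    simp only [Complex.add_re, Complex.ofReal_re, Complex.mul_re, Complex.I_re, Complex.I_im,
      Complex.ofReal_im]
    ring_nf
  · rw [Complex.log_im, Complex.arg_of_re_nonneg (by simp), hn, Real.arctan_eq_arcsin]
    simp

lemma kern_cauchy {t : ℝ} (ht : 0 < t) (a b c : ℕ) (x : ℝ) :
    kern a b c 0 (x - cauchyParam 0) (cauchyParam 1) (cauchyParam 2) t =
      ((t ^ a * Real.log t ^ c * t ^ b : ℝ) : ℂ) * Complex.exp (-((1 + Complex.I * x) * t)) := by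
  have h0 : cauchyParam 0 = 0 := rfl
  have h1 : cauchyParam 1 = 1 := rfl
  have h2 : cauchyParam 2 = 1 := rfl
  rw [h0, h1, h2, kern_zero_angle one_pos ht]
  simp only [one_mul, mul_one, Real.rpow_natCast, Real.rpow_one, sub_zero]
  rw [Complex.ofReal_mul (_ * _ * _), mul_assoc, Complex.ofReal_exp, ← Complex.exp_add]
  congr 2
  push_cast
  ring

/-- Closed forms of the derivatives of the Cauchy characteristic function, transformed. -/
def cauchyGrad (x : ℝ) : Fin 3 → ℂ :=
  ![Complex.I * (1 / (1 + Complex.I * x)) ^ 2, -(1 / (1 + Complex.I * x)) ^ 2,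
    -((1 / (1 + Complex.I * x)) ^ 2 *
        (1 - Real.eulerMascheroniConstant - Complex.log (1 + Complex.I * x)))]

lemma kernIntGrad_cauchyParam (x : ℝ) (i : Fin 3) :
    kernIntGrad 0 0 0 x cauchyParam i = cauchyGrad x i := by
  have h100 : kernInt 1 0 0 0 (x - cauchyParam 0) (cauchyParam 1) (cauchyParam 2) =
      (1 / (1 + Complex.I * x)) ^ 2 := by
    rw [kernInt_zero_angle, ← integral_mul_exp_neg]
    refine setIntegral_congr_fun measurableSet_Ioi fun t ht => ?_
    rw [kern_cauchy ht]; simp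
  have h010 : kernInt 0 1 0 0 (x - cauchyParam 0) (cauchyParam 1) (cauchyParam 2) =
      (1 / (1 + Complex.I * x)) ^ 2 := by
    rw [kernInt_zero_angle, ← integral_mul_exp_neg]
    refine setIntegral_congr_fun measurableSet_Ioi fun t ht => ?_
    rw [kern_cauchy ht]; simp
  have h011 : kernInt 0 1 1 0 (x - cauchyParam 0) (cauchyParam 1) (cauchyParam 2) =
      (1 / (1 + Complex.I * x)) ^ 2 *
        (1 - Real.eulerMascheroniConstant - Complex.log (1 + Complex.I * x)) := by
    rw [kernInt_zero_angle, ← integral_mul_log_mul_exp_neg]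
    refine setIntegral_congr_fun measurableSet_Ioi fun t ht => ?_
    rw [kern_cauchy ht]; simp; ring
  have h1 : (cauchyParam 1 : ℂ) = 1 := by simp [cauchyParam]
  have h2 : (cauchyParam 2 : ℂ) = 1 := by simp [cauchyParam]
  fin_cases i
  · simp [kernIntGrad, cauchyGrad, h100]
  · simp only [kernIntGrad, cauchyGrad, Fin.mk_one, Matrix.cons_val_one, Matrix.cons_val, zero_add,
      h010]
    simp [h1, h2]
  · simp [kernIntGrad, cauchyGrad, h011]

lemma scoreIntegrand_eq {t : ℝ} (ht : 0 < t) (x : ℝ) (i : Fin 3) :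
    scoreIntegrand 1 x i t = kernGrad 0 0 0 x cauchyParam t i := by
  have h1 : cauchyParam 1 = 1 := rfl
  have h2 : cauchyParam 2 = 1 := rfl
  have e : Complex.exp (-((1 + Complex.I * x) * t)) =
      Complex.exp (-(Complex.I * t * x)) * ((Real.exp (-t) : ℝ) : ℂ) := by
    rw [Complex.ofReal_exp, ← Complex.exp_add]; congr 1; push_cast; ring
  unfold scoreIntegrand
  fin_cases i <;>
    simp only [charFnGrad, kernGrad, kern_cauchy ht, e, abs_of_pos ht, Real.rpow_one,
      Fin.zero_eta, Fin.mk_one, Fin.reduceFinMk, Matrix.cons_val_zero, Matrix.cons_val_one, Matrix.cons_val] <;>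
    simp [h1, h2] <;> ring

lemma integral_scoreIntegrand (x : ℝ) (i : Fin 3) :
    Integrable (scoreIntegrand 1 x i) ∧
      ∫ t, scoreIntegrand 1 x i t = ((2 * (cauchyGrad x i).re : ℝ) : ℂ) := by
  have hint := fun a b c => integrableOn_kern_nearCauchy a b c cauchyParam_mem_nearCauchy x
  have h0 : IntegrableOn (fun t => kernGrad 0 0 0 x cauchyParam t i) (Set.Ioi 0) := by
    fin_cases i <;> simp only [kernGrad, Fin.zero_eta, Fin.mk_one, Fin.reduceFinMk,
      Matrix.cons_val_zero, Matrix.cons_val_one, Matrix.cons_val]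
    · exact (hint _ _ _).const_mul _
    · exact ((((hint _ _ _).const_mul _).add (((hint _ _ _).const_mul _).const_mul _)).add
        (((hint _ _ _).const_mul _).const_mul _)).const_mul _
    · exact ((hint _ _ _).const_mul _).add ((hint _ _ _).const_mul _)
  have he : ∀ t ∈ Set.Ioi (0 : ℝ), kernGrad 0 0 0 x cauchyParam t i = scoreIntegrand 1 x i t :=
    fun t ht => (scoreIntegrand_eq ht x i).symm
  obtain ⟨h1, h2⟩ := integral_of_conj_symm (h0.congr_fun he measurableSet_Ioi) (fun t => by
    unfold scoreIntegrand
    rw [map_mul, ← Complex.exp_conj]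
    congr 1
    · simp
    · fin_cases i <;> simp [charFnGrad, ← Complex.exp_conj])
  refine ⟨h1, ?_⟩
  rw [h2, ← setIntegral_congr_fun measurableSet_Ioi he, ← kernIntGrad_cauchyParam]
  congr 3
  fin_cases i <;> simp only [kernGrad, kernIntGrad, Fin.zero_eta, Fin.mk_one, Fin.reduceFinMk,
      Matrix.cons_val_zero, Matrix.cons_val_one, Matrix.cons_val, kernInt_zero_angle]
  · rw [integral_const_mul]
  · have i1 := (hint 0 0 (0 - 1)).const_mul ((0 : ℕ) : ℂ)
    have i2 := (((hint 0 0 0).const_mul ((cauchyParam 2 : ℝ) : ℂ)).const_mul ((0 : ℕ) : ℂ))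
    have i3 := (((hint 0 (0 + 1) 0).const_mul ((cauchyParam 2 : ℝ) : ℂ)).const_mul (-1 : ℂ))
    have e := integral_add (i1.add i2) i3
    simp only [Pi.add_apply] at e
    rw [integral_const_mul, e, integral_add i1 i2]
    simp only [integral_const_mul]
  · rw [integral_add ((hint _ _ _).const_mul _) ((hint _ _ _).const_mul _)]
    simp only [integral_const_mul]

/-- The score functions at the Cauchy parameter, in closed form. -/
def cauchyScore (i : Fin 3) (x : ℝ) : ℝ :=
  ![2 * x / (x ^ 2 + 1), (x ^ 2 - 1) / (x ^ 2 + 1),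
    (1 - x ^ 2) / (x ^ 2 + 1) * (1 / 2 * Real.log (x ^ 2 + 1) - 1 + Real.eulerMascheroniConstant) +
      2 * x / (x ^ 2 + 1) * Real.arctan x] i

lemma cauchyGrad_re (x : ℝ) (i : Fin 3) :
    (cauchyGrad x i).re = cauchyScore i x / (x ^ 2 + 1) := by
  have hinv : (1 / (1 + Complex.I * x) : ℂ) ^ 2 =
      (((1 - x ^ 2) / (x ^ 2 + 1) ^ 2 : ℝ) : ℂ) + ((-2 * x / (x ^ 2 + 1) ^ 2 : ℝ) : ℂ) * Complex.I := by
    have h1 := one_add_I_mul_ne_zero x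
    have h2 : ((x : ℂ) ^ 2 + 1) ≠ 0 := by
      have : (x ^ 2 + 1 : ℝ) ≠ 0 := by positivity
      exact_mod_cast this
    have h3 : ((x : ℂ) ^ 2 + 1) = (1 + Complex.I * x) * (1 - Complex.I * x) := by
      ring_nf; rw [Complex.I_sq]; ring
    push_cast
    field_simp
    rw [h3]
    rw [← sub_eq_zero]
    ring_nf
    simp only [Complex.I_sq, Complex.I_pow_three, Complex.I_pow_four]
    ring_nf
  have hx : x ^ 2 + 1 ≠ 0 := by positivity
  fin_cases i
  · simp only [cauchyGrad, cauchyScore, Fin.zero_eta, Matrix.cons_val_zero]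
    rw [hinv]
    have e : ∀ A B : ℝ, (Complex.I * ((A : ℂ) + B * Complex.I)).re = -B := by intro A B; simp
    rw [e]
    field_simp
  · simp only [cauchyGrad, cauchyScore, Fin.mk_one, Matrix.cons_val_one, Matrix.cons_val]
    rw [hinv]
    have e : ∀ A B : ℝ, (-((A : ℂ) + B * Complex.I)).re = -A := by intro A B; simp
    rw [e]
    field_simp
    ring
  · simp only [cauchyGrad, cauchyScore, Fin.reduceFinMk, Matrix.cons_val]
    rw [hinv, log_one_add_I_mul]
    have e : ∀ A B L T g : ℝ, (-(((A : ℂ) + B * Complex.I) * (1 - (g : ℂ) - ((L : ℂ) + T * Complex.I)))).re =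
        -(A * (1 - g - L) + B * T) := by
      intro A B L T g
      simp
    rw [e]
    field_simp
    ring

lemma score_cauchy (x : ℝ) (i : Fin 3) : score 1 x i = ((cauchyScore i x : ℝ) : ℂ) := by
  unfold score
  have : density ![0, 1, 1] x = 1 / Real.pi * (1 / (1 + x ^ 2)) := density_cauchyParam x
  rw [(integral_scoreIntegrand x i).2, cauchyGrad_re, this]
  have hx : x ^ 2 + 1 ≠ 0 := by positivity
  have hx' : 1 + x ^ 2 ≠ 0 := by positivity
  rw [← Complex.ofReal_ofNat 2, ← Complex.ofReal_mul, ← Complex.ofReal_mul, ← Complex.ofReal_one,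
    ← Complex.ofReal_div, ← Complex.ofReal_mul]
  congr 1
  field_simp
  ring

/-! ### Derivatives of the log-density and their growth -/

lemma measurable_density_cauchyParam : Measurable (density cauchyParam) := by
  rw [show density cauchyParam = fun x => 1 / Real.pi * (1 / (1 + x ^ 2)) from
    funext density_cauchyParam]
  fun_prop

lemma integrable_law_cauchyParam_iff {g : ℝ → ℝ} :
    Integrable g (law cauchyParam) ↔ Integrable fun x => density cauchyParam x * g x := by
  unfold law
  rw [integrable_withDensity_iff_integrable_smul' measurable_density_cauchyParam.ennreal_ofReal
    (ae_of_all _ fun x => ENNReal.ofReal_lt_top)]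
  simp only [ENNReal.toReal_ofReal (density_cauchyParam_pos _).le, smul_eq_mul]

lemma integral_law_cauchyParam (g : ℝ → ℝ) :
    ∫ x, g x ∂(law cauchyParam) = ∫ x, density cauchyParam x * g x := by
  unfold law
  rw [integral_withDensity_eq_integral_toReal_smul measurable_density_cauchyParam.ennreal_ofReal
    (ae_of_all _ fun x => ENNReal.ofReal_lt_top)]
  simp only [ENNReal.toReal_ofReal (density_cauchyParam_pos _).le, smul_eq_mul]

lemma density_cauchyParam_le (x : ℝ) : density cauchyParam x ≤ (1 + |x|) ^ (-(2 : ℝ)) := by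
  rw [density_cauchyParam, Real.rpow_neg (by positivity), ← one_div, one_div_mul_one_div]
  have h3 := Real.pi_gt_three
  apply one_div_le_one_div_of_le (by positivity)
  have : (1 + |x|) ^ (2 : ℝ) = (1 + |x|) ^ 2 := by exact_mod_cast Real.rpow_natCast (1 + |x|) 2
  rw [this]
  have h4 : x ^ 2 = |x| ^ 2 := (sq_abs x).symm
  rw [h4]
  nlinarith [sq_nonneg (|x| - 1), sq_nonneg (|x|)]

lemma integrable_law_of_le_rpow {g : ℝ → ℝ} {K r : ℝ} (hg : AEStronglyMeasurable g) (hr : r < 1)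
    (h : ∀ x, |g x| ≤ K * (1 + |x|) ^ r) : Integrable g (law cauchyParam) := by
  rw [integrable_law_cauchyParam_iff]
  refine Integrable.mono' ((integrable_envelope (r := 2 - r) (by linarith)).const_mul K)
    (measurable_density_cauchyParam.aestronglyMeasurable.mul hg) (ae_of_all _ fun x => ?_)
  rw [norm_mul, Real.norm_of_nonneg (density_cauchyParam_pos x).le, Real.norm_eq_abs]
  have hp : 0 < 1 + |x| := by positivity
  calc _ ≤ (1 + |x|) ^ (-(2 : ℝ)) * (K * (1 + |x|) ^ r) := by
        gcongr
        · exact density_cauchyParam_le x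
        · exact h x
    _ = _ := by
        rw [show -(2 - r) = -2 + r by ring, Real.rpow_add hp]; ring

/-- For |x| ≥ R + 1 the tail bound applies, as the location moves by at most 1. On the remaining
bounded range the density is uniformly close to the Cauchy density, which is at least δ there. -/
lemma exists_density_lower : ∃ c : ℝ, 0 < c ∧ ∃ r : ℝ, 0 < r ∧
    Metric.ball cauchyParam r ⊆ nearCauchy ∧ (∀ θ ∈ Metric.ball cauchyParam r, |θ 0| ≤ 1) ∧
    ∀ θ ∈ Metric.ball cauchyParam r, ∀ x, c * (1 + |x|) ^ (-(65 / 32) : ℝ) ≤ density θ x := by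
  obtain ⟨c, R, hc, hR, h⟩ := density_tail_lower
  set δ : ℝ := 1 / Real.pi * (1 / (1 + (R + 1) ^ 2)) with hδ
  have hδ0 : 0 < δ := by positivity
  have h1 := eventually_abs_density_sub_le (θ₁ := cauchyParam)
    (by linarith [cauchyParam_mem_nearCauchy.1]) (by linarith [cauchyParam_mem_nearCauchy.2.2.1])
    (half_pos hδ0)
  have h2 : ∀ᶠ θ : Param in 𝓝 cauchyParam, |θ 0| < 1 := by
    have : ContinuousAt (fun θ : Param => |θ 0|) cauchyParam :=
      ((continuous_apply (0 : Fin 3)).abs).continuousAt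
    exact this.eventually_lt_const (by simp [cauchyParam])
  obtain ⟨r, hr, hball⟩ := Metric.eventually_nhds_iff_ball.1
    (h1.and (h2.and (isOpen_nearCauchy.mem_nhds cauchyParam_mem_nearCauchy)))
  refine ⟨min c (δ / 2), by positivity, r, hr, fun θ hθ => (hball θ hθ).2.2,
    fun θ hθ => (hball θ hθ).2.1.le, fun θ hθ x => ?_⟩
  obtain ⟨b1, b2, b3⟩ := hball θ hθ
  have hp : 0 < (1 + |x|) ^ (-(65 / 32) : ℝ) := by positivity
  rcases le_total (R + 1) |x| with hx | hx
  · have t1 := abs_sub_abs_le_abs_sub x (θ 0)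
    have t2 := abs_sub x (θ 0)
    have hRx : R ≤ |x - θ 0| := by linarith
    refine le_trans ?_ (h θ b3.1.le b3.2.1.le b3.2.2.1.le b3.2.2.2.le x hRx)
    refine mul_le_mul (min_le_left _ _) ?_ hp.le hc.le
    exact Real.rpow_le_rpow_of_nonpos (by linarith) (by linarith) (by norm_num)
  · have t1 : δ ≤ density cauchyParam x := by
      rw [density_cauchyParam, hδ]
      have : x ^ 2 ≤ (R + 1) ^ 2 := sq_le_sq.2 (by rwa [abs_of_pos (by linarith : 0 < R + 1)])
      gcongr
    have t2 := (abs_le.1 (b1 x)).1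
    have t3 : (1 + |x|) ^ (-(65 / 32) : ℝ) ≤ 1 :=
      Real.rpow_le_one_of_one_le_of_nonpos (by linarith [abs_nonneg x]) (by norm_num)
    calc _ ≤ δ / 2 * 1 := mul_le_mul (min_le_right _ _) t3 hp.le (by positivity)
      _ ≤ _ := by linarith

lemma envelope_shift_le {μ : ℝ} (hμ : |μ| ≤ 1) (x : ℝ) :
    (1 + |x - μ|) ^ (-(31 / 16) : ℝ) ≤ 4 * (1 + |x|) ^ (-(31 / 16) : ℝ) := by
  have hx : 0 < 1 + |x| := by positivity
  have t2 := abs_sub_abs_le_abs_sub x μ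
  calc (1 + |x - μ|) ^ (-(31 / 16) : ℝ) ≤ ((1 + |x|) / 2) ^ (-(31 / 16) : ℝ) :=
        Real.rpow_le_rpow_of_nonpos (by positivity) (by linarith [abs_nonneg (x - μ)])
          (by norm_num)
    _ = (1 + |x|) ^ (-(31 / 16) : ℝ) * (2 : ℝ) ^ (31 / 16 : ℝ) := by
        rw [Real.div_rpow hx.le (by norm_num), Real.rpow_neg (by norm_num : (0 : ℝ) ≤ 2),
          div_inv_eq_mul]
    _ ≤ (1 + |x|) ^ (-(31 / 16) : ℝ) * (2 : ℝ) ^ (2 : ℝ) := by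
        gcongr <;> norm_num
    _ = _ := by norm_num; ring

/-- The gradient of the log-density. -/
def logGrad (f₁ : Fin 3 → Param → ℝ → ℝ) (i : Fin 3) (θ : Param) (x : ℝ) : ℝ :=
  f₁ i θ x / density θ x

/-- The Hessian of the log-density. -/
def logHess (f₁ : Fin 3 → Param → ℝ → ℝ) (f₂ : Fin 3 → Fin 3 → Param → ℝ → ℝ) (i j : Fin 3)
    (θ : Param) (x : ℝ) : ℝ :=
  f₂ i j θ x / density θ x - f₁ i θ x / density θ x * (f₁ j θ x / density θ x)

/-- The third derivatives of the log-density. -/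
def logThird (f₁ : Fin 3 → Param → ℝ → ℝ) (f₂ : Fin 3 → Fin 3 → Param → ℝ → ℝ)
    (f₃ : Fin 3 → Fin 3 → Fin 3 → Param → ℝ → ℝ) (i j k : Fin 3) (θ : Param) (x : ℝ) : ℝ :=
  f₃ i j k θ x / density θ x - f₂ i j θ x / density θ x * (f₁ k θ x / density θ x) -
    (f₁ i θ x / density θ x * logHess f₁ f₂ j k θ x +
      f₁ j θ x / density θ x * logHess f₁ f₂ i k θ x)

lemma hasFDerivAt_div_gradCLM {f g : Param → ℝ} {f' g' : Fin 3 → ℝ} {θ : Param}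
    (hg : HasFDerivAt g (gradCLM g') θ) (hf : HasFDerivAt f (gradCLM f') θ) (h0 : f θ ≠ 0) :
    HasFDerivAt (fun θ => g θ / f θ)
      (gradCLM fun i => g' i / f θ - g θ / f θ * (f' i / f θ)) θ := by
  have hi := (hasDerivAt_inv h0).comp_hasFDerivAt θ hf
  have h := hg.mul hi
  simp only [div_eq_mul_inv]
  refine h.congr_fderiv ?_
  ext v
  simp [gradCLM_apply, Fin.sum_univ_three]
  field_simp
  ring

lemma hasFDerivAt_mul_gradCLM {f g : Param → ℝ} {f' g' : Fin 3 → ℝ} {θ : Param}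
    (hg : HasFDerivAt g (gradCLM g') θ) (hf : HasFDerivAt f (gradCLM f') θ) :
    HasFDerivAt (fun θ => g θ * f θ) (gradCLM fun i => g θ * f' i + f θ * g' i) θ := by
  refine (hg.mul hf).congr_fderiv ?_
  ext v
  simp [gradCLM_apply, Fin.sum_univ_three]
  ring

lemma hasFDerivAt_sub_gradCLM {f g : Param → ℝ} {f' g' : Fin 3 → ℝ} {θ : Param}
    (hg : HasFDerivAt g (gradCLM g') θ) (hf : HasFDerivAt f (gradCLM f') θ) :
    HasFDerivAt (fun θ => g θ - f θ) (gradCLM fun i => g' i - f' i) θ := by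
  refine (hg.sub hf).congr_fderiv ?_
  ext v
  simp [gradCLM_apply, Fin.sum_univ_three]
  ring

/-- The derivatives of the log-density on a ball around the Cauchy parameter, with bounds that are
integrable under the Cauchy law. -/
structure LogDensityDerivs (r K : ℝ) (m₁ : Fin 3 → Param → ℝ → ℝ)
    (m₂ : Fin 3 → Fin 3 → Param → ℝ → ℝ) (m₃ : Fin 3 → Fin 3 → Fin 3 → Param → ℝ → ℝ) : Prop where
  radius_pos : 0 < r
  subset : Metric.ball cauchyParam r ⊆ nearCauchy
  density_pos : ∀ θ ∈ Metric.ball cauchyParam r, ∀ x, 0 < density θ x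
  deriv₁ : ∀ θ ∈ Metric.ball cauchyParam r, ∀ x,
    HasFDerivAt (logDensity x) (gradCLM fun i => m₁ i θ x) θ
  deriv₂ : ∀ i, ∀ θ ∈ Metric.ball cauchyParam r, ∀ x,
    HasFDerivAt (fun θ => m₁ i θ x) (gradCLM fun j => m₂ i j θ x) θ
  deriv₃ : ∀ i j, ∀ θ ∈ Metric.ball cauchyParam r, ∀ x,
    HasFDerivAt (fun θ => m₂ i j θ x) (gradCLM fun k => m₃ i j k θ x) θ
  bound₂ : ∀ i j x, |m₂ i j cauchyParam x| ≤ K * (1 + |x|) ^ (9 / 32 : ℝ)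
  bound₃ : ∀ i j k, ∀ θ ∈ Metric.ball cauchyParam r, ∀ x,
    |m₃ i j k θ x| ≤ K * (1 + |x|) ^ (9 / 32 : ℝ)
  measurable₂ : ∀ i j, Measurable (m₂ i j cauchyParam)

lemma DensityDerivs.logDensityDerivs {f₁ : Fin 3 → Param → ℝ → ℝ}
    {f₂ : Fin 3 → Fin 3 → Param → ℝ → ℝ} {f₃ : Fin 3 → Fin 3 → Fin 3 → Param → ℝ → ℝ} {C : ℝ}
    (D : DensityDerivs f₁ f₂ f₃ C) :
    ∃ r K, LogDensityDerivs r K (logGrad f₁) (logHess f₁ f₂) (logThird f₁ f₂ f₃) := by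
  obtain ⟨c, hc, r, hr, hsub, hμ, hlow⟩ := exists_density_lower
  have hpos : ∀ θ ∈ Metric.ball cauchyParam r, ∀ x, 0 < density θ x := fun θ hθ x =>
    lt_of_lt_of_le (by positivity) (hlow θ hθ x)
  set K : ℝ := max 1 (4 * C / c) with hK
  have hK1 : 1 ≤ K := le_max_left _ _
  -- The two tail exponents miss each other only by 65/32 - 31/16 = 3/32, so a derivative of the
  -- density divided by the density grows at most like (1 + |x|)^(3/32).
  have ratio : ∀ θ ∈ Metric.ball cauchyParam r, ∀ x g, |g| ≤ C * (1 + |x - θ 0|) ^ (-(31 / 16) : ℝ) →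
      |g / density θ x| ≤ K * (1 + |x|) ^ (3 / 32 : ℝ) := by
    intro θ hθ x g hg
    have hx : 0 < 1 + |x| := by positivity
    have t1 := envelope_shift_le (hμ θ hθ) x
    rw [abs_div, abs_of_pos (hpos θ hθ x), div_le_iff₀ (hpos θ hθ x)]
    have hC := D.pos
    calc |g| ≤ C * (4 * (1 + |x|) ^ (-(31 / 16) : ℝ)) := hg.trans (by gcongr)
      _ = (4 * C / c) * (1 + |x|) ^ (3 / 32 : ℝ) * (c * (1 + |x|) ^ (-(65 / 32) : ℝ)) := by
          rw [show (-(31 / 16) : ℝ) = 3 / 32 + -(65 / 32) by norm_num, Real.rpow_add hx]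
          field_simp
      _ ≤ _ := by
          have := hlow θ hθ x
          gcongr
          exact le_max_right _ _
  have r1 := fun i θ hθ x => ratio θ hθ x _ (D.bound₁ i θ (hsub hθ) x)
  have r2 := fun i j θ hθ x => ratio θ hθ x _ (D.bound₂ i j θ (hsub hθ) x)
  have r3 := fun i j k θ hθ x => ratio θ hθ x _ (D.bound₃ i j k θ (hsub hθ) x)
  have hw : ∀ x : ℝ, (1 + |x|) ^ (9 / 32 : ℝ) = ((1 + |x|) ^ (3 / 32 : ℝ)) ^ 3 := fun x => by
    rw [← Real.rpow_natCast, ← Real.rpow_mul (by positivity)]; norm_num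
  have hB : ∀ x : ℝ, 1 ≤ K * (1 + |x|) ^ (3 / 32 : ℝ) := fun x => by
    have : 1 ≤ (1 + |x|) ^ (3 / 32 : ℝ) := Real.one_le_rpow (by linarith [abs_nonneg x]) (by norm_num)
    nlinarith
  have dm1 : ∀ i, ∀ θ ∈ Metric.ball cauchyParam r, ∀ x,
      HasFDerivAt (fun θ => logGrad f₁ i θ x) (gradCLM fun j => logHess f₁ f₂ i j θ x) θ :=
    fun i θ hθ x => hasFDerivAt_div_gradCLM (D.deriv₂ i θ (hsub hθ) x) (D.deriv₁ θ (hsub hθ) x)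
      (hpos θ hθ x).ne'
  have hmem : cauchyParam ∈ Metric.ball cauchyParam r := Metric.mem_ball_self hr
  have hH : ∀ i j, ∀ θ ∈ Metric.ball cauchyParam r, ∀ x,
      |logHess f₁ f₂ i j θ x| ≤ 2 * (K * (1 + |x|) ^ (3 / 32 : ℝ)) ^ 2 := by
    intro i j θ hθ x
    have b1 := r1 i θ hθ x
    have b2 := r1 j θ hθ x
    have b3 := r2 i j θ hθ x
    have b4 := hB x
    unfold logHess
    generalize K * (1 + |x|) ^ (3 / 32 : ℝ) = B at *
    refine (abs_sub _ _).trans ?_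
    rw [abs_mul]
    have := mul_le_mul b1 b2 (abs_nonneg _) (by linarith)
    nlinarith
  -- With B = K(1 + |x|)^(3/32) ≥ 1 a third derivative is at most B + B² + 2·B·2B² ≤ 6B³, and B³ has
  -- growth exponent 9/32.
  refine ⟨r, 6 * K ^ 3, hr, hsub, hpos, ?_, dm1, ?_, ?_, ?_, ?_⟩
  · intro θ hθ x
    refine ((D.deriv₁ θ (hsub hθ) x).log (hpos θ hθ x).ne').congr_fderiv ?_
    ext v
    simp [gradCLM_apply, Fin.sum_univ_three, logGrad]
    ring
  · intro i j θ hθ x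
    have h1 := hasFDerivAt_div_gradCLM (D.deriv₃ i j θ (hsub hθ) x) (D.deriv₁ θ (hsub hθ) x)
      (hpos θ hθ x).ne'
    have h2 := hasFDerivAt_mul_gradCLM (dm1 i θ hθ x) (dm1 j θ hθ x)
    exact hasFDerivAt_sub_gradCLM h1 h2
  · intro i j x
    have b1 := hH i j _ hmem x
    have b4 := hB x
    rw [hw, mul_assoc, ← mul_pow]
    generalize K * (1 + |x|) ^ (3 / 32 : ℝ) = B at *
    have : B ^ 2 ≤ B ^ 3 := pow_le_pow_right₀ b4 (by norm_num)
    nlinarith [sq_nonneg B]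
  · intro i j k θ hθ x
    have b1 := r1 i θ hθ x
    have b2 := r1 j θ hθ x
    have b3 := r1 k θ hθ x
    have b5 := r2 i j θ hθ x
    have b6 := r3 i j k θ hθ x
    have b7 := hH j k θ hθ x
    have b8 := hH i k θ hθ x
    have b4 := hB x
    rw [hw, mul_assoc, ← mul_pow]
    unfold logThird
    generalize K * (1 + |x|) ^ (3 / 32 : ℝ) = B at *
    have c1 := mul_le_mul b5 b3 (abs_nonneg _) (by linarith)
    have c2 := mul_le_mul b1 b7 (abs_nonneg _) (by linarith)
    have c3 := mul_le_mul b2 b8 (abs_nonneg _) (by linarith)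
    rw [← abs_mul] at c1 c2 c3
    have p1 : B ^ 2 ≤ B ^ 3 := pow_le_pow_right₀ b4 (by norm_num)
    have p2 : B ≤ B ^ 3 := le_self_pow₀ b4 (by norm_num)
    refine (abs_sub _ _).trans ((add_le_add (abs_sub _ _) (abs_add_le _ _)).trans ?_)
    nlinarith
  · intro i j
    exact ((D.measurable₂ i j _).div measurable_density_cauchyParam).sub
      (((D.measurable₁ i _).div measurable_density_cauchyParam).mul
        ((D.measurable₁ j _).div measurable_density_cauchyParam))

section
variable {r K : ℝ} {m₁ : Fin 3 → Param → ℝ → ℝ} {m₂ : Fin 3 → Fin 3 → Param → ℝ → ℝ}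
  {m₃ : Fin 3 → Fin 3 → Fin 3 → Param → ℝ → ℝ}

/-- The second partial derivatives are continuous because they are themselves differentiable. -/
lemma LogDensityDerivs.contDiffAt (L : LogDensityDerivs r K m₁ m₂ m₃) (x : ℝ) :
    ContDiffAt ℝ 2 (logDensity x) cauchyParam := by
  have hball := Metric.ball_mem_nhds cauchyParam L.radius_pos
  have c2 : ∀ i j, ContinuousOn (fun θ => m₂ i j θ x) (Metric.ball cauchyParam r) := fun i j θ hθ =>
    (L.deriv₃ i j θ hθ x).continuousAt.continuousWithinAt
  have m1C : ∀ i, ContDiffAt ℝ 1 (fun θ => m₁ i θ x) cauchyParam := by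
    intro i
    rw [show (1 : WithTop ℕ∞) = ((0 : ℕ) : WithTop ℕ∞) + 1 by simp, contDiffAt_succ_iff_hasFDerivAt]
    refine ⟨fun θ => gradCLM fun j => m₂ i j θ x, ⟨_, hball, fun θ hθ => L.deriv₂ i θ hθ x⟩, ?_⟩
    rw [Nat.cast_zero, contDiffAt_zero]
    refine ⟨_, hball, ?_⟩
    unfold gradCLM
    refine continuousOn_finsetSum _ fun j _ => ?_
    exact ((ContinuousLinearMap.smulRightL ℝ Param ℝ
      (ContinuousLinearMap.proj (R := ℝ) (φ := fun _ : Fin 3 => ℝ) j)).continuous.comp_continuousOn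
        (c2 i j))
  rw [show (2 : WithTop ℕ∞) = ((1 : ℕ) : WithTop ℕ∞) + 1 by norm_num, contDiffAt_succ_iff_hasFDerivAt]
  refine ⟨fun θ => gradCLM fun j => m₁ j θ x, ⟨_, hball, fun θ hθ => L.deriv₁ θ hθ x⟩, ?_⟩
  rw [Nat.cast_one]
  unfold gradCLM
  refine ContDiffAt.sum fun j _ => ?_
  exact ((ContinuousLinearMap.smulRightL ℝ Param ℝ
    (ContinuousLinearMap.proj (R := ℝ) (φ := fun _ : Fin 3 => ℝ) j)).contDiff.contDiffAt.comp _
      (m1C j))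

lemma LogDensityDerivs.partialDeriv_logDensity (L : LogDensityDerivs r K m₁ m₂ m₃) {θ : Param}
    (hθ : θ ∈ Metric.ball cauchyParam r) (x : ℝ) (i : Fin 3) :
    partialDeriv i (logDensity x) θ = m₁ i θ x := by
  unfold partialDeriv
  rw [((L.deriv₁ θ hθ x).hasLineDerivAt _).lineDeriv, gradCLM_single]

/-- The indices are exchanged because the first index of `m₂` names the inner derivative, which in
`logDensityHess` is `j`. -/
lemma LogDensityDerivs.logDensityHess_eq (L : LogDensityDerivs r K m₁ m₂ m₃) (x : ℝ) (i j : Fin 3) :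
    logDensityHess cauchyParam i j x = m₂ j i cauchyParam x := by
  have hmem : cauchyParam ∈ Metric.ball cauchyParam r := Metric.mem_ball_self L.radius_pos
  have h1 : HasFDerivAt (partialDeriv j (logDensity x)) (gradCLM fun i => m₂ j i cauchyParam x)
      cauchyParam := by
    refine (L.deriv₂ j cauchyParam hmem x).congr_of_eventuallyEq ?_
    filter_upwards [Metric.ball_mem_nhds cauchyParam L.radius_pos] with θ hθ
    exact L.partialDeriv_logDensity hθ x j
  unfold logDensityHess
  rw [partialDeriv, (h1.hasLineDerivAt _).lineDeriv, gradCLM_single]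

lemma LogDensityDerivs.integrable_hess (L : LogDensityDerivs r K m₁ m₂ m₃) (i j : Fin 3) :
    Integrable (m₂ i j cauchyParam) (law cauchyParam) :=
  integrable_law_of_le_rpow (L.measurable₂ i j).aestronglyMeasurable (by norm_num) (L.bound₂ i j)

end

/-! ### The score at the Cauchy parameter and differentiation of the total mass -/

lemma logGrad_cauchyParam {f₁ : Fin 3 → Param → ℝ → ℝ}
    (h : ∀ i θ x, f₁ i θ x = 1 / Real.pi * (kernIntGrad 0 0 0 x θ i).re) (i : Fin 3) (x : ℝ) :
    logGrad f₁ i cauchyParam x = cauchyScore i x := by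
  unfold logGrad
  rw [h, kernIntGrad_cauchyParam, cauchyGrad_re, density_cauchyParam]
  have := Real.pi_pos
  have hx : x ^ 2 + 1 ≠ 0 := by positivity
  have hx' : 1 + x ^ 2 ≠ 0 := by positivity
  field_simp
  ring

/-- Differentiation under the integral of a total integral that is constant in θ. It is applied to
the density with `c = 1`, and then to its first derivatives with `c = 0`. -/
lemma integral_deriv_eq_zero {F : Param → ℝ → ℝ} {F' : Fin 3 → Param → ℝ → ℝ} {U : Set Param}
    {B : ℝ → ℝ} {c : ℝ} {θ : Param} (hU : IsOpen U) (hθ : θ ∈ U)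
    (hF : ∀ θ ∈ U, AEStronglyMeasurable (F θ)) (hFi : Integrable (F θ))
    (hF' : ∀ i, AEStronglyMeasurable (F' i θ)) (hB : Integrable B)
    (hb : ∀ i, ∀ θ ∈ U, ∀ x, |F' i θ x| ≤ B x)
    (hd : ∀ θ ∈ U, ∀ x, HasFDerivAt (fun θ => F θ x) (gradCLM fun i => F' i θ x) θ)
    (hc : ∀ θ ∈ U, ∫ x, F θ x = c) (i : Fin 3) : ∫ x, F' i θ x = 0 := by
  have hm : AEStronglyMeasurable fun x => gradCLM fun i => F' i θ x := by
    unfold gradCLM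
    refine Finset.aestronglyMeasurable_fun_sum _ fun j _ => ?_
    exact (ContinuousLinearMap.smulRightL ℝ Param ℝ (ContinuousLinearMap.proj (R := ℝ)
      (φ := fun _ : Fin 3 => ℝ) j)).continuous.comp_aestronglyMeasurable (hF' j)
  have hbound : ∀ θ ∈ U, ∀ x, ‖gradCLM fun i => F' i θ x‖ ≤ 3 * B x := fun θ hθ x => by
    refine (norm_gradCLM_le _).trans ?_
    rw [Fin.sum_univ_three]
    have h0 := hb 0 θ hθ x
    have h1 := hb 1 θ hθ x
    have h2 := hb 2 θ hθ x
    simp only [Real.norm_eq_abs]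
    linarith
  have h1 := hasFDerivAt_integral_of_dominated_of_fderiv_le (𝕜 := ℝ) (hU.mem_nhds hθ)
    (by filter_upwards [hU.mem_nhds hθ] with θ' h' using hF θ' h') hFi hm
    (ae_of_all _ fun x θ' h' => hbound θ' h' x) (hB.const_mul 3)
    (ae_of_all _ fun x θ' h' => hd θ' h' x)
  have h2 : HasFDerivAt (fun θ => ∫ x, F θ x) (0 : Param →L[ℝ] ℝ) θ := by
    refine (hasFDerivAt_const c θ).congr_of_eventuallyEq ?_
    filter_upwards [hU.mem_nhds hθ] with θ' h' using hc θ' h'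
  have h3 := h1.unique h2
  have hint : Integrable fun x => gradCLM fun i => F' i θ x :=
    (hB.const_mul 3).mono' hm (ae_of_all _ fun x => hbound θ hθ x)
  have h4 := ContinuousLinearMap.integral_apply hint (Pi.single i 1)
  rw [h3] at h4
  simpa only [gradCLM_single, _root_.zero_apply, eq_comm] using h4

lemma DensityDerivs.integral_eq_zero {f₁ : Fin 3 → Param → ℝ → ℝ}
    {f₂ : Fin 3 → Fin 3 → Param → ℝ → ℝ} {f₃ : Fin 3 → Fin 3 → Fin 3 → Param → ℝ → ℝ} {C : ℝ}
    (D : DensityDerivs f₁ f₂ f₃ C) :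
    (∀ i, Integrable (f₁ i cauchyParam) ∧ ∫ x, f₁ i cauchyParam x = 0) ∧
      ∀ i j, Integrable (f₂ i j cauchyParam) ∧ ∫ x, f₂ i j cauchyParam x = 0 := by
  set U : Set Param := nearCauchy ∩ {θ | |θ 0| < 1} with hU
  have hUo : IsOpen U := isOpen_nearCauchy.inter
    (isOpen_lt (continuous_apply (0 : Fin 3)).abs continuous_const)
  have h0 : cauchyParam ∈ U := ⟨cauchyParam_mem_nearCauchy, by simp [cauchyParam]⟩
  have hB : Integrable fun x : ℝ => C * (4 * (1 + |x|) ^ (-(31 / 16) : ℝ)) :=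
    ((integrable_envelope (by norm_num)).const_mul 4).const_mul C
  have hC := D.pos
  have b1 : ∀ i, ∀ θ ∈ U, ∀ x, |f₁ i θ x| ≤ C * (4 * (1 + |x|) ^ (-(31 / 16) : ℝ)) :=
    fun i θ hθ x => (D.bound₁ i θ hθ.1 x).trans (by
      gcongr; exact envelope_shift_le (le_of_lt hθ.2) x)
  have b2 : ∀ i j, ∀ θ ∈ U, ∀ x, |f₂ i j θ x| ≤ C * (4 * (1 + |x|) ^ (-(31 / 16) : ℝ)) :=
    fun i j θ hθ x => (D.bound₂ i j θ hθ.1 x).trans (by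
      gcongr; exact envelope_shift_le (le_of_lt hθ.2) x)
  have i1 : ∀ i, ∀ θ ∈ U, Integrable (f₁ i θ) := fun i θ hθ =>
    hB.mono' (D.measurable₁ i θ).aestronglyMeasurable (ae_of_all _ (b1 i θ hθ))
  have pr : ∀ θ ∈ U, 0 < θ 1 ∧ 0 < θ 2 ∧ θ 2 ≤ 2 := fun θ hθ =>
    ⟨by linarith [hθ.1.1], by linarith [hθ.1.2.2.1], by linarith [hθ.1.2.2.2]⟩
  -- Needed on all of `U`, not only at the Cauchy parameter, so that it can be differentiated once
  -- more.
  have z1 : ∀ i, ∀ θ ∈ U, ∫ x, f₁ i θ x = 0 := fun i θ hθ =>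
    integral_deriv_eq_zero (c := 1) hUo hθ
      (fun θ h => (measurable_density θ (pr θ h).1 (pr θ h).2.1 (pr θ h).2.2).aestronglyMeasurable)
      (integrable_density (pr θ hθ).1 (pr θ hθ).2.1 (pr θ hθ).2.2)
      (fun i => (D.measurable₁ i θ).aestronglyMeasurable) hB b1 (fun θ h => D.deriv₁ θ h.1)
      (fun θ h => integral_density (pr θ h).1 (pr θ h).2.1 (pr θ h).2.2) i
  refine ⟨fun i => ⟨i1 i _ h0, z1 i _ h0⟩, fun i j => ⟨hB.mono'
    (D.measurable₂ i j _).aestronglyMeasurable (ae_of_all _ (b2 i j _ h0)), ?_⟩⟩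
  exact integral_deriv_eq_zero (c := 0) hUo h0 (fun θ h => (D.measurable₁ i θ).aestronglyMeasurable)
      (i1 i _ h0) (fun j => (D.measurable₂ i j _).aestronglyMeasurable) hB (b2 i)
      (fun θ h => D.deriv₂ i θ h.1) (z1 i) j

/-! ### The Cayley transform and the Fisher information -/

/-- The Cayley transform, which maps the Cauchy law to the uniform law on the unit circle. -/
def cayley (x : ℝ) : ℂ :=
  (((1 - x ^ 2) / (1 + x ^ 2) : ℝ) : ℂ) + ((2 * x / (1 + x ^ 2) : ℝ) : ℂ) * Complex.I

lemma cayley_re (x : ℝ) : (cayley x).re = (1 - x ^ 2) / (1 + x ^ 2) := by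
  simp only [cayley, Complex.add_re, Complex.ofReal_re, Complex.mul_re, Complex.I_re, Complex.I_im,
    Complex.ofReal_im]
  ring

lemma cayley_im (x : ℝ) : (cayley x).im = 2 * x / (1 + x ^ 2) := by
  simp only [cayley, Complex.add_im, Complex.ofReal_re, Complex.mul_im, Complex.I_re, Complex.I_im,
    Complex.ofReal_im]
  ring

lemma cayley_re_sq_add_im_sq (x : ℝ) : (cayley x).re ^ 2 + (cayley x).im ^ 2 = 1 := by
  rw [cayley_re, cayley_im]
  have : 1 + x ^ 2 ≠ 0 := by positivity
  field_simp
  ring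

lemma norm_cayley (x : ℝ) : ‖cayley x‖ = 1 := by
  rw [Complex.norm_eq_sqrt_sq_add_sq, cayley_re_sq_add_im_sq, Real.sqrt_one]

lemma continuous_cayley : Continuous cayley := by
  unfold cayley
  have : ∀ x : ℝ, 1 + x ^ 2 ≠ 0 := fun x => by positivity
  refine ((Complex.continuous_ofReal.comp ?_)).add ((Complex.continuous_ofReal.comp ?_).mul
    continuous_const) <;> fun_prop (disch := exact this _)

lemma cayley_tan {φ : ℝ} (h : Real.cos φ ≠ 0) : cayley (Real.tan φ) = Complex.exp ((2 * φ : ℝ) * Complex.I) := by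
  have h1 : 1 + Real.tan φ ^ 2 = 1 / Real.cos φ ^ 2 := by
    rw [Real.tan_eq_sin_div_cos]
    field_simp
    linarith [Real.sin_sq_add_cos_sq φ]
  rw [Complex.exp_ofReal_mul_I]
  unfold cayley
  rw [h1, Real.cos_two_mul, Real.sin_two_mul,
    Real.tan_eq_sin_div_cos]
  congr 2
  · field_simp
    linarith [Real.sin_sq_add_cos_sq φ]
  · field_simp

lemma integral_law_eq_integral_tan {E : Type*} [NormedAddCommGroup E] [NormedSpace ℝ E] (g : ℝ → E) :
    ∫ x, g x ∂(law cauchyParam) =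
      (1 / Real.pi) • ∫ φ in Set.Ioo (-(Real.pi / 2)) (Real.pi / 2), g (Real.tan φ) := by
  unfold law
  rw [integral_withDensity_eq_integral_toReal_smul measurable_density_cauchyParam.ennreal_ofReal
    (ae_of_all _ fun x => ENNReal.ofReal_lt_top)]
  simp only [ENNReal.toReal_ofReal (density_cauchyParam_pos _).le]
  have h1 := integral_image_eq_integral_abs_deriv_smul measurableSet_Ioo
    (fun φ hφ => (Real.hasDerivAt_tan_of_mem_Ioo hφ).hasDerivWithinAt) Real.injOn_tan
    (fun x => density cauchyParam x • g x)
  rw [Real.image_tan_Ioo, setIntegral_univ] at h1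
  rw [h1, ← integral_smul]
  refine setIntegral_congr_fun measurableSet_Ioo fun φ hφ => ?_
  have hc := Real.cos_pos_of_mem_Ioo hφ
  have h2 : 1 + Real.tan φ ^ 2 = 1 / Real.cos φ ^ 2 := by
    rw [Real.tan_eq_sin_div_cos]
    field_simp
    linarith [Real.sin_sq_add_cos_sq φ]
  simp only [smul_smul]
  congr 1
  rw [density_cauchyParam, h2, abs_of_pos (by positivity)]
  field_simp

/-- With x = tan φ the Cauchy law is uniform in φ and `cayley x` is exp(2iφ), so the integral is a
circle average and the mean value property applies. -/
lemma integral_law_circle {F : ℂ → ℂ} {r : ℝ} (hr : 0 < r) (hF : DiffContOnCl ℂ F (Metric.ball 0 r)) :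
    ∫ x, F (r * cayley x) ∂(law cauchyParam) = F 0 := by
  have h := DiffContOnCl.circleAverage (c := 0) (R := r) (by rwa [abs_of_pos hr])
  rw [Real.circleAverage_eq_integral_add (-Real.pi)] at h
  rw [← h, integral_law_eq_integral_tan, ← integral_Ioc_eq_integral_Ioo,
    ← intervalIntegral.integral_of_le (by linarith [Real.pi_pos])]
  have h1 : ∫ φ in (-(Real.pi / 2))..(Real.pi / 2), F (r * cayley (Real.tan φ)) =
      ∫ φ in (-(Real.pi / 2))..(Real.pi / 2), F (circleMap 0 r (2 * φ)) := by
    rw [intervalIntegral.integral_of_le (by linarith [Real.pi_pos]),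
      intervalIntegral.integral_of_le (by linarith [Real.pi_pos]), integral_Ioc_eq_integral_Ioo,
      integral_Ioc_eq_integral_Ioo]
    refine setIntegral_congr_fun measurableSet_Ioo fun φ hφ => ?_
    rw [cayley_tan (Real.cos_pos_of_mem_Ioo hφ).ne', circleMap, zero_add]
  rw [h1, intervalIntegral.integral_comp_mul_left (fun u => F (circleMap 0 r u)) two_ne_zero,
    intervalIntegral.integral_comp_add_right (fun u => F (circleMap 0 r u)), smul_smul]
  congr 1
  · rw [mul_inv, one_div, mul_comm]
  · congr 1 <;> ring

instance isProbabilityMeasure_law_cauchyParam : IsProbabilityMeasure (law cauchyParam) := by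
  have h1 : (0 : ℝ) < cauchyParam 1 := by simp [cauchyParam]
  have h2 : (0 : ℝ) < cauchyParam 2 := by simp [cauchyParam]
  have h3 : cauchyParam 2 ≤ 2 := by simp [cauchyParam]
  constructor
  rw [law, withDensity_apply _ MeasurableSet.univ, setLIntegral_univ,
    ← ofReal_integral_eq_lintegral_ofReal (integrable_density h1 h2 h3)
      (ae_of_all _ fun x => (density_cauchyParam_pos x).le), integral_density h1 h2 h3,
    ENNReal.ofReal_one]

lemma one_add_cayley (x : ℝ) : 1 + cayley x = ((2 : ℝ) : ℂ) * (1 + Complex.I * ((-x : ℝ) : ℂ))⁻¹ := by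
  have h1 := one_add_I_mul_ne_zero (-x)
  have h2 : (1 + (x : ℂ) ^ 2) ≠ 0 := by
    have : (1 + x ^ 2 : ℝ) ≠ 0 := by positivity
    exact_mod_cast this
  rw [eq_mul_inv_iff_mul_eq₀ h1, cayley]
  push_cast
  field_simp
  ring_nf
  rw [Complex.I_sq]
  ring

lemma one_add_cayley_mem_slitPlane (x : ℝ) : 1 + cayley x ∈ Complex.slitPlane := by
  left
  rw [Complex.add_re, cayley_re, Complex.one_re]
  have : 0 < 1 + x ^ 2 := by positivity
  rw [show 1 + (1 - x ^ 2) / (1 + x ^ 2) = 2 / (1 + x ^ 2) by field_simp; ring]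
  positivity

lemma log_one_add_cayley (x : ℝ) : Complex.log (1 + cayley x) =
    ((Real.log 2 - 1 / 2 * Real.log (x ^ 2 + 1) : ℝ) : ℂ) + (Real.arctan x : ℝ) * Complex.I := by
  have harg : (1 + Complex.I * ((-x : ℝ) : ℂ)).arg ≠ Real.pi := by
    intro h
    have := (Complex.arg_eq_pi_iff.1 h).1
    simp at this
    linarith
  rw [one_add_cayley, Complex.log_ofReal_mul two_pos (inv_ne_zero (one_add_I_mul_ne_zero _)),
    Complex.log_inv _ harg, log_one_add_I_mul, neg_sq, Real.arctan_neg, Complex.ofReal_sub,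
    Complex.ofReal_neg]
  ring

/-- The bound is uniform up to r = 1, where log(1 + z) is singular at z = -1, the image of x = ∞. It
rests on |1 + rw|² ≥ 1/(1 + x²), where w = `cayley x`. -/
lemma norm_log_one_add_mul_cayley_le {r : ℝ} (hr : 0 ≤ r) (hr1 : r ≤ 1) (x : ℝ) :
    ‖Complex.log (1 + r * cayley x)‖ ≤ 13 * (1 + |x|) ^ (1 / 8 : ℝ) := by
  have hx : 0 < 1 + x ^ 2 := by positivity
  have hsq : ‖(1 + r * cayley x : ℂ)‖ ^ 2 = 1 + 2 * r * ((1 - x ^ 2) / (1 + x ^ 2)) + r ^ 2 := by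
    rw [← cayley_re, Complex.sq_norm, Complex.normSq_apply]
    simp only [Complex.add_re, Complex.one_re, Complex.re_ofReal_mul, Complex.add_im,
      Complex.one_im, Complex.im_ofReal_mul]
    linear_combination r ^ 2 * cayley_re_sq_add_im_sq x
  have hlow : (1 + x ^ 2)⁻¹ ≤ ‖(1 + r * cayley x : ℂ)‖ ^ 2 := by
    rw [hsq, ← sub_nonneg, show 1 + 2 * r * ((1 - x ^ 2) / (1 + x ^ 2)) + r ^ 2 - (1 + x ^ 2)⁻¹ =
      (2 * r + r ^ 2 + (1 - r) ^ 2 * x ^ 2) / (1 + x ^ 2) by field_simp; ring]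
    positivity
  have hup : ‖(1 + r * cayley x : ℂ)‖ ≤ 2 := by
    refine (norm_add_le _ _).trans ?_
    rw [norm_one, norm_mul, norm_cayley, Complex.norm_of_nonneg hr]
    linarith
  have hpos : 0 < ‖(1 + r * cayley x : ℂ)‖ := by
    by_contra h
    have h0 : ‖(1 + r * cayley x : ℂ)‖ = 0 := le_antisymm (not_lt.1 h) (norm_nonneg _)
    rw [h0] at hlow
    have : 0 < (1 + x ^ 2)⁻¹ := by positivity
    norm_num at hlow
    linarith
  have hax : 0 < 1 + |x| := by positivity
  have hlog : Real.log (1 + x ^ 2) ≤ 2 * Real.log (1 + |x|) := by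
    rw [← Nat.cast_ofNat (R := ℝ), ← Real.log_pow]
    apply Real.log_le_log hx
    have : x ^ 2 = |x| ^ 2 := (sq_abs x).symm
    nlinarith [abs_nonneg x]
  have hlog2 : Real.log (1 + |x|) ≤ (1 + |x|) ^ (1 / 8 : ℝ) / (1 / 8) :=
    Real.log_le_rpow_div hax.le (by norm_num)
  have hone : 1 ≤ (1 + |x|) ^ (1 / 8 : ℝ) :=
    Real.one_le_rpow (by linarith [abs_nonneg x]) (by norm_num)
  have hl2 : Real.log 2 < 1 := by linarith [Real.log_two_lt_d9]
  have hl0 : 0 ≤ Real.log (1 + x ^ 2) := Real.log_nonneg (by nlinarith [sq_nonneg x])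
  have hre : |(Complex.log (1 + r * cayley x)).re| ≤ 1 + 8 * (1 + |x|) ^ (1 / 8 : ℝ) := by
    rw [Complex.log_re, abs_le]
    constructor
    · have := Real.log_le_log (by positivity) hlow
      rw [Real.log_inv, Real.log_pow] at this
      push_cast at this
      linarith
    · have := Real.log_le_log hpos hup
      linarith
  have him : |(Complex.log (1 + r * cayley x)).im| ≤ 4 := by
    rw [Complex.log_im]
    exact (Complex.abs_arg_le_pi _).trans Real.pi_le_four
  refine (Complex.norm_le_abs_re_add_abs_im _).trans ?_
  linarith

lemma diffContOnCl_pow_mul_log_pow (k m : ℕ) {r : ℝ} (hr : r < 1) :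
    DiffContOnCl ℂ (fun z : ℂ => z ^ k * Complex.log (1 + z) ^ m) (Metric.ball 0 r) := by
  refine DifferentiableOn.diffContOnCl_ball (U := Metric.ball 0 1) (fun z hz => ?_)
    (Metric.closedBall_subset_ball hr)
  have h1 : 1 + z ∈ Complex.slitPlane := by
    left
    have := (abs_le.1 (Complex.abs_re_le_norm z)).1
    rw [mem_ball_zero_iff] at hz
    simp only [Complex.add_re, Complex.one_re]
    linarith
  have : DifferentiableAt ℂ (fun z : ℂ => z ^ k * Complex.log (1 + z) ^ m) z :=
    (differentiableAt_id.pow k).mul (((differentiableAt_id.const_add 1).clog h1).pow m)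
  exact this.differentiableWithinAt

/-- The function z^k log(1 + z)^m is analytic in the unit disc and vanishes at 0, so its averages
over circles of radius r < 1 are zero. Dominated convergence then gives r → 1. -/
lemma cayley_moment {k m : ℕ} (hm : m ≤ 2) (hkm : k + m ≠ 0) :
    Integrable (fun x => cayley x ^ k * Complex.log (1 + cayley x) ^ m) (law cauchyParam) ∧
      ∫ x, cayley x ^ k * Complex.log (1 + cayley x) ^ m ∂(law cauchyParam) = 0 := by
  set D : ℝ → ℝ := fun x => (13 * (1 + |x|) ^ (1 / 8 : ℝ)) ^ 2 with hD
  have hDi : Integrable D (law cauchyParam) := by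
    refine integrable_law_of_le_rpow (K := 169) (r := 1 / 4) ?_ (by norm_num) fun x => ?_
    · exact Measurable.aestronglyMeasurable (by fun_prop)
    · simp only [hD]
      rw [abs_of_nonneg (by positivity), mul_pow, ← Real.rpow_natCast (_ ^ (1 / 8 : ℝ)),
        ← Real.rpow_mul (by positivity)]
      norm_num
  have hb : ∀ r : ℝ, 0 ≤ r → r ≤ 1 → ∀ x,
      ‖(r * cayley x) ^ k * Complex.log (1 + r * cayley x) ^ m‖ ≤ D x := by
    intro r hr hr1 x
    have h1 := norm_log_one_add_mul_cayley_le hr hr1 x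
    have hone : 1 ≤ (1 + |x|) ^ (1 / 8 : ℝ) :=
      Real.one_le_rpow (by linarith [abs_nonneg x]) (by norm_num)
    rw [norm_mul, norm_pow, norm_pow, norm_mul, norm_cayley, Complex.norm_of_nonneg hr, mul_one]
    calc _ ≤ 1 * (13 * (1 + |x|) ^ (1 / 8 : ℝ)) ^ m := by
          gcongr
          exact pow_le_one₀ hr hr1
      _ ≤ _ := by
          rw [one_mul]
          exact pow_le_pow_right₀ (by linarith) hm
  have hmeas : ∀ r : ℝ, AEStronglyMeasurable
      (fun x => (r * cayley x) ^ k * Complex.log (1 + r * cayley x) ^ m) (law cauchyParam) := by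
    intro r
    have := continuous_cayley.measurable
    exact Measurable.aestronglyMeasurable (by fun_prop)
  have hi : Integrable (fun x => cayley x ^ k * Complex.log (1 + cayley x) ^ m) (law cauchyParam) := by
    have h1 := hb 1 zero_le_one le_rfl
    have h2 := hmeas 1
    simp only [Complex.ofReal_one, one_mul] at h1 h2
    exact hDi.mono' h2 (ae_of_all _ h1)
  refine ⟨hi, ?_⟩
  have hlim : Tendsto (fun r : ℝ => ∫ x, (r * cayley x) ^ k * Complex.log (1 + r * cayley x) ^ m
      ∂(law cauchyParam)) (𝓝[<] 1)
      (𝓝 (∫ x, cayley x ^ k * Complex.log (1 + cayley x) ^ m ∂(law cauchyParam))) := by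
    refine tendsto_integral_filter_of_dominated_convergence D (Eventually.of_forall hmeas) ?_ hDi ?_
    · filter_upwards [Ioo_mem_nhdsLT (show (0 : ℝ) < 1 by norm_num)] with r hr
      exact ae_of_all _ (hb r hr.1.le hr.2.le)
    · refine ae_of_all _ fun x => ?_
      have hc : ContinuousAt (fun r : ℝ => ((r : ℂ) * cayley x) ^ k *
          Complex.log (1 + r * cayley x) ^ m) 1 := by
        have h1 : ContinuousAt (fun r : ℝ => (r : ℂ) * cayley x) 1 := by fun_prop
        refine (h1.pow k).mul (((continuousAt_const.add h1).clog ?_).pow m)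
        simpa using one_add_cayley_mem_slitPlane x
      have := hc.tendsto.mono_left (nhdsWithin_le_nhds (s := Set.Iio 1))
      simpa only [Complex.ofReal_one, one_mul] using this
  refine tendsto_nhds_unique hlim (tendsto_const_nhds.congr' ?_)
  filter_upwards [Ioo_mem_nhdsLT (show (0 : ℝ) < 1 by norm_num)] with r hr
  rw [integral_law_circle hr.1 (diffContOnCl_pow_mul_log_pow k m hr.2)]
  rcases Nat.eq_zero_or_pos k with h | h
  · have : m ≠ 0 := by omega
    simp [this]
  · simp [h.ne']

/-- Integrable functions with mean zero under the standard Cauchy law. -/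
def CauchyCentered (g : ℝ → ℝ) : Prop :=
  Integrable g (law cauchyParam) ∧ ∫ x, g x ∂(law cauchyParam) = 0

lemma CauchyCentered.add {g h : ℝ → ℝ} (hg : CauchyCentered g) (hh : CauchyCentered h) :
    CauchyCentered fun x => g x + h x :=
  ⟨hg.1.add hh.1, by rw [integral_add hg.1 hh.1, hg.2, hh.2, add_zero]⟩

lemma CauchyCentered.const_mul {g : ℝ → ℝ} (c : ℝ) (hg : CauchyCentered g) :
    CauchyCentered fun x => c * g x :=
  ⟨hg.1.const_mul c, by rw [integral_const_mul, hg.2, mul_zero]⟩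

lemma cauchyCentered_re {k m : ℕ} (hm : m ≤ 2) (hkm : k + m ≠ 0) :
    CauchyCentered fun x => (cayley x ^ k * Complex.log (1 + cayley x) ^ m).re := by
  obtain ⟨h1, h2⟩ := cayley_moment hm hkm
  refine ⟨h1.re, ?_⟩
  have := Complex.reCLM.integral_comp_comm h1
  rw [h2] at this
  simpa using this

lemma cauchyCentered_im {k m : ℕ} (hm : m ≤ 2) (hkm : k + m ≠ 0) :
    CauchyCentered fun x => (cayley x ^ k * Complex.log (1 + cayley x) ^ m).im := by
  obtain ⟨h1, h2⟩ := cayley_moment hm hkm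
  refine ⟨h1.im, ?_⟩
  have := Complex.imCLM.integral_comp_comm h1
  rw [h2] at this
  simpa using this

/-- Under the Cauchy law arctan x is uniform on (-π/2, π/2). This is the one moment in the
information matrix that the mean value property does not supply. -/
lemma cauchyCentered_arctan_sq : CauchyCentered fun x => Real.arctan x ^ 2 - Real.pi ^ 2 / 12 := by
  have hi : Integrable (fun x => Real.arctan x ^ 2) (law cauchyParam) := by
    refine integrable_law_of_le_rpow (K := 4) (r := 0)
      (Real.continuous_arctan.pow 2).aestronglyMeasurable (by norm_num) fun x => ?_
    rw [abs_of_nonneg (sq_nonneg _), Real.rpow_zero, mul_one, ← sq_abs]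
    have h1 : |Real.arctan x| ≤ 2 := abs_le.2
      ⟨by linarith [Real.neg_pi_div_two_lt_arctan x, Real.pi_le_four],
        by linarith [Real.arctan_lt_pi_div_two x, Real.pi_le_four]⟩
    nlinarith [abs_nonneg (Real.arctan x)]
  refine ⟨hi.sub (integrable_const _), ?_⟩
  rw [integral_sub hi (integrable_const _), integral_const, probReal_univ, one_smul,
    integral_law_eq_integral_tan]
  have : ∫ φ in Set.Ioo (-(Real.pi / 2)) (Real.pi / 2), Real.arctan (Real.tan φ) ^ 2 =
      ∫ φ in Set.Ioo (-(Real.pi / 2)) (Real.pi / 2), φ ^ 2 :=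
    setIntegral_congr_fun measurableSet_Ioo fun φ hφ => by
      simp only [Real.arctan_tan hφ.1 hφ.2]
  rw [this, ← integral_Ioc_eq_integral_Ioo,
    ← intervalIntegral.integral_of_le (by linarith [Real.pi_pos]), integral_pow, smul_eq_mul]
  have := Real.pi_pos
  field_simp
  ring

/-- The Fisher information matrix of the symmetric stable family at the Cauchy parameter. -/
def cauchyInfo : Matrix (Fin 3) (Fin 3) ℝ :=
  !![1 / 2, 0, 0;
     0, 1 / 2, (1 - Real.eulerMascheroniConstant - Real.log 2) / 2;
     0, (1 - Real.eulerMascheroniConstant - Real.log 2) / 2,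
       (Real.pi ^ 2 / 6 + (Real.eulerMascheroniConstant + Real.log 2 - 1) ^ 2) / 2]

/-- Put w = `cayley x` and L = log(1 + w) = l + it. The scores are Im w, -Re w and Re(w(c - L)). As
|w| = 1, their products are constants plus real or imaginary parts of w^k L^m, all of mean zero. In
the last entry |c - L|² also appears, and l² + t² = Re(L²) + 2t² leaves t² = arctan² x, the source
of π²/12. -/
lemma cauchyCentered_score_mul_score (i j : Fin 3) :
    CauchyCentered fun x => cauchyScore i x * cauchyScore j x - cauchyInfo i j := by
  have R20 := cauchyCentered_re (k := 2) (m := 0) (by norm_num) (by norm_num)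
  have I20 := cauchyCentered_im (k := 2) (m := 0) (by norm_num) (by norm_num)
  have R01 := cauchyCentered_re (k := 0) (m := 1) (by norm_num) (by norm_num)
  have I01 := cauchyCentered_im (k := 0) (m := 1) (by norm_num) (by norm_num)
  have R21 := cauchyCentered_re (k := 2) (m := 1) (by norm_num) (by norm_num)
  have I21 := cauchyCentered_im (k := 2) (m := 1) (by norm_num) (by norm_num)
  have R02 := cauchyCentered_re (k := 0) (m := 2) (by norm_num) (by norm_num)
  have R22 := cauchyCentered_re (k := 2) (m := 2) (by norm_num) (by norm_num)
  have T := cauchyCentered_arctan_sq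
  set c : ℝ := Real.log 2 - 1 + Real.eulerMascheroniConstant with hc
  have s0 : ∀ x, cauchyScore 0 x = (cayley x).im := fun x => by
    rw [cayley_im]; simp [cauchyScore, add_comm]
  have s1 : ∀ x, cauchyScore 1 x = -(cayley x).re := fun x => by
    rw [cayley_re]; simp [cauchyScore, add_comm, ← neg_div]
  have hl : ∀ x, (Complex.log (1 + cayley x)).re = Real.log 2 - 1 / 2 * Real.log (x ^ 2 + 1) :=
    fun x => by
      rw [log_one_add_cayley]
      simp only [Complex.add_re, Complex.ofReal_re, Complex.mul_re, Complex.I_re, Complex.I_im,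
        Complex.ofReal_im]
      ring
  have ht : ∀ x, (Complex.log (1 + cayley x)).im = Real.arctan x := fun x => by
      rw [log_one_add_cayley]
      simp only [Complex.add_im, Complex.ofReal_re, Complex.mul_im, Complex.I_re, Complex.I_im,
        Complex.ofReal_im]
      ring
  have s2 : ∀ x, cauchyScore 2 x = (cayley x).re * (c - (Complex.log (1 + cayley x)).re) +
      (cayley x).im * (Complex.log (1 + cayley x)).im := fun x => by
    rw [hl, ht, cayley_re, cayley_im, hc]
    simp only [cauchyScore, Matrix.cons_val, add_comm (x ^ 2) 1]
    ring
  have hsq := cayley_re_sq_add_im_sq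
  have h00 : CauchyCentered fun x => cauchyScore 0 x * cauchyScore 0 x - cauchyInfo 0 0 := by
    convert R20.const_mul (-(1 / 2)) using 2 with x
    rw [s0]
    simp [cauchyInfo, pow_two]
    linear_combination 1 / 2 * hsq x
  have h01 : CauchyCentered fun x => cauchyScore 0 x * cauchyScore 1 x - cauchyInfo 0 1 := by
    convert I20.const_mul (-(1 / 2)) using 2 with x
    rw [s0, s1]
    simp [cauchyInfo, pow_two]
    ring
  have h11 : CauchyCentered fun x => cauchyScore 1 x * cauchyScore 1 x - cauchyInfo 1 1 := by
    convert R20.const_mul (1 / 2) using 2 with x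
    rw [s1]
    simp [cauchyInfo, pow_two]
    linear_combination 1 / 2 * hsq x
  have h02 : CauchyCentered fun x => cauchyScore 0 x * cauchyScore 2 x - cauchyInfo 0 2 := by
    convert ((I20.const_mul (c / 2)).add (I21.const_mul (-(1 / 2)))).add (I01.const_mul (1 / 2))
      using 2 with x
    rw [s0, s2]
    simp [cauchyInfo, pow_two]
    generalize (Complex.log (1 + cayley x)).im = t
    linear_combination t / 2 * hsq x
  have h12 : CauchyCentered fun x => cauchyScore 1 x * cauchyScore 2 x - cauchyInfo 1 2 := by
    convert ((R20.const_mul (-(c / 2))).add (R21.const_mul (1 / 2))).add (R01.const_mul (1 / 2))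
      using 2 with x
    rw [s1, s2]
    simp [cauchyInfo, pow_two, hc]
    generalize (Complex.log (1 + cayley x)).re = t
    linear_combination (t / 2 - (Real.log 2 - 1 + Real.eulerMascheroniConstant) / 2) * hsq x
  have h22 : CauchyCentered fun x => cauchyScore 2 x * cauchyScore 2 x - cauchyInfo 2 2 := by
    convert ((((R01.const_mul (-c)).add (R02.const_mul (1 / 2))).add T).add
      (R20.const_mul (c ^ 2 / 2))).add ((R21.const_mul (-c)).add (R22.const_mul (1 / 2)))
      using 2 with x
    rw [s2, ← ht]
    simp [cauchyInfo, pow_two, hc]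
    generalize (Complex.log (1 + cayley x)).re = l
    generalize (Complex.log (1 + cayley x)).im = t
    linear_combination (((Real.log 2 - 1 + Real.eulerMascheroniConstant) - l) ^ 2 + t ^ 2) / 2 * hsq x
  have symm : ∀ i j, (CauchyCentered fun x => cauchyScore i x * cauchyScore j x - cauchyInfo i j) →
      cauchyInfo i j = cauchyInfo j i →
      CauchyCentered fun x => cauchyScore j x * cauchyScore i x - cauchyInfo j i := by
    intro i j h e
    simpa only [mul_comm, e] using h
  fin_cases i <;> fin_cases j
  · exact h00
  · exact h01
  · exact h02
  · exact symm 0 1 h01 rfl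
  · exact h11
  · exact h12
  · exact symm 0 2 h02 rfl
  · exact symm 1 2 h12 rfl
  · exact h22

section
variable {f₁ : Fin 3 → Param → ℝ → ℝ} {f₂ : Fin 3 → Fin 3 → Param → ℝ → ℝ}
  {f₃ : Fin 3 → Fin 3 → Fin 3 → Param → ℝ → ℝ} {C : ℝ}

lemma measurable_cauchyScore (i : Fin 3) : Measurable (cauchyScore i) := by
  have : Measurable Real.arctan := Real.measurable_arctan
  fin_cases i <;> simp only [Fin.zero_eta, Fin.mk_one, Fin.reduceFinMk] <;> unfold cauchyScore <;>
    simp only [Matrix.cons_val_zero, Matrix.cons_val_one, Matrix.cons_val] <;> fun_prop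

lemma integrable_score_mul_score (i j : Fin 3) :
    Integrable (fun x => cauchyScore i x * cauchyScore j x) (law cauchyParam) ∧
      ∫ x, cauchyScore i x * cauchyScore j x ∂(law cauchyParam) = cauchyInfo i j := by
  obtain ⟨h1, h2⟩ := cauchyCentered_score_mul_score i j
  have h3 : Integrable (fun x => cauchyScore i x * cauchyScore j x) (law cauchyParam) := by
    refine (h1.add (integrable_const (cauchyInfo i j))).congr (ae_of_all _ fun x => ?_)
    simp
  refine ⟨h3, ?_⟩
  rw [integral_sub h3 (integrable_const _), integral_const, probReal_univ, one_smul] at h2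
  linarith

lemma memLp_cauchyScore (i : Fin 3) : MemLp (cauchyScore i) 2 (law cauchyParam) := by
  rw [memLp_two_iff_integrable_sq (measurable_cauchyScore i).aestronglyMeasurable]
  simpa only [pow_two] using (integrable_score_mul_score i i).1

lemma integral_cauchyScore (i : Fin 3) : ∫ x, cauchyScore i x ∂(law cauchyParam) = 0 := by
  obtain ⟨f₁, f₂, f₃, C, D, hf₁⟩ := exists_densityDerivs
  rw [integral_law_cauchyParam, ← (D.integral_eq_zero.1 i).2]
  refine integral_congr_ae (ae_of_all _ fun x => ?_)
  simp only
  rw [← logGrad_cauchyParam hf₁, logGrad, mul_div_cancel₀ _ (density_cauchyParam_pos x).ne']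

/-- The information identity: after multiplication by the density, the Hessian of its logarithm is
the second derivative, of integral zero, minus the density times a product of scores. -/
lemma DensityDerivs.integral_logHess (D : DensityDerivs f₁ f₂ f₃ C)
    (hf₁ : ∀ i θ x, f₁ i θ x = 1 / Real.pi * (kernIntGrad 0 0 0 x θ i).re) (i j : Fin 3) :
    ∫ x, logHess f₁ f₂ i j cauchyParam x ∂(law cauchyParam) = -cauchyInfo i j := by
  obtain ⟨h1, h2⟩ := integrable_score_mul_score i j
  obtain ⟨h3, h4⟩ := D.integral_eq_zero.2 i j
  rw [integral_law_cauchyParam] at h2 ⊢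
  rw [integrable_law_cauchyParam_iff] at h1
  rw [← h2, ← zero_sub, ← h4, ← integral_sub h3 h1]
  refine integral_congr_ae (ae_of_all _ fun x => ?_)
  simp only
  rw [← logGrad_cauchyParam hf₁, ← logGrad_cauchyParam hf₁, logHess, logGrad, logGrad, mul_sub,
    mul_div_cancel₀ _ (density_cauchyParam_pos x).ne']

end

lemma cauchyInfo_symm (i j : Fin 3) : cauchyInfo i j = cauchyInfo j i := by
  fin_cases i <;> fin_cases j <;> rfl

lemma fisherInfo_cauchyParam : fisherInfo cauchyParam = cauchyInfo := by
  obtain ⟨f₁, f₂, f₃, C, D, hf₁⟩ := exists_densityDerivs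
  obtain ⟨r, K, L⟩ := D.logDensityDerivs
  ext i j
  rw [fisherInfo, Matrix.of_apply, integral_congr_ae (ae_of_all _ fun x => L.logDensityHess_eq x i j),
    D.integral_logHess hf₁, neg_neg, cauchyInfo_symm]

/-- The terms with γ and log 2 cancel and the determinant is π²/48. -/
lemma isUnit_det_cauchyInfo : IsUnit cauchyInfo.det := by
  rw [isUnit_iff_ne_zero, Matrix.det_fin_three]
  simp only [cauchyInfo, Matrix.of_apply, Matrix.cons_val', Matrix.cons_val_zero,
    Matrix.cons_val_one, Matrix.cons_val, Matrix.cons_val_fin_one]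
  ring_nf
  positivity

/-! ### Consistency of the maximum likelihood estimators -/

lemma continuous_density {θ : Param} (hσ : 0 < θ 1) (hα : 0 < θ 2) : Continuous (density θ) := by
  unfold density
  refine continuous_const.mul (Complex.continuous_re.comp ?_)
  refine continuous_of_dominated (bound := fun t => ‖charFn θ t‖) (fun x => ?_) (fun x => ?_)
    (integrable_charFn' hσ hα).norm (ae_of_all _ fun t => by fun_prop)
  · exact (Measurable.aestronglyMeasurable (by fun_prop)).mul
      (measurable_charFn θ).aestronglyMeasurable
  · refine ae_of_all _ fun t => ?_
    rw [norm_mul, Complex.norm_exp]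
    simp

lemma one_div_density_cauchyParam_le (x : ℝ) : 1 / density cauchyParam x ≤ 4 * (1 + |x|) ^ 2 := by
  rw [density_cauchyParam]
  have h4 : x ^ 2 = |x| ^ 2 := (sq_abs x).symm
  have h5 := Real.pi_le_four
  have h6 := Real.pi_pos
  rw [one_div_mul_one_div, one_div_one_div, h4]
  nlinarith [abs_nonneg x, mul_nonneg (sub_nonneg.2 h5) (sq_nonneg |x|)]

section
variable {Ω : Type*} [MeasurableSpace Ω] {P : Measure Ω} {X : ℕ → Ω → ℝ}

/-- With probability tending to one, no parameter in `A` has a likelihood that reaches that of the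
Cauchy parameter. -/
def Excluded (P : Measure Ω) (X : ℕ → Ω → ℝ) (A : Set Param) : Prop :=
  Tendsto (fun n => P {ω | ∃ θ ∈ A,
    1 ≤ ∏ j ∈ Finset.range n, (density θ (X j ω) / density cauchyParam (X j ω))}) atTop (𝓝 0)

lemma Excluded.mono {A B : Set Param} (hB : Excluded P X B) (h : A ⊆ B) : Excluded P X A :=
  tendsto_of_tendsto_of_tendsto_of_le_of_le tendsto_const_nhds hB (fun _ => zero_le)
    fun _ => measure_mono fun _ ⟨θ, hθ, h1⟩ => ⟨θ, h hθ, h1⟩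

lemma Excluded.union {A B : Set Param} (hA : Excluded P X A) (hB : Excluded P X B) :
    Excluded P X (A ∪ B) := by
  have h := hA.add hB
  rw [add_zero] at h
  refine tendsto_of_tendsto_of_tendsto_of_le_of_le tendsto_const_nhds h (fun _ => zero_le) fun n =>
    (measure_mono ?_).trans (measure_union_le _ _)
  rintro ω ⟨θ, hθ | hθ, h1⟩
  · exact Or.inl ⟨θ, hθ, h1⟩
  · exact Or.inr ⟨θ, hθ, h1⟩

lemma excluded_empty : Excluded P X ∅ := by simp [Excluded]

variable (hX : ∀ j, HasLaw (X j) (law cauchyParam) P) (hI : iIndepFun X P)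

include hX hI in
-- Markov's inequality and independence bound the probability by the n-th power of the mean.
-- Measurable versions are used because each X j is only almost everywhere measurable.
lemma tendsto_measure_one_le_prod_ennreal {G : ℝ → ENNReal} (hG : Measurable G)
    (h : ∫⁻ x, G x ∂(law cauchyParam) < 1) :
    Tendsto (fun n => P {ω | 1 ≤ ∏ j ∈ Finset.range n, G (X j ω)}) atTop (𝓝 0) := by
  have hae : ∀ j, X j =ᵐ[P] (hX j).aemeasurable.mk (X j) := fun j => (hX j).aemeasurable.ae_eq_mk
  have hm : ∀ j, Measurable ((hX j).aemeasurable.mk (X j)) := fun j => (hX j).aemeasurable.measurable_mk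
  have hI' := (hI.congr hae).comp (fun _ => G) fun _ => hG
  have hle : ∀ n, P {ω | 1 ≤ ∏ j ∈ Finset.range n, G (X j ω)} ≤ (∫⁻ x, G x ∂(law cauchyParam)) ^ n := by
    intro n
    have h1 : P {ω | 1 ≤ ∏ j ∈ Finset.range n, G (X j ω)} ≤
        P {ω | 1 ≤ ∏ j ∈ Finset.range n, G ((hX j).aemeasurable.mk (X j) ω)} := by
      refine measure_mono_ae ?_
      filter_upwards [ae_all_iff.2 hae] with ω hω h
      change 1 ≤ _
      have h' : 1 ≤ ∏ j ∈ Finset.range n, G (X j ω) := h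
      simpa only [hω] using h'
    have h2 := mul_meas_ge_le_lintegral₀ (μ := P) (f := fun ω => ∏ j ∈ Finset.range n,
      G ((hX j).aemeasurable.mk (X j) ω))
      (Finset.measurable_fun_prod _ fun j _ => hG.comp (hm j)).aemeasurable 1
    rw [one_mul] at h2
    refine h1.trans (h2.trans_eq ?_)
    have h3 := lintegral_prod_eq_prod_lintegral_of_indepFun (Finset.range n) _ hI'
      fun j => hG.comp (hm j)
    refine h3.trans ?_
    rw [Finset.prod_congr rfl fun j _ => ?_, Finset.prod_const, Finset.card_range]
    have e1 := lintegral_map (μ := P) hG (hm j)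
    rw [← Measure.map_congr (hae j), (hX j).map_eq] at e1
    exact e1.symm
  exact tendsto_of_tendsto_of_tendsto_of_le_of_le tendsto_const_nhds
    (ENNReal.tendsto_pow_atTop_nhds_zero_of_lt_one h) (fun _ => zero_le) hle

include hX hI in
-- A product is at least 1 only if its t-th power is. A small t makes the mean finite although `G`
-- itself may have none under the heavy-tailed law.
lemma tendsto_measure_one_le_prod {G : ℝ → ℝ} {t : ℝ} (ht : 0 < t) (h0 : ∀ x, 0 ≤ G x)
    (hG : Measurable G) (hi : Integrable (fun x => G x ^ t) (law cauchyParam))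
    (h : ∫ x, G x ^ t ∂(law cauchyParam) < 1) :
    Tendsto (fun n => P {ω | 1 ≤ ∏ j ∈ Finset.range n, G (X j ω)}) atTop (𝓝 0) := by
  have h1 : ∫⁻ x, ENNReal.ofReal (G x ^ t) ∂(law cauchyParam) < 1 := by
    rw [← ofReal_integral_eq_lintegral_ofReal hi (ae_of_all _ fun x => Real.rpow_nonneg (h0 x) t)]
    rwa [ENNReal.ofReal_lt_one]
  refine tendsto_of_tendsto_of_tendsto_of_le_of_le tendsto_const_nhds
    (tendsto_measure_one_le_prod_ennreal hX hI (hG.pow_const t).ennreal_ofReal h1)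
    (fun _ => zero_le) fun n => measure_mono fun ω hω => ?_
  have hω' : 1 ≤ ∏ j ∈ Finset.range n, G (X j ω) := hω
  change 1 ≤ ∏ j ∈ Finset.range n, ENNReal.ofReal (G (X j ω) ^ t)
  rw [← ENNReal.ofReal_prod_of_nonneg fun j _ => Real.rpow_nonneg (h0 _) t,
    Real.finsetProd_rpow _ _ fun j _ => h0 _, ENNReal.one_le_ofReal]
  exact Real.one_le_rpow hω' ht.le

lemma excluded_of_le {A : Set Param} {G : ℝ → ℝ}
    (hA : ∀ θ ∈ A, ∀ x, 0 ≤ density θ x) (hle : ∀ θ ∈ A, ∀ x, density θ x / density cauchyParam x ≤ G x)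
    (h : Tendsto (fun n => P {ω | 1 ≤ ∏ j ∈ Finset.range n, G (X j ω)}) atTop (𝓝 0)) :
    Excluded P X A := by
  refine tendsto_of_tendsto_of_tendsto_of_le_of_le tendsto_const_nhds h (fun _ => zero_le)
    fun n => measure_mono ?_
  rintro ω ⟨θ, hθ, h1⟩
  exact h1.trans (Finset.prod_le_prod
    (fun j _ => div_nonneg (hA θ hθ _) (density_cauchyParam_pos _).le) fun j _ => hle θ hθ _)

include hX hI in
-- The ratio grows at most like (1 + |x|)³, so its fourth root has exponent 3/4 < 1 and is
-- integrable. Any set of densities below δ(1 + |x|) can therefore be excluded.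
lemma exists_tendsto_measure_linear : ∃ δ : ℝ, 0 < δ ∧ Tendsto (fun n => P {ω |
    1 ≤ ∏ j ∈ Finset.range n, (δ * (1 + |X j ω|) / density cauchyParam (X j ω))}) atTop (𝓝 0) := by
  have hi : Integrable (fun x : ℝ => (1 + |x|) ^ (3 / 4 : ℝ)) (law cauchyParam) :=
    integrable_law_of_le_rpow (K := 1) (r := 3 / 4)
      (Measurable.aestronglyMeasurable (by fun_prop)) (by norm_num) fun x => by
        rw [abs_of_nonneg (by positivity), one_mul]
  set J := ∫ x : ℝ, (1 + |x|) ^ (3 / 4 : ℝ) ∂(law cauchyParam) with hJ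
  have hJ0 : 0 ≤ J := integral_nonneg fun x => by positivity
  -- Makes (4δ)^(1/4) = 1/(2(J + 1)), so that the mean of the fourth root is at most 1/2.
  set δ : ℝ := 1 / 4 * (1 / (2 * (J + 1))) ^ (4 : ℕ) with hδ
  have hδ0 : 0 < δ := by positivity
  refine ⟨δ, hδ0, ?_⟩
  have hle : ∀ x : ℝ, δ * (1 + |x|) / density cauchyParam x ≤ 4 * δ * (1 + |x|) ^ 3 := fun x => by
    have h1 := one_div_density_cauchyParam_le x
    calc _ = δ * (1 + |x|) * (1 / density cauchyParam x) := by ring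
      _ ≤ δ * (1 + |x|) * (4 * (1 + |x|) ^ 2) := by gcongr
      _ = _ := by ring
  have h2 : Tendsto (fun n => P {ω | 1 ≤ ∏ j ∈ Finset.range n, (4 * δ * (1 + |X j ω|) ^ 3)})
      atTop (𝓝 0) := by
    have he : (fun x : ℝ => (4 * δ * (1 + |x|) ^ 3) ^ (1 / 4 : ℝ)) =
        fun x => 1 / (2 * (J + 1)) * (1 + |x|) ^ (3 / 4 : ℝ) := by
      ext x
      rw [hδ, Real.mul_rpow (by positivity) (by positivity), ← Real.rpow_natCast (1 + |x|),
        ← Real.rpow_mul (by positivity), ← mul_assoc, mul_one_div_cancel (by norm_num), one_mul,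
        ← Real.rpow_natCast (1 / (2 * (J + 1))), ← Real.rpow_mul (by positivity)]
      norm_num
    refine tendsto_measure_one_le_prod hX hI (G := fun x => 4 * δ * (1 + |x|) ^ 3) (t := 1 / 4)
      (by norm_num) (fun x => by positivity)
      (by fun_prop) ?_ ?_
    · rw [he]; exact hi.const_mul _
    · rw [he, integral_const_mul, ← hJ, one_div_mul_eq_div, div_lt_one (by positivity)]
      linarith
  refine tendsto_of_tendsto_of_tendsto_of_le_of_le tendsto_const_nhds h2 (fun _ => zero_le)
    fun n => measure_mono fun ω hω => ?_
  have hω' : 1 ≤ ∏ j ∈ Finset.range n, (δ * (1 + |X j ω|) / density cauchyParam (X j ω)) := hω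
  exact hω'.trans (Finset.prod_le_prod (fun j _ => div_nonneg (by positivity)
    (density_cauchyParam_pos _).le) fun j _ => hle _)

include hX hI in
-- An exponential Chebyshev bound with G = exp(1_I - p). Its mean is e^(-p)(1 + (e - 1)P(I)), which
-- is below 1 since e - 1 < 3 and 1 + p < e^p.
lemma tendsto_measure_count {p : ℝ} (hp : 0 < p) {I : Set ℝ} (hIm : MeasurableSet I)
    (h : (law cauchyParam).real I ≤ p / 3) :
    Tendsto (fun n : ℕ => P {ω | p * n ≤ ∑ j ∈ Finset.range n, I.indicator (fun _ => (1 : ℝ)) (X j ω)})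
      atTop (𝓝 0) := by
  have hmeas : Measurable (I.indicator fun _ => (1 : ℝ)) := measurable_const.indicator hIm
  have hI1 : Integrable (I.indicator fun _ => (1 : ℝ)) (law cauchyParam) :=
    (integrable_const 1).indicator hIm
  have he : ∀ x, Real.exp (I.indicator (fun _ => (1 : ℝ)) x - p) =
      Real.exp (-p) * (1 + (Real.exp 1 - 1) * I.indicator (fun _ => (1 : ℝ)) x) := fun x => by
    by_cases hx : x ∈ I
    · simp only [Set.indicator_of_mem hx]; rw [sub_eq_add_neg, Real.exp_add]; ring
    · simp only [Set.indicator_of_notMem hx]; rw [zero_sub]; ring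
  have hi2 : Integrable (fun x => 1 + (Real.exp 1 - 1) * I.indicator (fun _ => (1 : ℝ)) x)
      (law cauchyParam) := (integrable_const 1).add (hI1.const_mul _)
  have h1 := tendsto_measure_one_le_prod hX hI
    (G := fun x => Real.exp (I.indicator (fun _ => (1 : ℝ)) x - p)) (t := 1) one_pos
    (fun x => (Real.exp_pos _).le) (by fun_prop) (by
      simp only [Real.rpow_one, he]
      exact hi2.const_mul _) (by
      simp only [Real.rpow_one, he]
      rw [integral_const_mul, integral_add (integrable_const 1) (hI1.const_mul _),
        integral_const_mul, integral_const, probReal_univ, integral_indicator hIm,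
        integral_const, one_smul, measureReal_restrict_apply_univ, smul_eq_mul, mul_one,
        Real.exp_neg, inv_mul_lt_one₀ (Real.exp_pos _)]
      have h2 := Real.add_one_lt_exp hp.ne'
      have h3 := Real.exp_one_lt_d9
      have h4 : 0 ≤ (law cauchyParam).real I := measureReal_nonneg
      nlinarith)
  refine tendsto_of_tendsto_of_tendsto_of_le_of_le tendsto_const_nhds h1 (fun _ => zero_le)
    fun n => measure_mono fun ω hω => ?_
  have hω' : p * n ≤ ∑ j ∈ Finset.range n, I.indicator (fun _ => (1 : ℝ)) (X j ω) := hω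
  change 1 ≤ ∏ j ∈ Finset.range n, Real.exp (I.indicator (fun _ => (1 : ℝ)) (X j ω) - p)
  rw [← Real.exp_sum, Real.one_le_exp_iff, Finset.sum_sub_distrib, Finset.sum_const,
    Finset.card_range, nsmul_eq_mul]
  linarith

include hX hI in
-- An observation near the location contributes at most C/σ, any other at most a constant times σ^ε.
-- If fewer than pn observations fall in `I`, where p = ε/(2(1 + ε)), the exponent of σ is at least
-- (ε - (1 + ε)p)n = εn/2, so the likelihood is at most (BD σ^(ε/2))^n. The threshold `s` depends on
-- τ but not on `I` or `S`, which makes it usable for all pieces of a cover.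
lemma exists_excluded_small_scale {ε τ : ℝ} (hε : 0 < ε) (hτ : 0 < τ) (hτ1 : τ ≤ 1) :
    ∃ s : ℝ, 0 < s ∧ ∀ (I S : Set ℝ), MeasurableSet I →
      (law cauchyParam).real I ≤ ε / (2 * (1 + ε)) / 3 → (∀ μ ∈ S, ∀ x, x ∉ I → τ ≤ |x - μ|) →
      Excluded P X {θ | θ ∈ paramSpace ε ∧ θ 1 ≤ s ∧ θ 0 ∈ S} := by
  obtain ⟨C, hC, hCb⟩ := abs_density_le_inv hε
  obtain ⟨δ, hδ, hlin⟩ := exists_tendsto_measure_linear hX hI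
  set B : ℝ := max 1 C with hB
  set D : ℝ := 500 * τ ^ (-3 : ℝ) with hD
  have hB1 : 1 ≤ B := le_max_left _ _
  have hτ3 : 1 ≤ τ ^ (-3 : ℝ) := Real.one_le_rpow_of_pos_of_le_one_of_nonpos hτ hτ1 (by norm_num)
  have hD1 : 1 ≤ D := by rw [hD]; linarith
  set s : ℝ := min 1 ((δ / (B * D)) ^ (2 / ε)) with hs
  have hBD : 0 < B * D := by positivity
  have hs0 : 0 < s := lt_min one_pos (by positivity)
  have hs1 : s ≤ 1 := min_le_left _ _
  have hsδ : B * D * s ^ (ε / 2) ≤ δ := by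
    have : s ^ (ε / 2) ≤ ((δ / (B * D)) ^ (2 / ε)) ^ (ε / 2) :=
      Real.rpow_le_rpow hs0.le (min_le_right _ _) (by positivity)
    rw [← Real.rpow_mul (by positivity), div_mul_div_comm, mul_comm 2 ε, div_self (by positivity),
      Real.rpow_one, le_div_iff₀ hBD] at this
    linarith
  refine ⟨s, hs0, fun I S hIm hIp hS => ?_⟩
  have hcount := tendsto_measure_count hX hI (p := ε / (2 * (1 + ε))) (by positivity) hIm hIp
  have hsum := hcount.add hlin
  rw [add_zero] at hsum
  refine tendsto_of_tendsto_of_tendsto_of_le_of_le tendsto_const_nhds hsum (fun _ => zero_le)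
    fun n => (measure_mono ?_).trans (measure_union_le _ _)
  rintro ω ⟨θ, ⟨hθ, hθs, hθS⟩, h1⟩
  obtain ⟨hσ, hα, hα2⟩ := hθ
  by_cases hN : ε / (2 * (1 + ε)) * n ≤ ∑ j ∈ Finset.range n, I.indicator (fun _ => (1 : ℝ)) (X j ω)
  · exact Or.inl hN
  right
  change 1 ≤ ∏ j ∈ Finset.range n, (δ * (1 + |X j ω|) / density cauchyParam (X j ω))
  have hpt : ∀ x, density θ x ≤ B * D * (θ 1) ^ (ε - (1 + ε) * I.indicator (fun _ => (1 : ℝ)) x) := by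
    intro x
    by_cases hx : x ∈ I
    · rw [Set.indicator_of_mem hx, show ε - (1 + ε) * 1 = -1 by ring, Real.rpow_neg_one]
      refine (le_abs_self _).trans ((hCb θ hσ hα hα2 x).trans ?_)
      gcongr
      exact (le_max_right 1 C).trans (le_mul_of_one_le_right (by positivity) hD1)
    · rw [Set.indicator_of_notMem hx, mul_zero, sub_zero]
      have hd := hS _ hθS x hx
      have hne : x ≠ θ 0 := fun h => by rw [h, sub_self, abs_zero] at hd; linarith
      refine (le_abs_self _).trans ((abs_density_le hσ (by linarith) hα2 hne).trans ?_)
      have e1 : θ 1 ^ θ 2 ≤ θ 1 ^ ε := Real.rpow_le_rpow_of_exponent_ge hσ (hθs.trans hs1) hα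
      have e2 : |x - θ 0| ^ (-(1 + θ 2)) ≤ τ ^ (-3 : ℝ) :=
        (Real.rpow_le_rpow_of_nonpos hτ hd (by linarith)).trans
          (Real.rpow_le_rpow_of_exponent_ge hτ hτ1 (by linarith))
      calc _ ≤ 500 * θ 1 ^ ε * τ ^ (-3 : ℝ) := by gcongr
        _ = 1 * D * θ 1 ^ ε := by rw [hD]; ring
        _ ≤ _ := by gcongr
  have hprod : ∏ j ∈ Finset.range n, density θ (X j ω) ≤ δ ^ n := by
    calc _ ≤ ∏ j ∈ Finset.range n, (B * D * (θ 1) ^ (ε - (1 + ε) * I.indicator (fun _ => (1 : ℝ)) (X j ω))) :=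
          Finset.prod_le_prod (fun j _ => density_nonneg hσ (by linarith) hα2 _) fun j _ => hpt _
      _ = (B * D) ^ n * (θ 1) ^ (ε * n - (1 + ε) *
            ∑ j ∈ Finset.range n, I.indicator (fun _ => (1 : ℝ)) (X j ω)) := by
          rw [Finset.prod_mul_distrib, Finset.prod_const, Finset.card_range,
            ← Real.rpow_sum_of_pos hσ, Finset.sum_sub_distrib, ← Finset.mul_sum, Finset.sum_const,
            Finset.card_range, nsmul_eq_mul, mul_comm (n : ℝ)]
      _ ≤ (B * D) ^ n * (θ 1) ^ (ε / 2 * n) := by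
          refine mul_le_mul_of_nonneg_left ?_ (by positivity)
          refine Real.rpow_le_rpow_of_exponent_ge hσ (hθs.trans hs1) ?_
          have := mul_le_mul_of_nonneg_left (not_le.1 hN).le (by positivity : 0 ≤ 1 + ε)
          have e : (1 + ε) * (ε / (2 * (1 + ε)) * n) = ε / 2 * n := by field_simp
          rw [e] at this
          linarith
      _ ≤ (B * D) ^ n * s ^ (ε / 2 * n) := by gcongr
      _ = (B * D * s ^ (ε / 2)) ^ n := by
          rw [mul_pow (B * D), Real.rpow_mul hs0.le, Real.rpow_natCast]
      _ ≤ _ := by gcongr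
  rw [Finset.prod_div_distrib] at h1
  have hf0 : 0 < ∏ j ∈ Finset.range n, density cauchyParam (X j ω) :=
    Finset.prod_pos fun j _ => density_cauchyParam_pos _
  rw [Finset.prod_div_distrib, Finset.prod_mul_distrib, Finset.prod_const, Finset.card_range]
  refine h1.trans ?_
  gcongr
  refine hprod.trans (le_mul_of_one_le_right (by positivity) ?_)
  exact Finset.one_le_prod fun j _ => by linarith [abs_nonneg (X j ω)]
end

section
variable {Ω : Type*} [MeasurableSpace Ω] {P : Measure Ω} {X : ℕ → Ω → ℝ}
variable (hX : ∀ j, HasLaw (X j) (law cauchyParam) P) (hI : iIndepFun X P)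

lemma law_real_Icc_le {a τ : ℝ} (hτ : 0 ≤ τ) :
    (law cauchyParam).real (Set.Icc (a - 2 * τ) (a + 2 * τ)) ≤ 4 * τ := by
  have h1 : law cauchyParam (Set.Icc (a - 2 * τ) (a + 2 * τ)) ≤ ENNReal.ofReal (4 * τ) := by
    rw [law, withDensity_apply _ measurableSet_Icc]
    calc _ ≤ ∫⁻ _ in Set.Icc (a - 2 * τ) (a + 2 * τ), 1 := by
          refine lintegral_mono fun x => ?_
          rw [ENNReal.ofReal_le_one]
          exact (density_cauchyParam_le x).trans
            (Real.rpow_le_one_of_one_le_of_nonpos (by linarith [abs_nonneg x]) (by norm_num))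
      _ = _ := by
          rw [setLIntegral_one, Real.volume_Icc]
          congr 1
          ring
  exact ENNReal.toReal_le_of_le_ofReal (by positivity) h1

include hX hI in
-- Bounded locations are covered by finitely many balls of radius τ, each with the concentric
-- interval of half-length 2τ as `I`; its mass is at most 4τ ≤ p/3. For far locations `I` is a set
-- of large |x|, of mass at most p/3 by Markov's inequality.
lemma exists_excluded_scale_le {ε : ℝ} (hε : 0 < ε) :
    ∃ s : ℝ, 0 < s ∧ Excluded P X {θ | θ ∈ paramSpace ε ∧ θ 1 ≤ s} := by
  set p : ℝ := ε / (2 * (1 + ε)) with hp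
  have hp0 : 0 < p := by positivity
  set τ : ℝ := min 1 (p / 12) with hτ
  have hτ0 : 0 < τ := by positivity
  obtain ⟨s, hs, h⟩ := exists_excluded_small_scale hX hI hε hτ0 (min_le_left _ _)
  refine ⟨s, hs, ?_⟩
  have hi : Integrable (fun x : ℝ => (1 + |x|) ^ (1 / 2 : ℝ)) (law cauchyParam) :=
    integrable_law_of_le_rpow (K := 1) (r := 1 / 2)
      (Measurable.aestronglyMeasurable (by fun_prop)) (by norm_num) fun x => by
        rw [abs_of_nonneg (by positivity), one_mul]
  set J := ∫ x : ℝ, (1 + |x|) ^ (1 / 2 : ℝ) ∂(law cauchyParam) with hJ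
  have hJ0 : 0 ≤ J := integral_nonneg fun x => by positivity
  set c : ℝ := 3 * (J + 1) / p with hc
  have hc0 : 0 < c := by positivity
  have hout : Excluded P X {θ | θ ∈ paramSpace ε ∧ θ 1 ≤ s ∧ θ 0 ∈ {μ | c ^ 2 + 1 < |μ|}} := by
    refine h {x | c ≤ (1 + |x|) ^ (1 / 2 : ℝ)} _ (measurableSet_le measurable_const (by fun_prop)) ?_ ?_
    · have h1 := mul_meas_ge_le_integral_of_nonneg
        (ae_of_all (law cauchyParam) fun x : ℝ => (by positivity : 0 ≤ (1 + |x|) ^ (1 / 2 : ℝ))) hi c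
      rw [← hJ] at h1
      rw [← hp]
      rw [← mul_le_mul_iff_right₀ hc0]
      refine h1.trans ?_
      rw [hc]
      field_simp
      linarith
    · intro μ hμ x hx
      have hμ' : c ^ 2 + 1 < |μ| := hμ
      have hx' : (1 + |x|) ^ (1 / 2 : ℝ) < c := not_le.1 hx
      have h2 : 1 + |x| < c ^ 2 := by
        have h3 : (1 + |x|) = ((1 + |x|) ^ (1 / 2 : ℝ)) ^ 2 := by
          rw [← Real.rpow_natCast, ← Real.rpow_mul (by positivity)]; norm_num
        rw [h3]
        exact pow_lt_pow_left₀ hx' (by positivity) (by norm_num)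
      have h4 := abs_sub_abs_le_abs_sub μ x
      rw [abs_sub_comm x μ]
      have h5 : τ ≤ 1 := min_le_left _ _
      linarith
  have hin : Excluded P X {θ | θ ∈ paramSpace ε ∧ θ 1 ≤ s ∧ θ 0 ∈ Set.Icc (-(c ^ 2 + 1)) (c ^ 2 + 1)} := by
    refine (isCompact_Icc (a := -(c ^ 2 + 1)) (b := c ^ 2 + 1)).induction_on
      (p := fun S => Excluded P X {θ | θ ∈ paramSpace ε ∧ θ 1 ≤ s ∧ θ 0 ∈ S}) ?_ ?_ ?_ ?_
    · refine excluded_empty.mono ?_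
      rintro θ ⟨-, -, h⟩
      exact h
    · exact fun S T hST hT => hT.mono fun θ ⟨h1, h2, h3⟩ => ⟨h1, h2, hST h3⟩
    · refine fun S T hS hT => (hS.union hT).mono ?_
      rintro θ ⟨h1, h2, h3 | h3⟩
      · exact Or.inl ⟨h1, h2, h3⟩
      · exact Or.inr ⟨h1, h2, h3⟩
    · intro a _
      refine ⟨Metric.ball a τ, mem_nhdsWithin_of_mem_nhds (Metric.ball_mem_nhds a hτ0),
        h (Set.Icc (a - 2 * τ) (a + 2 * τ)) _ measurableSet_Icc ?_ ?_⟩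
      · refine (law_real_Icc_le hτ0.le).trans ?_
        have : τ ≤ p / 12 := min_le_right _ _
        linarith
      · intro μ hμ x hx
        rw [Metric.mem_ball, Real.dist_eq, abs_lt] at hμ
        by_contra hlt
        rw [not_le, abs_lt] at hlt
        exact hx ⟨by linarith, by linarith⟩
  refine (hin.union hout).mono ?_
  rintro θ ⟨h1, h2⟩
  rcases le_or_gt |θ 0| (c ^ 2 + 1) with h3 | h3
  · exact Or.inl ⟨h1, h2, abs_le.1 h3⟩
  · exact Or.inr ⟨h1, h2, h3⟩

include hX hI in
lemma exists_excluded_of_le_linear : ∃ δ : ℝ, 0 < δ ∧ ∀ A : Set Param,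
    (∀ θ ∈ A, 0 < θ 1 ∧ 0 < θ 2 ∧ θ 2 ≤ 2) → (∀ θ ∈ A, ∀ x, density θ x ≤ δ * (1 + |x|)) →
    Excluded P X A := by
  obtain ⟨δ, hδ, h⟩ := exists_tendsto_measure_linear hX hI
  refine ⟨δ, hδ, fun A hA hle => excluded_of_le (G := fun x => δ * (1 + |x|) / density cauchyParam x)
    (fun θ hθ x => density_nonneg (hA θ hθ).1 (hA θ hθ).2.1 (hA θ hθ).2.2 x) (fun θ hθ x => ?_) h⟩
  have := density_cauchyParam_pos x
  gcongr
  exact hle θ hθ x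

include hX hI in
lemma exists_excluded_scale_ge {ε : ℝ} (hε : 0 < ε) :
    ∃ S : ℝ, Excluded P X {θ | θ ∈ paramSpace ε ∧ S ≤ θ 1} := by
  obtain ⟨δ, hδ, h⟩ := exists_excluded_of_le_linear hX hI
  obtain ⟨C, hC, hCb⟩ := abs_density_le_inv hε
  refine ⟨C / δ, h _ (fun θ hθ => ⟨hθ.1.1, hε.trans_le hθ.1.2.1, hθ.1.2.2⟩) fun θ hθ x => ?_⟩
  obtain ⟨⟨h1, h2, h3⟩, h4⟩ := hθ
  refine (le_abs_self _).trans ((hCb θ h1 h2 h3 x).trans ?_)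
  have h5 : C * (θ 1)⁻¹ ≤ δ := by
    rw [← div_eq_mul_inv, div_le_comm₀ h1 hδ]; exact h4
  exact h5.trans (le_mul_of_one_le_right hδ.le (by linarith [abs_nonneg x]))

include hX hI in
-- For |x| ≤ M/2 the point is far from the location and the power tail is below δ. For larger |x|
-- the sup bound C/s is at most δM/2 ≤ δ(1 + |x|); this is where the linear growth of the comparison
-- function is needed.
lemma exists_excluded_location_ge {ε s : ℝ} (hε : 0 < ε) (hs : 0 < s) (S : ℝ) :
    ∃ M : ℝ, Excluded P X {θ | θ ∈ paramSpace ε ∧ s ≤ θ 1 ∧ θ 1 ≤ S ∧ M ≤ |θ 0|} := by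
  obtain ⟨δ, hδ, h⟩ := exists_excluded_of_le_linear hX hI
  obtain ⟨C, hC, hCb⟩ := abs_density_le_inv hε
  set S' : ℝ := max 1 S with hS'
  have hS'1 : 1 ≤ S' := le_max_left _ _
  set M : ℝ := 2 + 2 * (C / s) / δ + 2 * (500 * S' ^ (2 : ℝ)) / δ with hM
  have hM0 : 2 ≤ M := by
    have : 0 ≤ 2 * (C / s) / δ + 2 * (500 * S' ^ (2 : ℝ)) / δ := by positivity
    linarith
  refine ⟨M, h _ (fun θ hθ => ⟨hθ.1.1, hε.trans_le hθ.1.2.1, hθ.1.2.2⟩) fun θ hθ x => ?_⟩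
  obtain ⟨⟨h1, h2, h3⟩, h4, h5, h6⟩ := hθ
  refine (le_abs_self _).trans ?_
  rcases le_total |x| (M / 2) with hx | hx
  · have hd : M / 2 ≤ |x - θ 0| := by
      have := abs_sub_abs_le_abs_sub (θ 0) x
      rw [abs_sub_comm]
      linarith
    have hne : x ≠ θ 0 := fun h => by rw [h, sub_self, abs_zero] at hd; linarith
    refine (abs_density_le h1 (by linarith) h3 hne).trans ?_
    have e1 : θ 1 ^ θ 2 ≤ S' ^ (2 : ℝ) :=
      (Real.rpow_le_rpow h1.le (h5.trans (le_max_right _ _)) (by linarith)).trans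
        (Real.rpow_le_rpow_of_exponent_le hS'1 h3)
    have e2 : |x - θ 0| ^ (-(1 + θ 2)) ≤ (M / 2)⁻¹ := by
      rw [← Real.rpow_neg_one]
      exact (Real.rpow_le_rpow_of_nonpos (by linarith) hd (by linarith)).trans
        (Real.rpow_le_rpow_of_exponent_le (by linarith) (by linarith))
    have e3 : 500 * S' ^ (2 : ℝ) * (M / 2)⁻¹ ≤ δ := by
      rw [← div_eq_mul_inv, div_le_comm₀ (by linarith) hδ, le_div_iff₀ two_pos]
      have : 0 ≤ 2 * (C / s) / δ := by positivity
      have e : 500 * S' ^ (2 : ℝ) / δ * 2 = 2 * (500 * S' ^ (2 : ℝ)) / δ := by ring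
      linarith
    calc _ ≤ 500 * S' ^ (2 : ℝ) * (M / 2)⁻¹ := by gcongr
      _ ≤ δ := e3
      _ ≤ _ := le_mul_of_one_le_right hδ.le (by linarith [abs_nonneg x])
  · refine (hCb θ h1 h2 h3 x).trans ?_
    have e1 : C * (θ 1)⁻¹ ≤ C / s := by rw [div_eq_mul_inv]; gcongr
    have e2 : C / s ≤ δ * (M / 2) := by
      have e : δ * ((2 * (C / s) / δ) / 2) = C / s := by field_simp
      rw [← e]
      have : 0 ≤ 2 * (500 * S' ^ (2 : ℝ)) / δ := by positivity
      gcongr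
      linarith
    refine e1.trans (e2.trans ?_)
    gcongr
    linarith

/-- The integral is the Hellinger affinity, equal to 1 minus half of ∫ (√f - √g)². By
identifiability the continuous integrand is positive somewhere. -/
lemma integral_sqrt_density_lt_one {θ : Param} (hσ : 0 < θ 1) (hα : 0 < θ 2) (hα2 : θ 2 ≤ 2)
    (hne : θ ≠ cauchyParam) :
    ∫ x, (density θ x / density cauchyParam x) ^ (1 / 2 : ℝ) ∂(law cauchyParam) < 1 := by
  have c1 : (0 : ℝ) < cauchyParam 1 := by simp [cauchyParam]
  have c2 : (0 : ℝ) < cauchyParam 2 := by simp [cauchyParam]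
  have c3 : cauchyParam 2 ≤ 2 := by simp [cauchyParam]
  have hnn := density_nonneg hσ hα hα2
  set f := density θ with hf
  set g := density cauchyParam with hg
  have hgpos : ∀ x, 0 < g x := density_cauchyParam_pos
  have hfc : Continuous f := continuous_density hσ hα
  have hgc : Continuous g := continuous_density c1 c2
  have hfi : Integrable f := integrable_density hσ hα hα2
  have hgi : Integrable g := integrable_density c1 c2 c3
  rw [integral_law_cauchyParam]
  have he : ∀ x, g x * (f x / g x) ^ (1 / 2 : ℝ) = √(f x) * √(g x) := fun x => by
    rw [← Real.sqrt_eq_rpow, Real.sqrt_div (hnn x)]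
    nth_rewrite 1 [← Real.mul_self_sqrt (hgpos x).le]
    have := (Real.sqrt_pos.2 (hgpos x)).ne'
    field_simp
  simp only [← hg, he]
  have hsq : ∀ x, (√(f x) - √(g x)) ^ 2 = f x + g x - 2 * (√(f x) * √(g x)) := fun x => by
    rw [sub_sq, Real.sq_sqrt (hnn x), Real.sq_sqrt (hgpos x).le]; ring
  have hmi : Integrable fun x => √(f x) * √(g x) := by
    refine (hfi.add hgi).mono' (by fun_prop) (ae_of_all _ fun x => ?_)
    rw [Real.norm_of_nonneg (by positivity), Pi.add_apply]
    nlinarith [hsq x, sq_nonneg (√(f x) - √(g x)), Real.sqrt_nonneg (f x), Real.sqrt_nonneg (g x),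
      hnn x, hgpos x]
  have hint : ∫ x, (√(f x) - √(g x)) ^ 2 = 2 - 2 * ∫ x, √(f x) * √(g x) := by
    simp only [hsq]
    rw [integral_sub (f := fun x => f x + g x) (hfi.add hgi) (hmi.const_mul 2), integral_add hfi hgi, integral_const_mul,
      integral_density hσ hα hα2, integral_density c1 c2 c3]
    norm_num
  have hpos : 0 < ∫ x, (√(f x) - √(g x)) ^ 2 := by
    obtain ⟨x, hx⟩ : ∃ x, f x ≠ g x := by
      by_contra! hcon
      exact hne (density_injective hσ hα hα2 c1 c2 c3 hcon)
    refine integral_pos_of_integrable_nonneg_nonzero (x := x) (by fun_prop) ?_ (fun x => sq_nonneg _) ?_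
    · simp only [hsq]
      exact (hfi.add hgi).sub (hmi.const_mul 2)
    · refine pow_ne_zero 2 (sub_ne_zero.2 fun h => hx ?_)
      rwa [Real.sqrt_inj (hnn x) (hgpos x).le] at h
  linarith

include hX hI in
-- Near θ₁ all ratios lie below one function `G r`, whose square root has a mean tending, as r → 0,
-- to the Hellinger affinity at θ₁, which is below 1.
lemma exists_excluded_nhds {ε : ℝ} (hε : 0 < ε) (hε1 : ε < 1) {θ₁ : Param} (h₁ : θ₁ ∈ paramSpace ε)
    (hne : θ₁ ≠ cauchyParam) : ∃ U ∈ 𝓝 θ₁, Excluded P X (U ∩ paramSpace ε) := by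
  obtain ⟨hσ, hα, hα2⟩ := h₁
  have hα0 : 0 < θ₁ 2 := hε.trans_le hα
  obtain ⟨C, hC, hCb⟩ := abs_density_le_envelope hε (half_pos hσ) (|θ₁ 0| + 1) (θ₁ 1 + 1)
  set H : ℝ → ℝ := fun x => C * (1 + |x|) ^ (-(1 + ε)) with hH
  have hH0 : ∀ x, 0 ≤ H x := fun x => by positivity
  -- Without the envelope `H` the constant `r` would make the square root grow like |x|, which is
  -- not integrable under the Cauchy law. With it the growth exponent is (1 - ε)/2.
  set G : ℝ → ℝ → ℝ := fun r x => min (density θ₁ x + r) (H x) / density cauchyParam x with hG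
  have hnn := density_nonneg hσ hα0 hα2
  have hG0 : ∀ r, 0 ≤ r → ∀ x, 0 ≤ G r x := fun r hr x =>
    div_nonneg (le_min (add_nonneg (hnn x) hr) (hH0 x)) (density_cauchyParam_pos x).le
  have hGm : ∀ r, Measurable (G r) := fun r =>
    (((measurable_density θ₁ hσ hα0 hα2).add_const r).min (by fun_prop)).div
      measurable_density_cauchyParam
  set E : ℝ → ℝ := fun x => (4 * C) ^ (1 / 2 : ℝ) * (1 + |x|) ^ ((1 - ε) / 2) with hE
  have hGE : ∀ r, 0 ≤ r → ∀ x, G r x ^ (1 / 2 : ℝ) ≤ E x := fun r hr x => by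
    have hx : 0 < 1 + |x| := by positivity
    have h1 : G r x ≤ 4 * C * (1 + |x|) ^ (1 - ε) := by
      calc G r x ≤ H x * (1 / density cauchyParam x) := by
            rw [hG, mul_one_div]
            have := density_cauchyParam_pos x
            dsimp only
            gcongr
            exact min_le_right _ _
        _ ≤ H x * (4 * (1 + |x|) ^ 2) := by
            exact mul_le_mul_of_nonneg_left (one_div_density_cauchyParam_le x) (hH0 x)
        _ = _ := by
            rw [hH, show 1 - ε = -(1 + ε) + 2 by ring, Real.rpow_add hx]
            norm_num
            ring
    calc _ ≤ (4 * C * (1 + |x|) ^ (1 - ε)) ^ (1 / 2 : ℝ) :=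
          Real.rpow_le_rpow (hG0 r hr x) h1 (by norm_num)
      _ = _ := by
          rw [hE, Real.mul_rpow (by positivity) (by positivity), ← Real.rpow_mul hx.le]
          ring_nf
  have hEi : Integrable E (law cauchyParam) :=
    integrable_law_of_le_rpow (K := (4 * C) ^ (1 / 2 : ℝ)) (r := (1 - ε) / 2)
      (Measurable.aestronglyMeasurable (by fun_prop)) (by linarith) fun x => by
        rw [hE, abs_of_nonneg (by positivity)]
  have hGi : ∀ r, 0 ≤ r → Integrable (fun x => G r x ^ (1 / 2 : ℝ)) (law cauchyParam) := fun r hr =>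
    hEi.mono' ((hGm r).pow_const _).aestronglyMeasurable (ae_of_all _ fun x => by
      rw [Real.norm_of_nonneg (Real.rpow_nonneg (hG0 r hr x) _)]
      exact hGE r hr x)
  have hmin : ∀ x, G 0 x = density θ₁ x / density cauchyParam x := fun x => by
    simp only [hG, add_zero]
    rw [min_eq_left]
    exact (le_abs_self _).trans (hCb θ₁ (by linarith) (by linarith) (by linarith) hα hα2 x)
  have hlim : Tendsto (fun r => ∫ x, G r x ^ (1 / 2 : ℝ) ∂(law cauchyParam)) (𝓝[>] 0)
      (𝓝 (∫ x, G 0 x ^ (1 / 2 : ℝ) ∂(law cauchyParam))) := by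
    refine tendsto_integral_filter_of_dominated_convergence E
      (Eventually.of_forall fun r => ((hGm r).pow_const _).aestronglyMeasurable) ?_ hEi ?_
    · filter_upwards [self_mem_nhdsWithin] with r hr
      refine ae_of_all _ fun x => ?_
      have hr' : 0 ≤ r := le_of_lt hr
      rw [Real.norm_of_nonneg (Real.rpow_nonneg (hG0 r hr' x) _)]
      exact hGE r hr' x
    · refine ae_of_all _ fun x => ?_
      have : Continuous fun r => G r x ^ (1 / 2 : ℝ) := by
        refine Continuous.rpow_const ?_ fun _ => Or.inr (by norm_num)
        simp only [hG]
        fun_prop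
      exact (this.tendsto 0).mono_left nhdsWithin_le_nhds
  have hlt : ∫ x, G 0 x ^ (1 / 2 : ℝ) ∂(law cauchyParam) < 1 := by
    simp only [hmin]
    exact integral_sqrt_density_lt_one hσ hα0 hα2 hne
  obtain ⟨r, hr1, hr2⟩ := ((hlim.eventually_lt_const hlt).and self_mem_nhdsWithin).exists
  have hr : 0 < r := hr2
  have n0 : ∀ᶠ θ : Param in 𝓝 θ₁, |θ 0| < |θ₁ 0| + 1 :=
    ((continuous_apply (0 : Fin 3)).abs.continuousAt (x := θ₁)).eventually_lt_const (by linarith)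
  have n1 : ∀ᶠ θ : Param in 𝓝 θ₁, θ₁ 1 / 2 < θ 1 :=
    ((continuous_apply (1 : Fin 3)).continuousAt (x := θ₁)).eventually_const_lt (by linarith)
  have n2 : ∀ᶠ θ : Param in 𝓝 θ₁, θ 1 < θ₁ 1 + 1 :=
    ((continuous_apply (1 : Fin 3)).continuousAt (x := θ₁)).eventually_lt_const (by linarith)
  refine ⟨_, (n0.and (n1.and (n2.and (eventually_abs_density_sub_le hσ hα0 hr)))), ?_⟩
  refine excluded_of_le (G := G r) (fun θ hθ x => density_nonneg hθ.2.1 (hε.trans_le hθ.2.2.1)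
    hθ.2.2.2 x) (fun θ hθ x => ?_)
    (tendsto_measure_one_le_prod hX hI (t := 1 / 2) (by norm_num) (hG0 r hr.le) (hGm r)
      (hGi r hr.le) hr1)
  obtain ⟨⟨k0, k1, k2, k3⟩, -, k4, k5⟩ := hθ
  have := density_cauchyParam_pos x
  simp only [hG]
  gcongr
  refine le_min ?_ ((le_abs_self _).trans (hCb θ k0.le k1.le k2.le k4 k5 x))
  linarith [(abs_le.1 (k3 x)).2]

include hX hI in
lemma excluded_compl_ball {ε δ : ℝ} (hε : 0 < ε) (hε1 : ε < 1) (hδ : 0 < δ) :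
    Excluded P X (paramSpace ε \ Metric.ball cauchyParam δ) := by
  obtain ⟨s, hs, h1⟩ := exists_excluded_scale_le hX hI hε
  obtain ⟨S, h2⟩ := exists_excluded_scale_ge hX hI hε
  obtain ⟨M, h3⟩ := exists_excluded_location_ge hX hI hε hs S
  -- What remains after excluding small and large scales and far locations is compact and avoids θ₀,
  -- so finitely many of the neighbourhoods from `exists_excluded_nhds` cover it.
  set K : Set Param := Set.Icc ![-M, s, ε] ![M, S, 2] \ Metric.ball cauchyParam δ with hK
  have hKc : IsCompact K := isCompact_Icc.diff Metric.isOpen_ball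
  have hKp : K ⊆ paramSpace ε := fun θ hθ => by
    obtain ⟨⟨a, b⟩, -⟩ := hθ
    have a1 := a 1
    have a2 := a 2
    have b2 := b 2
    simp only [Matrix.cons_val_one, Matrix.cons_val] at a1 a2 b2
    exact ⟨hs.trans_le a1, a2, b2⟩
  have h4 : Excluded P X K := by
    refine hKc.induction_on (p := Excluded P X) excluded_empty (fun S T hST hT => hT.mono hST)
      (fun S T hS hT => hS.union hT) fun θ hθ => ?_
    have hne : θ ≠ cauchyParam := fun h => hθ.2 (h ▸ Metric.mem_ball_self hδ)
    obtain ⟨U, hU, hex⟩ := exists_excluded_nhds hX hI hε hε1 (hKp hθ) hne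
    exact ⟨U ∩ K, Filter.inter_mem (mem_nhdsWithin_of_mem_nhds hU) self_mem_nhdsWithin, hex.mono (Set.inter_subset_inter_right _ hKp)⟩
  refine (((h1.union h2).union h3).union h4).mono ?_
  rintro θ ⟨hθ, hb⟩
  by_cases c1 : θ 1 ≤ s
  · exact Or.inl (Or.inl (Or.inl ⟨hθ, c1⟩))
  by_cases c2 : S ≤ θ 1
  · exact Or.inl (Or.inl (Or.inr ⟨hθ, c2⟩))
  rw [not_le] at c1 c2
  by_cases c3 : M ≤ |θ 0|
  · exact Or.inl (Or.inr ⟨hθ, c1.le, c2.le, c3⟩)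
  rw [not_le, abs_lt] at c3
  refine Or.inr ⟨⟨fun i => ?_, fun i => ?_⟩, hb⟩
  · fin_cases i
    · exact c3.1.le
    · exact c1.le
    · exact hθ.2.1
  · fin_cases i
    · exact c3.2.le
    · exact c2.le
    · exact hθ.2.2

lemma cauchyParam_mem_paramSpace {ε : ℝ} (hε1 : ε < 1) : cauchyParam ∈ paramSpace ε := by
  refine ⟨?_, ?_, ?_⟩ <;> simp [cauchyParam, hε1.le]

include hX hI in
/-- Consistency of the maximum likelihood estimators. -/
lemma tendsto_measure_not_mem_ball {ε δ : ℝ} (hε : 0 < ε) (hε1 : ε < 1) (hδ : 0 < δ)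
    {est : ℕ → Ω → Param}
    (hmle : Tendsto (fun n => P {ω | ¬ IsMLE ε n (fun j => X j ω) (est n ω)}) atTop (𝓝 0)) :
    Tendsto (fun n => P {ω | ¬ (IsMLE ε n (fun j => X j ω) (est n ω) ∧
      est n ω ∈ Metric.ball cauchyParam δ)}) atTop (𝓝 0) := by
  have h := hmle.add (excluded_compl_ball hX hI hε hε1 hδ)
  rw [add_zero] at h
  refine tendsto_of_tendsto_of_tendsto_of_le_of_le tendsto_const_nhds h (fun _ => zero_le)
    fun n => (measure_mono fun ω hω => ?_).trans (measure_union_le _ _)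
  by_cases h1 : IsMLE ε n (fun j => X j ω) (est n ω)
  · right
    have h2 : est n ω ∉ Metric.ball cauchyParam δ := fun h2 => hω ⟨h1, h2⟩
    refine ⟨est n ω, ⟨h1.1, h2⟩, ?_⟩
    rw [Finset.prod_div_distrib, one_le_div (Finset.prod_pos fun j _ => density_cauchyParam_pos _)]
    exact h1.2 (cauchyParam_mem_paramSpace hε1)
  · exact Or.inl h1
end

/-! ### Expansion of the score equation and the linear representation -/

section
variable {r K : ℝ} {m₁ : Fin 3 → Param → ℝ → ℝ} {m₂ : Fin 3 → Fin 3 → Param → ℝ → ℝ}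
  {m₃ : Fin 3 → Fin 3 → Fin 3 → Param → ℝ → ℝ}

/-- The mean value inequality is applied twice on a closed ball, first to the second derivatives and
then to the gradient minus its linearization. In the sup norm each application costs a factor 3,
hence the 9. -/
lemma LogDensityDerivs.abs_taylor_le (L : LogDensityDerivs r K m₁ m₂ m₃) {θ : Param}
    (hθ : θ ∈ Metric.ball cauchyParam r) (i : Fin 3) (x : ℝ) :
    |m₁ i θ x - m₁ i cauchyParam x - ∑ k, m₂ i k cauchyParam x * (θ k - cauchyParam k)| ≤
      9 * (K * (1 + |x|) ^ (9 / 32 : ℝ)) * ‖θ - cauchyParam‖ ^ 2 := by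
  set g : ℝ := K * (1 + |x|) ^ (9 / 32 : ℝ) with hg
  set ρ : ℝ := ‖θ - cauchyParam‖ with hρ
  have hsub : Metric.closedBall cauchyParam ρ ⊆ Metric.ball cauchyParam r :=
    Metric.closedBall_subset_ball (by rwa [hρ, ← dist_eq_norm])
  have h0 : cauchyParam ∈ Metric.closedBall cauchyParam ρ := Metric.mem_closedBall_self (norm_nonneg _)
  have hθ' : θ ∈ Metric.closedBall cauchyParam ρ := by rw [Metric.mem_closedBall, dist_eq_norm]
  have hconv := convex_closedBall cauchyParam ρ
  have hg0 : 0 ≤ g := (abs_nonneg _).trans (L.bound₃ 0 0 0 θ hθ x)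
  have hnorm : ∀ {u : Fin 3 → ℝ} {b : ℝ}, (∀ k, |u k| ≤ b) → ‖gradCLM u‖ ≤ 3 * b := by
    intro u b hu
    refine (norm_gradCLM_le u).trans ?_
    rw [Fin.sum_univ_three]
    have e0 := hu 0
    have e1 := hu 1
    have e2 := hu 2
    simp only [Real.norm_eq_abs]
    linarith
  have h2 : ∀ k, ∀ θ' ∈ Metric.closedBall cauchyParam ρ,
      |m₂ i k θ' x - m₂ i k cauchyParam x| ≤ 3 * g * ρ := by
    intro k θ' hθ'
    have := hconv.norm_image_sub_le_of_norm_hasFDerivWithin_le (𝕜 := ℝ) (C := 3 * g)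
      (f := fun θ => m₂ i k θ x) (fun θ'' h'' => (L.deriv₃ i k θ'' (hsub h'') x).hasFDerivWithinAt)
      (fun θ'' h'' => hnorm fun l => L.bound₃ i k l θ'' (hsub h'') x) h0 hθ'
    refine this.trans ?_
    rw [Metric.mem_closedBall, dist_eq_norm] at hθ'
    gcongr
  have hlin : ∀ θ' : Param, HasFDerivAt
      (fun θ : Param => ∑ k, m₂ i k cauchyParam x * (θ k - cauchyParam k))
      (gradCLM fun k => m₂ i k cauchyParam x) θ' := by
    intro θ'
    have := HasFDerivAt.fun_sum (u := Finset.univ) fun k (_ : k ∈ Finset.univ) =>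
      (((ContinuousLinearMap.proj (R := ℝ) (φ := fun _ : Fin 3 => ℝ) k).hasFDerivAt
        (x := θ')).sub_const (cauchyParam k)).const_mul (m₂ i k cauchyParam x)
    refine this.congr_fderiv ?_
    ext v
    simp [gradCLM_apply, Fin.sum_univ_three]
    ring
  have h3 := hconv.norm_image_sub_le_of_norm_hasFDerivWithin_le (𝕜 := ℝ) (C := 3 * (3 * g * ρ))
    (f := fun θ => m₁ i θ x - ∑ k, m₂ i k cauchyParam x * (θ k - cauchyParam k))
    (fun θ'' h'' => (hasFDerivAt_sub_gradCLM (L.deriv₂ i θ'' (hsub h'') x)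
      (hlin θ'')).hasFDerivWithinAt)
    (fun θ'' h'' => hnorm fun l => h2 l θ'' h'') h0 hθ'
  simp only [sub_self, mul_zero, Finset.sum_const_zero, sub_zero, Real.norm_eq_abs] at h3
  calc _ = |m₁ i θ x - ∑ k, m₂ i k cauchyParam x * (θ k - cauchyParam k) - m₁ i cauchyParam x| := by
        congr 1; ring
    _ ≤ _ := h3
    _ = _ := by rw [← hρ]; ring

/-- The ball of radius 1 - ε keeps the exponent above ε, so near θ every parameter is admissible.
The constrained maximum is then a local maximum and the gradient vanishes. -/
lemma LogDensityDerivs.sum_grad_eq_zero (L : LogDensityDerivs r K m₁ m₂ m₃) {ε : ℝ} {n : ℕ}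
    {x : ℕ → ℝ} {θ : Param} (hθ : θ ∈ Metric.ball cauchyParam r)
    (hθε : θ ∈ Metric.ball cauchyParam (1 - ε)) (h : IsMLE ε n x θ) (i : Fin 3) :
    ∑ j ∈ Finset.range n, m₁ i θ (x j) = 0 := by
  have hd : HasFDerivAt (fun θ => ∑ j ∈ Finset.range n, logDensity (x j) θ)
      (∑ j ∈ Finset.range n, gradCLM fun i => m₁ i θ (x j)) θ :=
    HasFDerivAt.fun_sum fun j _ => L.deriv₁ θ hθ (x j)
  have hlog : ∀ θ' ∈ Metric.ball cauchyParam r,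
      ∑ j ∈ Finset.range n, logDensity (x j) θ' = Real.log (likelihood n x θ') := fun θ' h' => by
    rw [likelihood, Real.log_prod fun j _ => (L.density_pos θ' h' (x j)).ne']
    rfl
  have hmax : IsLocalMax (fun θ => ∑ j ∈ Finset.range n, logDensity (x j) θ) θ := by
    filter_upwards [Metric.isOpen_ball.mem_nhds hθ, Metric.isOpen_ball.mem_nhds hθε] with θ' h1 h2
    rw [hlog θ' h1, hlog θ hθ]
    refine Real.log_le_log (Finset.prod_pos fun j _ => L.density_pos θ' h1 (x j)) (h.2 ?_)
    have h3 := L.subset h1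
    refine ⟨by linarith [h3.1], ?_, by linarith [h3.2.2.2]⟩
    rw [Metric.mem_ball, dist_eq_norm] at h2
    have h4 := (norm_le_pi_norm (θ' - cauchyParam) 2).trans_lt h2
    rw [Real.norm_eq_abs, Pi.sub_apply, abs_lt, show cauchyParam 2 = 1 from rfl] at h4
    linarith
  have h0 := hmax.hasFDerivAt_eq_zero hd
  have h1 := congrArg (fun l : Param →L[ℝ] ℝ => l (Pi.single i 1)) h0
  simpa [gradCLM_single] using h1

end

lemma Matrix.exists_norm_mulVec_le (M : Matrix (Fin 3) (Fin 3) ℝ) :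
    ∃ b : ℝ, 1 ≤ b ∧ ∀ y : Fin 3 → ℝ, ‖M.mulVec y‖ ≤ b * ‖y‖ := by
  refine ⟨1 + ∑ i, ∑ k, |M i k|, by
    have : 0 ≤ ∑ i, ∑ k, |M i k| := by positivity
    linarith, fun y => ?_⟩
  rw [pi_norm_le_iff_of_nonneg (by positivity)]
  intro i
  calc ‖M.mulVec y i‖ ≤ ∑ k, |M i k| * ‖y‖ := by
        rw [Matrix.mulVec, dotProduct]
        refine (norm_sum_le _ _).trans (Finset.sum_le_sum fun k _ => ?_)
        rw [norm_mul, Real.norm_eq_abs (M i k)]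
        gcongr
        exact norm_le_pi_norm y k
    _ = (∑ k, |M i k|) * ‖y‖ := by rw [Finset.sum_mul]
    _ ≤ _ := by
        gcongr
        have : ∑ k, |M i k| ≤ ∑ i, ∑ k, |M i k| :=
          Finset.single_le_sum (f := fun i => ∑ k, |M i k|) (fun i _ => by positivity)
            (Finset.mem_univ i)
        linarith

/-- Approximate solutions of an approximate linear equation are close to the exact solution. -/
lemma exists_norm_sub_mulVec_inv_le {J : Matrix (Fin 3) (Fin 3) ℝ} (hJ : IsUnit J.det) :
    ∃ B : ℝ, 0 < B ∧ ∀ (A : Matrix (Fin 3) (Fin 3) ℝ) (v S : Fin 3 → ℝ) (η : ℝ), 0 ≤ η →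
      B * η ≤ 1 / 2 → (∀ i, |S i + ∑ k, A i k * v k| ≤ η * ‖v‖) → (∀ i k, |A i k + J i k| ≤ η) →
      ‖v - J⁻¹.mulVec S‖ ≤ B * η * ‖S‖ := by
  obtain ⟨b, hb1, hb⟩ := Matrix.exists_norm_mulVec_le J⁻¹
  refine ⟨8 * b ^ 2, by positivity, fun A v S η hη hB h1 h2 => ?_⟩
  have hv := norm_nonneg v
  have hy : ‖J.mulVec v - S‖ ≤ 4 * η * ‖v‖ := by
    rw [pi_norm_le_iff_of_nonneg (by positivity)]
    intro i
    have e : (J.mulVec v - S) i = ∑ k, (A i k + J i k) * v k - (S i + ∑ k, A i k * v k) := by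
      rw [Pi.sub_apply, Matrix.mulVec, dotProduct]
      simp only [add_mul, Finset.sum_add_distrib]
      ring
    rw [e, Real.norm_eq_abs]
    have h3 : |∑ k, (A i k + J i k) * v k| ≤ 3 * (η * ‖v‖) := by
      refine (Finset.abs_sum_le_sum_abs _ _).trans ?_
      have : ∀ k ∈ Finset.univ, |(A i k + J i k) * v k| ≤ η * ‖v‖ := fun k _ => by
        rw [abs_mul]
        exact mul_le_mul (h2 i k) (norm_le_pi_norm v k) (abs_nonneg _) hη
      refine (Finset.sum_le_card_nsmul _ _ _ this).trans_eq ?_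
      simp
    have := h1 i
    exact (abs_sub _ _).trans (by linarith)
  have hw : v - J⁻¹.mulVec S = J⁻¹.mulVec (J.mulVec v - S) := by
    rw [Matrix.mulVec_sub, Matrix.mulVec_mulVec, Matrix.nonsing_inv_mul _ hJ, Matrix.one_mulVec]
  have h4 : ‖v - J⁻¹.mulVec S‖ ≤ 4 * b * η * ‖v‖ := by
    rw [hw]
    refine (hb _).trans ?_
    calc b * ‖J.mulVec v - S‖ ≤ b * (4 * η * ‖v‖) := by gcongr
      _ = _ := by ring
  have h5 : ‖v‖ ≤ ‖v - J⁻¹.mulVec S‖ + ‖J⁻¹.mulVec S‖ := by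
    simpa using norm_add_le (v - J⁻¹.mulVec S) (J⁻¹.mulVec S)
  have h6 := hb S
  -- Half of ‖v‖ is absorbed on the left, which gives ‖v‖ ≤ 2b‖S‖ and explains B = 4b · 2b.
  have h7 : 4 * b * η * ‖v‖ ≤ 1 / 2 * ‖v‖ := by
    gcongr
    nlinarith [mul_nonneg hη (sub_nonneg.2 hb1), mul_nonneg (mul_nonneg hη (sub_nonneg.2 hb1)) (by linarith : 0 ≤ b)]
  have h8 : ‖v‖ ≤ 2 * b * ‖S‖ := by linarith
  calc _ ≤ 4 * b * η * ‖v‖ := h4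
    _ ≤ 4 * b * η * (2 * b * ‖S‖) := by gcongr
    _ = _ := by ring

section
variable {Ω : Type*} [MeasurableSpace Ω] {P : Measure Ω} {X : ℕ → Ω → ℝ}
variable (hX : ∀ j, HasLaw (X j) (law cauchyParam) P) (hI : iIndepFun X P)

include hX hI in
lemma tendsto_measure_mean_sub [IsProbabilityMeasure P] {g : ℝ → ℝ} (hg : Measurable g)
    (hgi : Integrable g (law cauchyParam)) {η : ℝ} (hη : 0 < η) :
    Tendsto (fun n : ℕ => P {ω | η ≤ |(∑ j ∈ Finset.range n, g (X j ω)) / n -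
      ∫ x, g x ∂(law cauchyParam)|}) atTop (𝓝 0) := by
  have hint : Integrable (fun ω => g (X 0 ω)) P :=
    Integrable.comp_aemeasurable (by rwa [(hX 0).map_eq]) (hX 0).aemeasurable
  have h1 := strong_law_ae_real (fun j ω => g (X j ω)) hint
    (fun i j hij => (hI.indepFun hij).comp hg hg)
    (fun j => ((hX j).identDistrib (hX 0)).comp hg)
  have h2 : ∫ ω, g (X 0 ω) ∂P = ∫ x, g x ∂(law cauchyParam) :=
    (hX 0).integral_comp hg.aestronglyMeasurable
  rw [h2] at h1
  have h3 := tendstoInMeasure_of_tendsto_ae (fun n => ?_) h1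
  · rw [tendstoInMeasure_iff_norm] at h3
    simpa only [Real.norm_eq_abs] using h3 η hη
  · exact ((Finset.aemeasurable_fun_sum _ fun j _ =>
      hg.comp_aemeasurable (hX j).aemeasurable).div_const _).aestronglyMeasurable

include hX hI in
-- Chebyshev's inequality for a sum of n independent centred scores. The bound does not depend on n,
-- so it gives tightness of the normalized score.
lemma measure_sum_score_ge_le [IsProbabilityMeasure P] (i : Fin 3) {T : ℝ} (hT : 0 < T) {n : ℕ} (hn : 0 < n) :
    P {ω | T * √n ≤ |∑ j ∈ Finset.range n, cauchyScore i (X j ω)|} ≤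
      ENNReal.ofReal (Var[fun ω => cauchyScore i (X 0 ω); P] / T ^ 2) := by
  have hm := measurable_cauchyScore i
  have hL : ∀ j, MemLp (fun ω => cauchyScore i (X j ω)) 2 P := fun j =>
    MemLp.comp_of_map (g := cauchyScore i) (f := X j) (by rw [(hX j).map_eq]; exact memLp_cauchyScore i) (hX j).aemeasurable
  have hE : ∀ j, ∫ ω, cauchyScore i (X j ω) ∂P = 0 := fun j =>
    ((hX j).integral_comp hm.aestronglyMeasurable).trans (integral_cauchyScore i)
  have hsum : MemLp (∑ j ∈ Finset.range n, fun ω => cauchyScore i (X j ω)) 2 P :=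
    memLp_finsetSum' _ fun j _ => hL j
  have hvar : Var[∑ j ∈ Finset.range n, fun ω => cauchyScore i (X j ω); P] =
      n * Var[fun ω => cauchyScore i (X 0 ω); P] := by
    have hv : ∀ j, Var[fun ω => cauchyScore i (X j ω); P] = Var[fun ω => cauchyScore i (X 0 ω); P] :=
      fun j => (((hX j).identDistrib (hX 0)).comp hm).variance_eq
    rw [IndepFun.variance_sum (fun j _ => hL j)
      (fun j _ k _ hjk => (hI.indepFun hjk).comp hm hm), Finset.sum_congr rfl fun j _ => hv j,
      Finset.sum_const, Finset.card_range, nsmul_eq_mul]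
  have hn' : (0 : ℝ) < n := by exact_mod_cast hn
  have h := meas_ge_le_variance_div_sq hsum (c := T * √n) (by positivity)
  have hE' : ∫ ω, (∑ j ∈ Finset.range n, fun ω => cauchyScore i (X j ω)) ω ∂P = 0 := by
    simp only [Finset.sum_apply]
    rw [integral_finsetSum _ fun j _ => (hL j).integrable one_le_two]
    simp [hE]
  rw [hE', hvar, mul_pow, Real.sq_sqrt hn'.le, mul_comm (T ^ 2), mul_div_mul_left _ _ hn'.ne'] at h
  simpa only [Finset.sum_apply, sub_zero] using h
end

lemma linearRep_one (x : ℝ) :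
    linearRep 1 x = cauchyInfo⁻¹.mulVec fun i => cauchyScore i x := by
  unfold linearRep
  rw [show (![0, 1, 1] : Param) = cauchyParam from rfl, fisherInfo_cauchyParam]
  congr 1
  ext i
  rw [score_cauchy, Complex.ofReal_re]

/-- The deterministic expansion of a maximum likelihood estimate near the Cauchy parameter. -/
lemma LogDensityDerivs.exists_expansion {r K : ℝ} {f₁ : Fin 3 → Param → ℝ → ℝ}
    {m₂ : Fin 3 → Fin 3 → Param → ℝ → ℝ} {m₃ : Fin 3 → Fin 3 → Fin 3 → Param → ℝ → ℝ}
    (hf₁ : ∀ i θ x, f₁ i θ x = 1 / Real.pi * (kernIntGrad 0 0 0 x θ i).re)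
    (L : LogDensityDerivs r K (logGrad f₁) m₂ m₃) :
    ∃ B : ℝ, 0 < B ∧ ∀ (ε : ℝ) (n : ℕ) (x : ℕ → ℝ) (θ : Param) (η g δ : ℝ), 0 < n → 0 ≤ η →
      B * η ≤ 1 / 2 → 9 * g * δ ≤ η → 0 ≤ g → ‖θ - cauchyParam‖ ≤ δ →
      θ ∈ Metric.ball cauchyParam r → θ ∈ Metric.ball cauchyParam (1 - ε) → IsMLE ε n x θ →
      (∑ j ∈ Finset.range n, K * (1 + |x j|) ^ (9 / 32 : ℝ)) / n ≤ g →
      (∀ i k, |(∑ j ∈ Finset.range n, m₂ i k cauchyParam (x j)) / n + cauchyInfo i k| ≤ η) →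
      ∀ i, |√n * (θ i - cauchyParam i) - 1 / √n * ∑ j ∈ Finset.range n, linearRep 1 (x j) i| ≤
        B * η * ‖fun i => 1 / √n * ∑ j ∈ Finset.range n, cauchyScore i (x j)‖ := by
  obtain ⟨B, hB, h⟩ := exists_norm_sub_mulVec_inv_le isUnit_det_cauchyInfo
  refine ⟨B, hB, fun ε n x θ η g δ hn hη hBη hgη hg hδ hr hε hmle hG hA i => ?_⟩
  have hn' : (0 : ℝ) < n := by exact_mod_cast hn
  have hs : 0 < √(n : ℝ) := Real.sqrt_pos.2 hn'
  have hss : √(n : ℝ) * √n = n := Real.mul_self_sqrt hn'.le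
  set S : Fin 3 → ℝ := fun i => 1 / √n * ∑ j ∈ Finset.range n, cauchyScore i (x j) with hS
  set A : Matrix (Fin 3) (Fin 3) ℝ :=
    Matrix.of fun i k => (∑ j ∈ Finset.range n, m₂ i k cauchyParam (x j)) / n with hAdef
  set d : Param := θ - cauchyParam with hd
  set v : Fin 3 → ℝ := √(n : ℝ) • d with hv
  have hvn : ‖v‖ = √n * ‖d‖ := by rw [hv, norm_smul, Real.norm_of_nonneg hs.le]
  -- The score equation makes the left side a normalized sum of Taylor remainders, at most √n ·
  -- 9g‖d‖² = 9g‖d‖ · ‖v‖. One factor ‖d‖ ≤ δ is spent to reach η, the other stays in ‖v‖, so no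
  -- rate for the estimator is presupposed.
  have h1 : ∀ i, |S i + ∑ k, A i k * v k| ≤ η * ‖v‖ := by
    intro i
    have e0 := L.sum_grad_eq_zero hr hε hmle i
    have e1 : ∑ j ∈ Finset.range n, (cauchyScore i (x j) + ∑ k, m₂ i k cauchyParam (x j) * d k) =
        -∑ j ∈ Finset.range n, (logGrad f₁ i θ (x j) - logGrad f₁ i cauchyParam (x j) -
          ∑ k, m₂ i k cauchyParam (x j) * (θ k - cauchyParam k)) := by
      simp only [logGrad_cauchyParam hf₁, Finset.sum_sub_distrib, e0, Finset.sum_add_distrib, hd,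
        Pi.sub_apply]
      ring
    have e2 : S i + ∑ k, A i k * v k =
        1 / √n * ∑ j ∈ Finset.range n, (cauchyScore i (x j) + ∑ k, m₂ i k cauchyParam (x j) * d k) := by
      rw [Finset.sum_add_distrib, mul_add, Finset.sum_comm, Finset.mul_sum (s := Finset.univ)]
      congr 1
      refine Finset.sum_congr rfl fun k _ => ?_
      rw [hAdef, Matrix.of_apply, hv, Pi.smul_apply, smul_eq_mul, ← Finset.sum_mul]
      nth_rewrite 1 [← hss]
      field_simp
    have e3 : |∑ j ∈ Finset.range n, (logGrad f₁ i θ (x j) - logGrad f₁ i cauchyParam (x j) -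
          ∑ k, m₂ i k cauchyParam (x j) * (θ k - cauchyParam k))| ≤ n * (9 * g * ‖d‖ ^ 2) := by
      refine (Finset.abs_sum_le_sum_abs _ _).trans ?_
      refine (Finset.sum_le_sum fun j _ => L.abs_taylor_le hr i (x j)).trans ?_
      rw [← Finset.sum_mul, ← Finset.mul_sum]
      rw [div_le_iff₀ hn'] at hG
      calc _ ≤ 9 * (g * n) * ‖d‖ ^ 2 := by gcongr
        _ = _ := by ring
    rw [e2, e1, mul_neg, abs_neg, abs_mul, abs_of_pos (by positivity)]
    calc _ ≤ 1 / √n * (n * (9 * g * ‖d‖ ^ 2)) := by gcongr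
      _ = 9 * g * ‖d‖ * (√n * ‖d‖) := by
          nth_rewrite 2 [← hss]
          field_simp
      _ ≤ 9 * g * δ * (√n * ‖d‖) := by gcongr
      _ ≤ η * ‖v‖ := by rw [hvn]; gcongr
  have h2 := h A v S η hη hBη h1 hA
  have h3 := (norm_le_pi_norm (v - cauchyInfo⁻¹.mulVec S) i).trans h2
  have e4 : (v - cauchyInfo⁻¹.mulVec S) i =
      √n * (θ i - cauchyParam i) - 1 / √n * ∑ j ∈ Finset.range n, linearRep 1 (x j) i := by
    simp only [Pi.sub_apply, hv, hd, Pi.smul_apply, smul_eq_mul, linearRep_one, hS, Matrix.mulVec,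
      dotProduct]
    congr 1
    rw [Finset.sum_comm, Finset.mul_sum]
    refine Finset.sum_congr rfl fun k _ => ?_
    rw [← Finset.mul_sum]
    ring
  rwa [e4, Real.norm_eq_abs] at h3

/-- Constants are chosen in turn: `T` from tightness of the normalized score, `η` so that BηT < κ,
and `δ` so that the Taylor remainder is within `η`. Outside events of small probability,
`LogDensityDerivs.exists_expansion` bounds the error by BηT < κ. -/
theorem hasALRep_cauchyParam {Ω : Type*} [MeasurableSpace Ω] {P : Measure Ω} [IsProbabilityMeasure P]
    {X : ℕ → Ω → ℝ} {est : ℕ → Ω → Param} {ε : ℝ} (hε : 0 < ε) (hε1 : ε < 1)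
    (hX : ∀ j, HasLaw (X j) (law cauchyParam) P) (hI : iIndepFun X P)
    (hmle : Tendsto (fun n => P {ω | ¬ IsMLE ε n (fun j => X j ω) (est n ω)}) atTop (𝓝 0)) :
    HasALRep P X est cauchyParam (linearRep 1) := by
  obtain ⟨f₁, f₂, f₃, C, D, hf₁⟩ := exists_densityDerivs
  obtain ⟨r, K, L⟩ := D.logDensityDerivs
  obtain ⟨B, hB, hexp⟩ := L.exists_expansion hf₁
  intro i
  rw [tendstoInMeasure_iff_norm]
  intro κ hκ
  simp only [sub_zero, Real.norm_eq_abs]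
  rw [ENNReal.tendsto_nhds_zero]
  intro ρ hρ
  set V : Fin 3 → ℝ := fun i => Var[fun ω => cauchyScore i (X 0 ω); P] with hV
  obtain ⟨T, hT, hTρ⟩ : ∃ T : ℝ, 0 < T ∧ ∑ i, ENNReal.ofReal (V i / T ^ 2) ≤ ρ / 2 := by
    have hlim : Tendsto (fun T : ℝ => ∑ i, ENNReal.ofReal (V i / T ^ 2)) atTop (𝓝 0) := by
      rw [show (0 : ENNReal) = ∑ _i : Fin 3, ENNReal.ofReal 0 by simp]
      refine tendsto_finsetSum _ fun i _ => (ENNReal.continuous_ofReal.tendsto 0).comp ?_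
      exact tendsto_const_nhds.div_atTop (tendsto_pow_atTop two_ne_zero)
    have h1 := (ENNReal.tendsto_nhds_zero.1 hlim) (ρ / 2) (ENNReal.half_pos hρ.ne')
    obtain ⟨T, h2, h3⟩ := (h1.and (eventually_gt_atTop 0)).exists
    exact ⟨T, h3, h2⟩
  set η : ℝ := min (1 / (2 * B)) (κ / (2 * B * T)) with hη
  have hη0 : 0 < η := by positivity
  have hBη : B * η ≤ 1 / 2 := by
    calc B * η ≤ B * (1 / (2 * B)) := by gcongr; exact min_le_left _ _
      _ = 1 / 2 := by field_simp
  have hBηT : B * η * T < κ := by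
    calc B * η * T ≤ B * (κ / (2 * B * T)) * T := by gcongr; exact min_le_right _ _
      _ = κ / 2 := by field_simp
      _ < κ := half_lt_self hκ
  set G : ℝ → ℝ := fun x => K * (1 + |x|) ^ (9 / 32 : ℝ) with hG
  have hG0 : ∀ x, 0 ≤ G x := fun x => (abs_nonneg _).trans (L.bound₂ 0 0 x)
  have hGm : Measurable G := by fun_prop
  have hGi : Integrable G (law cauchyParam) :=
    integrable_law_of_le_rpow hGm.aestronglyMeasurable (by norm_num)
      fun x => (abs_of_nonneg (hG0 x)).le
  -- The added 1 is the slack for the law of large numbers applied to the Taylor majorant.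
  set g : ℝ := ∫ x, G x ∂(law cauchyParam) + 1 with hg
  have hg0 : 0 < g := by
    have : 0 ≤ ∫ x, G x ∂(law cauchyParam) := integral_nonneg hG0
    linarith
  set δ : ℝ := min (η / (9 * g)) (min r (1 - ε)) with hδ
  have hr := L.radius_pos
  have hδ0 : 0 < δ := lt_min (by positivity) (lt_min hr (by linarith))
  have hgδ : 9 * g * δ ≤ η := by
    calc 9 * g * δ ≤ 9 * g * (η / (9 * g)) := by gcongr; exact min_le_left _ _
      _ = η := by field_simp
  have t1 := tendsto_measure_not_mem_ball hX hI hε hε1 hδ0 hmle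
  have t2 := tendsto_measure_mean_sub hX hI hGm hGi one_pos
  have t3 := fun p : Fin 3 × Fin 3 =>
    tendsto_measure_mean_sub hX hI (L.measurable₂ p.1 p.2) (L.integrable_hess p.1 p.2) hη0
  have t4 := (t1.add t2).add (tendsto_finsetSum Finset.univ fun p _ => t3 p)
  simp only [add_zero, Finset.sum_const_zero] at t4
  filter_upwards [(ENNReal.tendsto_nhds_zero.1 t4) (ρ / 2) (ENNReal.half_pos hρ.ne'),
    eventually_gt_atTop 0] with n hn hn0
  have hs : 0 < √(n : ℝ) := Real.sqrt_pos.2 (by exact_mod_cast hn0)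
  -- Four ways to fail: no nearby maximizer, a large mean of the Taylor majorant, an average Hessian
  -- far from its mean, or a large score sum. The first three have vanishing probability; the last
  -- is controlled only through the choice of `T`.
  have hsub : {ω | κ ≤ |√n * (est n ω i - cauchyParam i) -
      1 / √n * ∑ j ∈ Finset.range n, linearRep 1 (X j ω) i|} ⊆
      (({ω | ¬ (IsMLE ε n (fun j => X j ω) (est n ω) ∧ est n ω ∈ Metric.ball cauchyParam δ)} ∪
        {ω | 1 ≤ |(∑ j ∈ Finset.range n, G (X j ω)) / n - ∫ x, G x ∂(law cauchyParam)|}) ∪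
        ⋃ p : Fin 3 × Fin 3, {ω | η ≤ |(∑ j ∈ Finset.range n, logHess f₁ f₂ p.1 p.2 cauchyParam (X j ω)) / n -
          ∫ x, logHess f₁ f₂ p.1 p.2 cauchyParam x ∂(law cauchyParam)|}) ∪
        ⋃ i, {ω | T * √n ≤ |∑ j ∈ Finset.range n, cauchyScore i (X j ω)|} := by
    intro ω hω
    by_contra hcon
    simp only [Set.mem_union, Set.mem_iUnion, Set.mem_ofPred_eq, not_or, not_exists, not_not, not_le]
      at hcon
    obtain ⟨⟨⟨⟨k1, k2⟩, k3⟩, k4⟩, k5⟩ := hcon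
    have hb1 : est n ω ∈ Metric.ball cauchyParam r :=
      Metric.ball_subset_ball ((min_le_right _ _).trans (min_le_left _ _)) k2
    have hb2 : est n ω ∈ Metric.ball cauchyParam (1 - ε) :=
      Metric.ball_subset_ball ((min_le_right _ _).trans (min_le_right _ _)) k2
    rw [Metric.mem_ball, dist_eq_norm] at k2
    have hx := hexp ε n (fun j => X j ω) (est n ω) η g δ hn0 hη0.le hBη hgδ hg0.le k2.le hb1 hb2 k1
      (by have := (abs_lt.1 k3).2
          simp only [hG] at this
          linarith)
      (fun i k => by
        have := k4 (i, k)
        rw [D.integral_logHess hf₁, sub_neg_eq_add] at this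
        exact this.le) i
    have hS : ‖fun i => 1 / √n * ∑ j ∈ Finset.range n, cauchyScore i (X j ω)‖ ≤ T := by
      rw [pi_norm_le_iff_of_nonneg hT.le]
      intro i
      rw [norm_mul, Real.norm_of_nonneg (by positivity), Real.norm_eq_abs, one_div_mul_eq_div,
        div_le_iff₀ hs]
      exact (k5 i).le
    have hω' : κ ≤ _ := hω
    have : B * η * ‖fun i => 1 / √n * ∑ j ∈ Finset.range n, cauchyScore i (X j ω)‖ ≤ B * η * T := by
      gcongr
    linarith
  calc _ ≤ _ := measure_mono hsub
    _ ≤ ρ / 2 + ρ / 2 := by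
        refine (measure_union_le _ _).trans (add_le_add ?_ ?_)
        · refine le_trans ?_ hn
          refine (measure_union_le _ _).trans (add_le_add (measure_union_le _ _) ?_)
          exact measure_iUnion_fintype_le _ _
        · refine (measure_iUnion_fintype_le _ _).trans (le_trans ?_ hTρ)
          exact Finset.sum_le_sum fun i _ => measure_sum_score_ge_le hX hI i hT hn0
    _ = ρ := ENNReal.add_halves ρ

end SymmStable

end

theorem mainTheorem6 :
    -- the scores: well defined, equal to the partial derivatives of the log-density, closed forms
    (∀ x : ℝ,
      0 < SymmStable.density SymmStable.cauchyParam x ∧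
      ContDiffAt ℝ 2 (SymmStable.logDensity x) SymmStable.cauchyParam ∧
      (∀ i : Fin 3, Integrable (SymmStable.scoreIntegrand 1 x i) volume) ∧
      (∀ i : Fin 3, SymmStable.score 1 x i =
        ((SymmStable.partialDeriv i (SymmStable.logDensity x) SymmStable.cauchyParam : ℝ) : ℂ)) ∧
      SymmStable.score 1 x 0 = ((2 * x / (x ^ 2 + 1) : ℝ) : ℂ) ∧
      SymmStable.score 1 x 1 = (((x ^ 2 - 1) / (x ^ 2 + 1) : ℝ) : ℂ) ∧
      SymmStable.score 1 x 2 =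
        (((1 - x ^ 2) / (x ^ 2 + 1) *
            (1 / 2 * Real.log (x ^ 2 + 1) - 1 + Real.eulerMascheroniConstant) +
          2 * x / (x ^ 2 + 1) * Real.arctan x : ℝ) : ℂ)) ∧
    -- the Fisher information matrix
    (∀ i j : Fin 3, Integrable (SymmStable.logDensityHess SymmStable.cauchyParam i j)
      (SymmStable.law SymmStable.cauchyParam)) ∧
    SymmStable.fisherInfo SymmStable.cauchyParam =
      !![1 / 2, 0, 0;
         0, 1 / 2, (1 - Real.eulerMascheroniConstant - Real.log 2) / 2;
         0, (1 - Real.eulerMascheroniConstant - Real.log 2) / 2,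
           (Real.pi ^ 2 / 6 + (Real.eulerMascheroniConstant + Real.log 2 - 1) ^ 2) / 2] ∧
    -- the asymptotically linear representation of the maximum likelihood estimator
    (∀ {Ω : Type*} [MeasurableSpace Ω] (P : Measure Ω) [IsProbabilityMeasure P]
      (X : ℕ → Ω → ℝ) (est : ℕ → Ω → SymmStable.Param) (ε : ℝ),
      0 < ε → ε < 1 →
      (∀ j, HasLaw (X j) (SymmStable.law SymmStable.cauchyParam) P) →
      iIndepFun X P →
      Tendsto (fun n => P {ω | ¬ SymmStable.IsMLE ε n (fun j => X j ω) (est n ω)})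
        atTop (𝓝 0) →
      SymmStable.HasALRep P X est SymmStable.cauchyParam (SymmStable.linearRep 1)) := by
  refine ⟨fun x => ?_, fun i j => ?_, SymmStable.fisherInfo_cauchyParam,
    fun P _ X est ε hε hε1 hX hI hmle => SymmStable.hasALRep_cauchyParam hε hε1 hX hI hmle⟩
  all_goals
    obtain ⟨f₁, f₂, f₃, C, D, hf₁⟩ := SymmStable.exists_densityDerivs
    obtain ⟨r, K, L⟩ := D.logDensityDerivs
  · refine ⟨SymmStable.density_cauchyParam_pos x, L.contDiffAt x,
      fun i => (SymmStable.integral_scoreIntegrand x i).1, fun i => ?_,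
      SymmStable.score_cauchy x 0, SymmStable.score_cauchy x 1, SymmStable.score_cauchy x 2⟩
    rw [SymmStable.score_cauchy, L.partialDeriv_logDensity (Metric.mem_ball_self L.radius_pos),
      SymmStable.logGrad_cauchyParam hf₁]
  · rw [show SymmStable.logDensityHess SymmStable.cauchyParam i j = _ from
      funext fun x => L.logDensityHess_eq x i j]
    exact L.integrable_hess j i
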